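/- **Setting.** A *weakly conical end* is a triple $(\Sigma^n,g,r)$ of a smooth $n$-manifold $\Sigma$, $n\ge 2$, a $C^1$ Riemannian metric $g$ and a proper unbounded $C^2$ function $r:\Sigma\to(R_\Sigma,\infty)$, $R_\Sigma\ge 1$, such that for a constant $\Lambda\ge 0$ $$\big||\nabla_g r|-1\big|\le \frac{\Lambda}{r^4}\le\frac12,\qquad |\nabla_g^2r^2-2g|\le\frac{\Lambda}{r^2}\le\frac12 ,$$ where the second norm is the norm as a bilinear form. Write $E_R=\{r>R\}$, $\partial_r=\nabla_g r$, $\mathbf X=r\,\nabla_g r/|\nabla_g r|^2$, and for $\tau\ge1$ let $\Pi_\tau:\Sigma\to\Sigma$ be the time $\ln\tau$ flow of $\mathbf X$. The *asymptotic cone metric* of the end is the $C^0$ Riemannian metric $g_C=\lim_{\tau\to\infty}\tau^{-2}\Pi_\tau^*g$ (limit in $C^0_{loc}(\Sigma)$); let $\mu_C$ be its Riemannian measure and $\mu_g$ that of $g$. A function $F\in L^2_{loc}(\Sigma;\mu_C)$ is *homogeneous of degree $d$* if $\Pi_\tau^*(r^{-d}F)=r^{-d}F$ almost everywhere for every $\tau\ge1$.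 A function $G\in L^2_{loc}(\Sigma;\mu_g)$ is *asymptotically homogeneous of degree $d$ with leading term $F$* if $F$ is homogeneous of degree $d$ and $\Pi_\tau^*(r^{-d}G)\to r^{-d}F$ in $L^2_{loc}(\Sigma;\mu_C)$ as $\tau\to\infty$. **Proposition.** For all $n$ and $\Lambda$ there is a constant $R_1=R_1(n,\Lambda)$ such that the following holds for every weakly conical end $(\Sigma^n,g,r)$ with constant $\Lambda$. The asymptotic cone metric $g_C$ exists. Moreover, if $G\in C^1(\Sigma)$, $\alpha\in\mathbb R$ and $R_H\ge R_\Sigma$ satisfy $$\int_{E_R} \left(r^{-n}|\nabla_g G|^2+r^{2-n}(\partial_rG)^2\right)d\mu_g\le\alpha^2R^{-2}\qquad\text{for all }R\ge R_H,$$ then $G$ is asymptotically homogeneous of degree $0$, and if $F$ is its leading term, then $F\in H^1_{loc}(\Sigma)$ and $$\int_{E_R} r^{-n}|F-G|^2\,d\mu_g\le 16\,\alpha^2R^{-2}\qquad\text{for all }R\ge\max\{R_H,R_1\}.$$ -/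

import Mathlib

open Set Filter Topology MeasureTheory
open scoped Manifold ContDiff ENNReal Matrix

namespace WeaklyConical

noncomputable section

variable {n : ℕ} {M : Type*} [TopologicalSpace M] [ChartedSpace (EuclideanSpace ℝ (Fin n)) M]

/-! ### Metrics in coordinates and the Riemannian measure -/

/-- A field `β` of (bilinear) forms on the tangent spaces of `M`, not necessarily continuous. -/
abbrev FormField (n : ℕ) (M : Type*) [TopologicalSpace M]
    [ChartedSpace (EuclideanSpace ℝ (Fin n)) M] :=
  ∀ p : M, TangentSpace (𝓡 n) p → TangentSpace (𝓡 n) p → ℝ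

/-- The space of `C¹` Riemannian metrics on `M`. -/
abbrev C1Metric (n : ℕ) (M : Type*) [TopologicalSpace M]
    [ChartedSpace (EuclideanSpace ℝ (Fin n)) M] [IsManifold (𝓡 n) ∞ M] :=
  Bundle.ContMDiffRiemannianMetric (𝓡 n) 1 (EuclideanSpace ℝ (Fin n))
    (fun p : M => TangentSpace (𝓡 n) p)

/-- The space of `C⁰` Riemannian metrics on `M`. -/
abbrev C0Metric (n : ℕ) (M : Type*) [TopologicalSpace M]
    [ChartedSpace (EuclideanSpace ℝ (Fin n)) M] [IsManifold (𝓡 n) ∞ M] :=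
  Bundle.ContinuousRiemannianMetric (EuclideanSpace ℝ (Fin n))
    (fun p : M => TangentSpace (𝓡 n) p)

/-- The form field `(v, w) ↦ g(v, w)` of a `C¹` metric. -/
def formC1 [IsManifold (𝓡 n) ∞ M] (g : C1Metric n M) : FormField n M :=
  fun p v w => g.inner p v w

/-- The form field `(v, w) ↦ g(v, w)` of a `C⁰` metric. -/
def formC0 [IsManifold (𝓡 n) ∞ M] (g : C0Metric n M) : FormField n M :=
  fun p v w => g.inner p v w

/-- The matrix `β_{ij}(x) = β(∂_i, ∂_j)` of a form field in the coordinates of a chart `φ`;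
meaningful for `x ∈ φ.target`. -/
def coordMatrix (β : FormField n M) (φ : OpenPartialHomeomorph M (EuclideanSpace ℝ (Fin n)))
    (x : EuclideanSpace ℝ (Fin n)) : Matrix (Fin n) (Fin n) ℝ :=
  Matrix.of fun i j => β (φ.symm x)
    (mfderiv (𝓡 n) (𝓡 n) φ.symm x (EuclideanSpace.single i (1 : ℝ)))
    (mfderiv (𝓡 n) (𝓡 n) φ.symm x (EuclideanSpace.single j (1 : ℝ)))

/-- The Riemannian measure of the part of `M` covered by the chart `φ`: the push-forward to `M` of
`√(det β_{ij}) dx` on `φ.target`. -/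
def chartVolume [MeasurableSpace M] (β : FormField n M)
    (φ : OpenPartialHomeomorph M (EuclideanSpace ℝ (Fin n))) : Measure M :=
  ((volume.restrict φ.target).withDensity
    fun x => ENNReal.ofReal (Real.sqrt (coordMatrix β φ x).det)).map φ.symm

/-- The Riemannian measure `dμ` of a metric. The measures `chartVolume β φ` agree on the overlaps
of charts, and the measure glued from them is their least upper bound. -/
def riemannianVolume [MeasurableSpace M] (β : FormField n M) : Measure M :=
  ⨆ φ ∈ atlas (EuclideanSpace ℝ (Fin n)) M, chartVolume β φ

/-! ### Gradient and Hessian for a `C¹` metric -/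

/-- The differential of a real function, as a covector. -/
def differential (f : M → ℝ) (p : M) : TangentSpace (𝓡 n) p →L[ℝ] ℝ :=
  mfderiv (𝓡 n) 𝓘(ℝ, ℝ) f p

/-- The gradient `∇_g f`: the vector with `g(∇_g f, w) = df(w)` for all `w`. -/
def grad [IsManifold (𝓡 n) ∞ M] (g : C1Metric n M) (f : M → ℝ) (p : M) : TangentSpace (𝓡 n) p :=
  (g.inner p).inverse (differential f p)

/-- `|∇_g f|²`. -/
def normGradSq [IsManifold (𝓡 n) ∞ M] (g : C1Metric n M) (f : M → ℝ) (p : M) : ℝ :=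
  g.inner p (grad g f p) (grad g f p)

/-- `∂_r G = g(∇_g r, ∇_g G)`, the derivative of `G` along `∂_r = ∇_g r`. -/
def radialDeriv [IsManifold (𝓡 n) ∞ M] (g : C1Metric n M) (r G : M → ℝ) (p : M) : ℝ :=
  differential G p (grad g r p)

/-- The `i`-th partial derivative of a function on `ℝⁿ`. -/
def partialDeriv (i : Fin n) (f : EuclideanSpace ℝ (Fin n) → ℝ) (x : EuclideanSpace ℝ (Fin n)) :
    ℝ :=
  fderiv ℝ f x (EuclideanSpace.single i (1 : ℝ))

/-- Christoffel symbols in the chart `φ`: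
`Γ^k_{ij} = ½ ∑_l g^{kl} (∂_i g_{jl} + ∂_j g_{il} - ∂_l g_{ij})`. -/
def christoffel (β : FormField n M) (φ : OpenPartialHomeomorph M (EuclideanSpace ℝ (Fin n)))
    (x : EuclideanSpace ℝ (Fin n)) (k i j : Fin n) : ℝ :=
  (1 / 2) * ∑ l, (coordMatrix β φ x)⁻¹ k l *
    (partialDeriv i (fun y => coordMatrix β φ y j l) x + partialDeriv j (fun y => coordMatrix β φ y i l) x
      - partialDeriv l (fun y => coordMatrix β φ y i j) x)

/-- The matrix of the Hessian `∇²f` in the chart `φ`: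
`(∇²f)_{ij} = ∂_i ∂_j f - ∑_k Γ^k_{ij} ∂_k f`. -/
def hessian (β : FormField n M) (f : M → ℝ)
    (φ : OpenPartialHomeomorph M (EuclideanSpace ℝ (Fin n)))
    (x : EuclideanSpace ℝ (Fin n)) : Matrix (Fin n) (Fin n) ℝ :=
  Matrix.of fun i j => partialDeriv i (partialDeriv j (f ∘ φ.symm)) x
    - ∑ k, christoffel β φ x k i j * partialDeriv k (f ∘ φ.symm) x

/-! ### Weakly conical ends -/

/-- `(M, g, r)` is a weakly conical end with constants `R_Σ = RS` and `Λ`. The norm of the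
symmetric 2-tensor `T = ∇²r² - 2g` is its norm as a bilinear form, i.e. `|T| ≤ c` means
`|T(v, w)| ≤ c |v| |w|` for all tangent vectors; it is at most the Hilbert-Schmidt norm of `T`. -/
structure IsWeaklyConicalEnd [IsManifold (𝓡 n) ∞ M] (g : C1Metric n M) (r : M → ℝ)
    (RS Λ : ℝ) : Prop where
  two_le_dim : 2 ≤ n
  one_le_RS : 1 ≤ RS
  nonneg : 0 ≤ Λ
  contMDiff : ContMDiff (𝓡 n) 𝓘(ℝ, ℝ) 2 r
  lt_r : ∀ p, RS < r p
  proper : ∀ K : Set ℝ, K ⊆ Ioi RS → IsCompact K → IsCompact (r ⁻¹' K)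
  unbounded : ¬ BddAbove (range r)
  grad_bound : ∀ p, |Real.sqrt (normGradSq g r p) - 1| ≤ Λ / r p ^ 4
  quartic_le : ∀ p, Λ / r p ^ 4 ≤ 1 / 2
  hess_bound : ∀ φ ∈ IsManifold.maximalAtlas (𝓡 n) ∞ M, ∀ x ∈ φ.target, ∀ v w : Fin n → ℝ,
    |v ⬝ᵥ ((hessian (formC1 g) (fun p => r p ^ 2) φ x - (2 : ℝ) • coordMatrix (formC1 g) φ x) *ᵥ w)| ≤
      Λ / r (φ.symm x) ^ 2 * Real.sqrt (v ⬝ᵥ (coordMatrix (formC1 g) φ x *ᵥ v))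
        * Real.sqrt (w ⬝ᵥ (coordMatrix (formC1 g) φ x *ᵥ w))
  quadratic_le : ∀ p, Λ / r p ^ 2 ≤ 1 / 2

/-- `E_R = {p : r(p) > R}`. -/
def outerRegion (r : M → ℝ) (R : ℝ) : Set M := {p | R < r p}

/-- The vector field `𝐗 = r ∇_g r / |∇_g r|²`. -/
def radialField [IsManifold (𝓡 n) ∞ M] (g : C1Metric n M) (r : M → ℝ) (p : M) :
    TangentSpace (𝓡 n) p :=
  (r p / normGradSq g r p) • grad g r p

open Classical in
/-- The forward flow of a vector field `X`: `forwardFlow X t p` is the position at time `t ≥ 0` of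
the integral curve of `X` that starts at `p` and is defined for all non-negative times (and `p`, if
there is no such curve). -/
def forwardFlow (X : ∀ p : M, TangentSpace (𝓡 n) p) (t : ℝ) (p : M) : M :=
  if h : ∃ γ : ℝ → M, γ 0 = p ∧ IsMIntegralCurveOn γ X (Ici 0) then h.choose t else p

/-- `Π_τ : M → M`, the time `ln τ` flow of `𝐗`, for `τ ≥ 1`. -/
def dilation [IsManifold (𝓡 n) ∞ M] (g : C1Metric n M) (r : M → ℝ) (τ : ℝ) : M → M :=
  forwardFlow (radialField g r) (Real.log τ)

/-- The rescaled pull-back `g_τ = τ⁻² Π_τ^* g`. -/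
def rescaledPullback [IsManifold (𝓡 n) ∞ M] (g : C1Metric n M) (r : M → ℝ) (τ : ℝ) :
    FormField n M :=
  fun p v w => (τ ^ 2)⁻¹ * g.inner (dilation g r τ p)
    (mfderiv (𝓡 n) (𝓡 n) (dilation g r τ) p v) (mfderiv (𝓡 n) (𝓡 n) (dilation g r τ) p w)

/-- `gC` is the metric `g_C` of the asymptotic cone of `(M, g, r)`: the limit of
`τ⁻² Π_τ^* g` in `C⁰_loc(M)` as `τ → ∞`. -/
def IsAsymptoticConeMetric [IsManifold (𝓡 n) ∞ M] (g : C1Metric n M) (r : M → ℝ)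
    (gC : C0Metric n M) : Prop :=
  ∀ φ ∈ IsManifold.maximalAtlas (𝓡 n) ∞ M, ∀ i j : Fin n,
    TendstoLocallyUniformlyOn (fun (τ : ℝ) x => coordMatrix (rescaledPullback g r τ) φ x i j)
      (fun x => coordMatrix (formC0 gC) φ x i j) atTop φ.target

/-! ### Local function spaces -/

/-- `F ∈ L²_loc(M; μ)`. -/
def MemL2Loc [MeasurableSpace M] (μ : Measure M) (F : M → ℝ) : Prop :=
  ∀ K : Set M, IsCompact K → MemLp F 2 (μ.restrict K)

/-- `F τ → F₀` in `L²_loc(M; μ)` as `τ → ∞`. -/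
def TendstoL2Loc [MeasurableSpace M] (μ : Measure M) (F : ℝ → M → ℝ) (F₀ : M → ℝ) : Prop :=
  ∀ K : Set M, IsCompact K →
    Tendsto (fun τ => eLpNorm (fun p => F τ p - F₀ p) 2 (μ.restrict K)) atTop (𝓝 0)

/-- `f ∈ H¹_loc(U)` for an open `U ⊆ ℝⁿ`: `f` and its weak partial derivatives lie in
`L²_loc(U)`. -/
def MemH1LocOn (U : Set (EuclideanSpace ℝ (Fin n))) (f : EuclideanSpace ℝ (Fin n) → ℝ) : Prop :=
  (∀ K ⊆ U, IsCompact K → MemLp f 2 (volume.restrict K)) ∧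
  ∀ i : Fin n, ∃ w : EuclideanSpace ℝ (Fin n) → ℝ,
    (∀ K ⊆ U, IsCompact K → MemLp w 2 (volume.restrict K)) ∧
    ∀ ψ : EuclideanSpace ℝ (Fin n) → ℝ, ContDiff ℝ ∞ ψ → HasCompactSupport ψ → tsupport ψ ⊆ U →
      ∫ x in U, f x * partialDeriv i ψ x = - ∫ x in U, w x * ψ x

/-- `F ∈ H¹_loc(M)`: in the coordinates of every chart `F` is an `H¹_loc` function. This does not
involve a metric: on compact sets all `C⁰` metrics define equivalent `H¹` norms. -/
def MemH1Loc (n : ℕ) {M : Type*} [TopologicalSpace M]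
    [ChartedSpace (EuclideanSpace ℝ (Fin n)) M] [IsManifold (𝓡 n) ∞ M] (F : M → ℝ) : Prop :=
  ∀ φ ∈ IsManifold.maximalAtlas (𝓡 n) ∞ M, MemH1LocOn φ.target (F ∘ φ.symm)

/-! ### Asymptotically homogeneous functions -/

/-- `F` is homogeneous of degree `d`: `F ∈ L²_loc(M; μ_C)` and, for all `τ ≥ 1`,
`Π_τ^*(r^{-d} F) = r^{-d} F` almost everywhere. -/
def IsHomogeneousOfDegree [IsManifold (𝓡 n) ∞ M] [MeasurableSpace M] (g : C1Metric n M)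
    (r : M → ℝ) (gC : C0Metric n M) (d : ℝ) (F : M → ℝ) : Prop :=
  MemL2Loc (riemannianVolume (formC0 gC)) F ∧
  ∀ τ : ℝ, 1 ≤ τ →
    (fun p => (r (dilation g r τ p)) ^ (-d) * F (dilation g r τ p))
      =ᵐ[riemannianVolume (formC0 gC)] fun p => (r p) ^ (-d) * F p

/-- `G ∈ L²_loc(M; μ_g)` is asymptotically homogeneous of degree `d` with leading term `F`: `F` is
homogeneous of degree `d` and `Π_τ^*(r^{-d} G) → r^{-d} F` in `L²_loc(M; μ_C)` as `τ → ∞`. -/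
def IsLeadingTerm [IsManifold (𝓡 n) ∞ M] [MeasurableSpace M] (g : C1Metric n M)
    (r : M → ℝ) (gC : C0Metric n M) (d : ℝ) (G F : M → ℝ) : Prop :=
  MemL2Loc (riemannianVolume (formC1 g)) G ∧
  IsHomogeneousOfDegree g r gC d F ∧
  TendstoL2Loc (riemannianVolume (formC0 gC))
    (fun τ p => (r (dilation g r τ p)) ^ (-d) * G (dilation g r τ p))
    (fun p => (r p) ^ (-d) * F p)

/-- `G` is asymptotically homogeneous of degree `d`. -/
def IsAsymptoticallyHomogeneous [IsManifold (𝓡 n) ∞ M] [MeasurableSpace M] (g : C1Metric n M)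
    (r : M → ℝ) (gC : C0Metric n M) (d : ℝ) (G : M → ℝ) : Prop :=
  ∃ F : M → ℝ, IsLeadingTerm g r gC d G F

end

end WeaklyConical

/-!
Write `u = r²`, `N = |∇r|²`, `X = r∇r/|∇r|² = ∇u/(2N)` and `T = ∇²u - 2g`. Pointwise
`L_X g = ∇²u/N - dN ⊗ du/N²` (symmetrised) and `u dN = (1 - N) du + T(∇u, ·)/2`, so that the
hypotheses on `∇r` and `∇²r²` combine to `|L_X g - 2g| ≤ 72 Λ r⁻² g` (`lie_derivative_bound`).
Along the flow `F_t` of `X` one has `r(F_t p) = e^t r(p)` exactly; since `r` is proper, the flow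
exists for all positive times (`exists_curve`), and integrating the bound shows that
`e^{-2t} F_t^* g` lies between `exp(± 36 Λ / r²) g` (`flowBounds_forwardFlow`). By the semigroup
property of the flow the same estimate, applied from time `t` on, makes the rescaled pull-backs a
Cauchy family, locally uniformly. The limit is the cone metric `g_C`, which is comparable to `g`
on the whole end (`exists_coneMetric`).

The same bound on volume forms says that `F_t` carries `r⁻ⁿ dμ_g` to itself up to the factor
`exp(18 n Λ / R²)` on `{r > R}` (`lintegral_forwardFlow_le`). Along an integral curve,
Cauchy-Schwarz with the weight `e^s` gives `|G(F_t p) - G(p)|² ≤ ∫₀^∞ e^s (XG)²(F_s p) ds`,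
because `∫₀^∞ e^{-s} ds = 1`. Integrate this against `r⁻ⁿ dμ_g` over `{r > R}`: the flow moves
this region into `{r > e^s R}`, where the energy hypothesis leaves a factor `e^{-2s}`, and what
remains is `∫₀^∞ e^{s} e^{-2s} ds = 1` (`lintegral_radialEnergy_le`). Hence `G` converges along
almost every integral curve. The limit `F` is constant along integral curves, it is a leading term
(`HasEnergyDecay.isLeadingTerm`), and leading terms are unique almost everywhere
(`ae_eq_of_isLeadingTerm`). In the final estimate `(XG)² = |∇r|⁻⁴ r² (∂_r G)²`, and `R₁` is chosen
so that on `{r > R₁}` both `|∇r|⁻⁴` and the distortion of `r⁻ⁿ dμ_g` are at most `4`; this is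
where `16 = 4 · 4` comes from.

For the regularity of `F`, the functions `G ∘ F_t` have bounded Dirichlet energy in each chart:
the factor `e^{2t}` by which the flow increases `|∇(G ∘ F_t)|²` is compensated by the decay of the
energy on `{r > e^t R}` (`HasEnergyDecay.lintegral_partialDeriv_le`). They converge to `F` in
`L²_loc`, so weak compactness of balls in `L²` provides the weak derivatives of `F`
(`exists_weakDeriv_of_bounded`).
-/

namespace WeaklyConical

noncomputable section

/-! ### Local flows of `C¹` vector fields -/

section LocalFlow

variable {E : Type*} [NormedAddCommGroup E] [NormedSpace ℝ E]

/-- Grönwall's inequality for a function that vanishes at the start. -/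
theorem norm_le_of_norm_deriv_le {f f' : ℝ → E} {K η T : ℝ} (hK : 0 < K) (hη : 0 ≤ η) (hT : T ≤ 1)
    (hf : ∀ t ∈ Icc 0 T, HasDerivAt f (f' t) t) (h0 : f 0 = 0)
    (hb : ∀ t ∈ Icc 0 T, ‖f' t‖ ≤ K * ‖f t‖ + η) :
    ∀ t ∈ Icc 0 T, ‖f t‖ ≤ η * Real.exp K := by
  intro t ht
  have h1 := norm_le_gronwallBound_of_norm_deriv_right_le (δ := 0) (K := K) (ε := η)
    (fun s hs => (hf s hs).continuousAt.continuousWithinAt)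
    (fun s hs => (hf s (Ico_subset_Icc_self hs)).hasDerivWithinAt) (by simp [h0])
    (fun s hs => hb s (Ico_subset_Icc_self hs)) t ht
  refine h1.trans ?_
  rw [gronwallBound_of_K_ne_0 hK.ne']
  simp only [zero_mul, zero_add, sub_zero]
  have h2 : Real.exp (K * t) - 1 ≤ K * Real.exp K := by
    have h3 := Real.one_sub_le_exp_neg (K * t)
    have h4 : Real.exp (-(K * t)) * Real.exp (K * t) = 1 := by
      rw [← Real.exp_add]; simp
    have h5 : Real.exp (K * t) ≤ Real.exp K :=
      Real.exp_le_exp.2 (by nlinarith [ht.2])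
    have h6 : 0 ≤ K * t := mul_nonneg hK.le ht.1
    have h7 : K * t ≤ K := by nlinarith [ht.2]
    nlinarith [Real.exp_pos (K * t), Real.exp_pos K]
  calc η / K * (Real.exp (K * t) - 1) ≤ η / K * (K * Real.exp K) := by gcongr
    _ = η * Real.exp K := by field_simp

/-- The solution of the linear equation `W' = A(t) W` with `W(0) = 1`, for short times. -/
theorem exists_linear_flow [CompleteSpace E] {A : ℝ → E →L[ℝ] E} {K T : ℝ} (hK : 0 ≤ K)
    (hT : 0 < T) (hKT : 2 * K * T ≤ 1) (hA : ContinuousOn A (Icc (-T) T))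
    (hAK : ∀ t ∈ Icc (-T) T, ‖A t‖ ≤ K) :
    ∃ W : ℝ → E →L[ℝ] E, W 0 = ContinuousLinearMap.id ℝ E ∧
      ∀ t ∈ Ioo (-T) T, HasDerivAt W ((A t).comp (W t)) t ∧ ‖W t‖ ≤ Real.exp (K * |t|) := by
  -- On the unit ball about the identity `‖A(t) w‖ ≤ 2K`, so that `2KT ≤ 1` is what is needed.
  have hPL : IsPicardLindelof (fun t (w : E →L[ℝ] E) => (A t).comp w) (tmin := -T) (tmax := T)
      ⟨0, by constructor <;> linarith⟩ (ContinuousLinearMap.id ℝ E) 1 0 ⟨2 * K, by positivity⟩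
      ⟨K, hK⟩ := by
    refine ⟨fun t ht => ?_, fun w _ => ?_, fun t ht w hw => ?_, ?_⟩
    · refine LipschitzOnWith.of_dist_le_mul fun x _ y _ => ?_
      rw [dist_eq_norm, dist_eq_norm, ← ContinuousLinearMap.comp_sub]
      exact (ContinuousLinearMap.opNorm_comp_le _ _).trans
        (mul_le_mul_of_nonneg_right (hAK t ht) (norm_nonneg _))
    · exact hA.clm_comp continuousOn_const
    · have h1 : ‖w‖ ≤ 2 := by
        have h2 := mem_closedBall_iff_norm.1 hw
        have h3 := norm_le_norm_add_norm_sub' w (ContinuousLinearMap.id ℝ E)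
        have h4 := ContinuousLinearMap.norm_id_le (𝕜 := ℝ) (E := E)
        simp only [NNReal.coe_one] at h2
        linarith
      calc ‖(A t).comp w‖ ≤ ‖A t‖ * ‖w‖ := ContinuousLinearMap.opNorm_comp_le _ _
        _ ≤ K * 2 := by gcongr; exact hAK t ht
        _ = 2 * K := by ring
    · simp only [NNReal.coe_one, NNReal.coe_zero, sub_zero, zero_sub, neg_neg, max_self]
      exact hKT
  obtain ⟨W, hW0, hW⟩ := hPL.exists_eq_forall_mem_Icc_hasDerivWithinAt₀
  have hd : ∀ t ∈ Ioo (-T) T, HasDerivAt W ((A t).comp (W t)) t := fun t ht =>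
    (hW t (Ioo_subset_Icc_self ht)).hasDerivAt (Icc_mem_nhds ht.1 ht.2)
  refine ⟨W, hW0, fun t ht => ⟨hd t ht, ?_⟩⟩
  have h1 : ‖W 0‖ ≤ 1 := by
    have : W 0 = ContinuousLinearMap.id ℝ E := hW0
    rw [this]; exact ContinuousLinearMap.norm_id_le
  -- Grönwall's inequality, to be applied to `W(t)` and to `W(-t)`
  have key : ∀ (V : ℝ → E →L[ℝ] E) (V' : ℝ → E →L[ℝ] E) (b : ℝ), 0 ≤ b → ‖V 0‖ ≤ 1 →
      (∀ s ∈ Icc 0 b, HasDerivAt V (V' s) s) → (∀ s ∈ Icc 0 b, ‖V' s‖ ≤ K * ‖V s‖) →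
      ‖V b‖ ≤ Real.exp (K * b) := by
    intro V V' b hb h0 hV hV'
    have := norm_le_gronwallBound_of_norm_deriv_right_le (δ := 1) (K := K) (ε := 0)
      (fun s hs => (hV s hs).continuousAt.continuousWithinAt)
      (fun s hs => (hV s (Ico_subset_Icc_self hs)).hasDerivWithinAt) h0
      (fun s hs => by simpa using hV' s (Ico_subset_Icc_self hs)) b ⟨hb, le_rfl⟩
    simpa [gronwallBound_ε0] using this
  rcases le_total 0 t with h | h
  · rw [abs_of_nonneg h]
    refine key W _ t h h1 (fun s hs => hd s ⟨by linarith [hs.1], by linarith [hs.2, ht.2]⟩)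
      fun s hs => (ContinuousLinearMap.opNorm_comp_le _ _).trans
        (mul_le_mul_of_nonneg_right (hAK s ⟨by linarith [hs.1], by linarith [hs.2, ht.2]⟩)
          (norm_nonneg _))
  · rw [abs_of_nonpos h]
    have := key (fun s => W (-s)) (fun s => -((A (-s)).comp (W (-s)))) (-t) (by linarith)
      (by simpa using h1) (fun s hs => ?_) fun s hs => ?_
    · simpa using this
    · have h2 := (hd (-s) ⟨by linarith [hs.2, ht.1], by linarith [hs.1]⟩).scomp s
        (hasDerivAt_neg s)
      simpa [Function.comp_def] using h2
    · rw [norm_neg]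
      exact (ContinuousLinearMap.opNorm_comp_le _ _).trans
        (mul_le_mul_of_nonneg_right (hAK (-s) ⟨by linarith [hs.2, ht.1], by linarith [hs.1]⟩)
          (norm_nonneg _))

/-- A `C¹` vector field `f` on a finite-dimensional space has, near a point, a local flow `Φ` that
is `C¹` in the initial point, with derivative `W` satisfying the variational equation
`W' = Df(Φ) W`. -/
theorem exists_local_flow [FiniteDimensional ℝ E] {f : E → E} {x₀ : E} (hf : ContDiffAt ℝ 1 f x₀)
    {N : Set E} (hN : N ∈ 𝓝 x₀) :
    ∃ δ > 0, ∃ ε > 0, ∃ (Φ : E → ℝ → E) (W : E → ℝ → E →L[ℝ] E),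
      ∀ x ∈ Metric.ball x₀ δ, Φ x 0 = x ∧ W x 0 = ContinuousLinearMap.id ℝ E ∧
        (∀ t ∈ Ioo (-ε) ε, Φ x t ∈ N ∧ HasDerivAt (Φ x) (f (Φ x t)) t ∧
          HasDerivAt (W x) ((fderiv ℝ f (Φ x t)).comp (W x t)) t) ∧
        ∀ t ∈ Ico 0 ε, HasFDerivAt (fun y => Φ y t) (W x t) x ∧
          ContDiffAt ℝ 1 (fun y => Φ y t) x := by
  have : CompleteSpace E := FiniteDimensional.complete ℝ E
  -- a compact ball in `N` on which `f` is `C¹`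
  obtain ⟨b, hb, hbN⟩ : ∃ b > 0, ∀ y ∈ Metric.closedBall x₀ b, y ∈ N ∧ ContDiffAt ℝ 1 f y := by
    obtain ⟨b, hb, h⟩ := Metric.nhds_basis_closedBall.mem_iff.1
      (inter_mem hN (hf.eventually (by simp)))
    exact ⟨b, hb, fun y hy => h hy⟩
  have hcomp : IsCompact (Metric.closedBall x₀ b) := isCompact_closedBall _ _
  have hdiff : ∀ y ∈ Metric.closedBall x₀ b, DifferentiableAt ℝ f y := fun y hy =>
    (hbN y hy).2.differentiableAt (by simp)
  have hcont : ContinuousOn (fderiv ℝ f) (Metric.closedBall x₀ b) := fun y hy =>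
    ((hbN y hy).2.fderiv_right (m := 0) (by simp)).continuousAt.continuousWithinAt
  obtain ⟨K₀, hK₀⟩ := hcomp.exists_bound_of_continuousOn hcont
  set K : ℝ := max K₀ 1 with hKdef
  have hK : 0 < K := lt_of_lt_of_le one_pos (le_max_right _ _)
  have hfK : ∀ y ∈ Metric.closedBall x₀ b, ‖fderiv ℝ f y‖ ≤ K := fun y hy =>
    (hK₀ y hy).trans (le_max_left _ _)
  -- Picard-Lindelöf
  obtain ⟨ε₀, hε₀, a, r, L, K', hr, hPL⟩ := IsPicardLindelof.of_contDiffAt_one hf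
  obtain ⟨Φ, hΦ, L', hL'⟩ :=
    (hPL 0).exists_forall_mem_closedBall_eq_hasDerivWithinAt_lipschitzOnWith
  simp only [zero_sub, zero_add] at hΦ hL'
  have hr' : (0 : ℝ) < r := hr
  have hcΦ : ContinuousOn (Function.uncurry Φ) (Metric.closedBall x₀ r ×ˢ Icc (-ε₀) ε₀) :=
    continuousOn_prod_of_continuousOn_lipschitzOnWith _ L'
      (fun x hx => HasDerivWithinAt.continuousOn (hΦ x hx).2) hL'
  have hx₀ : x₀ ∈ Metric.closedBall x₀ (r : ℝ) := Metric.mem_closedBall_self hr'.le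
  have hnhds : Metric.closedBall x₀ (r : ℝ) ×ˢ Icc (-ε₀) ε₀ ∈ 𝓝 (x₀, (0 : ℝ)) :=
    prod_mem_nhds (Metric.closedBall_mem_nhds _ hr') (Icc_mem_nhds (by linarith) hε₀)
  have hpre : ∀ᶠ z in 𝓝 (x₀, (0 : ℝ)), Function.uncurry Φ z ∈ Metric.closedBall x₀ b := by
    refine (hcΦ.continuousAt hnhds).eventually_mem ?_
    have : Function.uncurry Φ (x₀, 0) = x₀ := (hΦ x₀ hx₀).1
    rw [this]
    exact Metric.closedBall_mem_nhds _ hb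
  obtain ⟨d, hd, hdb⟩ := Metric.eventually_nhds_iff_ball.1 hpre
  set δ : ℝ := min d r with hδdef
  have hδ : 0 < δ := lt_min hd hr'
  -- `1 / (2K)` is the lifetime of the solutions provided by `exists_linear_flow`.
  set ε : ℝ := min (min d ε₀) (min (1 / (2 * K)) 1) with hεdef
  have hε : 0 < ε := by positivity
  have hεd : ε ≤ d := (min_le_left _ _).trans (min_le_left _ _)
  have hεε : ε ≤ ε₀ := (min_le_left _ _).trans (min_le_right _ _)
  have hεK : ε ≤ 1 / (2 * K) := (min_le_right _ _).trans (min_le_left _ _)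
  have hε1 : ε ≤ 1 := (min_le_right _ _).trans (min_le_right _ _)
  have hxr : ∀ x ∈ Metric.ball x₀ δ, x ∈ Metric.closedBall x₀ (r : ℝ) := fun x hx =>
    Metric.ball_subset_closedBall (Metric.ball_subset_ball (min_le_right _ _) hx)
  have hIoo : ∀ t ∈ Ioo (-ε) ε, t ∈ Ioo (-ε₀) ε₀ := fun t ht =>
    ⟨by linarith [ht.1], by linarith [ht.2]⟩
  have hmem : ∀ x ∈ Metric.ball x₀ δ, ∀ t ∈ Ioo (-ε) ε, Φ x t ∈ Metric.closedBall x₀ b := by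
    intro x hx t ht
    refine hdb (x, t) ?_
    rw [Metric.mem_ball, Prod.dist_eq]
    refine max_lt (lt_of_lt_of_le hx (min_le_left _ _)) ?_
    rw [Real.dist_eq, sub_zero, abs_lt]
    exact ⟨by linarith [ht.1], by linarith [ht.2]⟩
  have hΦd : ∀ x ∈ Metric.ball x₀ δ, ∀ t ∈ Ioo (-ε) ε, HasDerivAt (Φ x) (f (Φ x t)) t :=
    fun x hx t ht => ((hΦ x (hxr x hx)).2 t (Ioo_subset_Icc_self (hIoo t ht))).hasDerivAt
      (Icc_mem_nhds (hIoo t ht).1 (hIoo t ht).2)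
  -- the variational equation, on a slightly shorter time interval
  have hW : ∀ x : E, ∃ W : ℝ → E →L[ℝ] E, x ∈ Metric.ball x₀ δ →
      W 0 = ContinuousLinearMap.id ℝ E ∧ ∀ t ∈ Ioo (-(ε / 2)) (ε / 2),
        HasDerivAt W ((fderiv ℝ f (Φ x t)).comp (W t)) t ∧ ‖W t‖ ≤ Real.exp (K * |t|) := by
    intro x
    by_cases hx : x ∈ Metric.ball x₀ δ
    · have hsub : ∀ t ∈ Icc (-(ε / 2)) (ε / 2), t ∈ Ioo (-ε) ε := fun t ht =>
        ⟨by linarith [ht.1], by linarith [ht.2]⟩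
      have h2K : 2 * K * (ε / 2) ≤ 1 := by
        have := mul_le_mul_of_nonneg_left hεK (by positivity : 0 ≤ 2 * K)
        rw [mul_one_div_cancel (by positivity)] at this
        nlinarith
      obtain ⟨W, h0, h1⟩ := exists_linear_flow (A := fun t => fderiv ℝ f (Φ x t)) hK.le
        (half_pos hε) h2K
        (hcont.comp (fun t ht => (hΦd x hx t (hsub t ht)).continuousAt.continuousWithinAt)
          fun t ht => hmem x hx t (hsub t ht))
        fun t ht => hfK _ (hmem x hx t (hsub t ht))
      exact ⟨W, fun _ => ⟨h0, h1⟩⟩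
    · exact ⟨0, fun h => (hx h).elim⟩
  choose W hW using hW
  have hhalf : ∀ t ∈ Ioo (-(ε / 2)) (ε / 2), t ∈ Ioo (-ε) ε := fun t ht =>
    ⟨by linarith [ht.1], by linarith [ht.2]⟩
  have hWb : ∀ x ∈ Metric.ball x₀ δ, ∀ t ∈ Ico 0 (ε / 2), ‖W x t‖ ≤ Real.exp K := by
    intro x hx t ht
    refine (((hW x hx).2 t ⟨by linarith [ht.1], ht.2⟩).2).trans (Real.exp_le_exp.2 ?_)
    rw [abs_of_nonneg ht.1]
    nlinarith [ht.2, ht.1]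
  -- Lipschitz dependence, with the constant `L'`, and uniform continuity of `Df`
  have hlip : ∀ x ∈ Metric.ball x₀ δ, ∀ y ∈ Metric.ball x₀ δ, ∀ t ∈ Ioo (-ε) ε,
      ‖Φ y t - Φ x t‖ ≤ L' * ‖y - x‖ := fun x hx y hy t ht => by
    have := (hL' t (Ioo_subset_Icc_self (hIoo t ht))).dist_le_mul y (hxr y hy) x (hxr x hx)
    simpa [dist_eq_norm] using this
  have huc : ∀ η > 0, ∃ κ > 0, ∀ y ∈ Metric.closedBall x₀ b, ∀ z ∈ Metric.closedBall x₀ b,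
      ‖z - y‖ < κ → ‖fderiv ℝ f z - fderiv ℝ f y‖ < η := by
    intro η hη
    obtain ⟨κ, hκ, h⟩ := Metric.uniformContinuousOn_iff.1
      (hcomp.uniformContinuousOn_of_continuous hcont) η hη
    exact ⟨κ, hκ, fun y hy z hz hyz => by
      simpa [dist_eq_norm] using h z hz y hy (by simpa [dist_eq_norm] using hyz)⟩
  have hnear : ∀ x ∈ Metric.ball x₀ δ, ∀ κ > 0, ∀ᶠ y in 𝓝 x, y ∈ Metric.ball x₀ δ ∧
      ∀ t ∈ Ioo (-ε) ε, ‖Φ y t - Φ x t‖ < κ := by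
    intro x hx κ hκ
    have h1 : ∀ᶠ y in 𝓝 x, ‖y - x‖ < κ / (L' + 1) := by
      have : ContinuousAt (fun y => ‖y - x‖) x := by fun_prop
      exact Tendsto.eventually_lt_const (by simp only [sub_self, norm_zero]; positivity) this
    filter_upwards [h1, Metric.isOpen_ball.mem_nhds hx] with y hy hyδ
    refine ⟨hyδ, fun t ht => (hlip x hx y hyδ t ht).trans_lt ?_⟩
    have hpos : (0 : ℝ) < L' + 1 := by positivity
    calc (L' : ℝ) * ‖y - x‖ ≤ (L' + 1) * ‖y - x‖ := by nlinarith [norm_nonneg (y - x)]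
      _ < (L' + 1) * (κ / (L' + 1)) := by gcongr
      _ = κ := by field_simp
  -- `W x t` is the derivative of the flow: Grönwall's inequality for `Φ y - Φ x - W x (y - x)`
  have hfd : ∀ x ∈ Metric.ball x₀ δ, ∀ t ∈ Ico 0 (ε / 2),
      HasFDerivAt (fun y => Φ y t) (W x t) x := by
    intro x hx t ht
    rw [hasFDerivAt_iff_isLittleO, Asymptotics.isLittleO_iff]
    intro c hc
    set η : ℝ := c / ((L' + 1) * Real.exp K) with hη
    have hηpos : 0 < η := by positivity
    obtain ⟨κ, hκ, hκη⟩ := huc η hηpos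
    filter_upwards [hnear x hx κ hκ] with y hy
    have hIcc : ∀ s ∈ Icc 0 t, s ∈ Ioo (-(ε / 2)) (ε / 2) := fun s hs =>
      ⟨by linarith [hs.1], by linarith [hs.2, ht.2]⟩
    have hrem : ∀ s ∈ Icc 0 t,
        ‖f (Φ y s) - f (Φ x s) - fderiv ℝ f (Φ x s) (Φ y s - Φ x s)‖ ≤ η * (L' * ‖y - x‖) := by
      intro s hs
      have hs' := hhalf s (hIcc s hs)
      have hmx := hmem x hx s hs'
      have hmy := hmem y hy.1 s hs'
      have hκs := hy.2 s hs'
      have hconv : Convex ℝ (segment ℝ (Φ x s) (Φ y s)) := convex_segment _ _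
      have hsegb : segment ℝ (Φ x s) (Φ y s) ⊆ Metric.closedBall x₀ b :=
        (convex_closedBall x₀ b).segment_subset hmx hmy
      have := hconv.norm_image_sub_le_of_norm_hasFDerivWithin_le' (f := f)
        (f' := fderiv ℝ f) (φ := fderiv ℝ f (Φ x s)) (C := η)
        (fun z hz => (hdiff z (hsegb hz)).hasFDerivAt.hasFDerivWithinAt)
        (fun z hz => (hκη _ hmx z (hsegb hz) ?_).le) (left_mem_segment _ _ _)
        (right_mem_segment _ _ _)
      · refine this.trans ?_
        gcongr
        exact hlip x hx y hy.1 s hs'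
      · refine lt_of_le_of_lt ?_ hκs
        have := norm_sub_le_of_mem_segment hz
        simpa [norm_sub_rev] using this
    have := norm_le_of_norm_deriv_le (f := fun s => Φ y s - Φ x s - W x s (y - x))
      (f' := fun s => f (Φ y s) - f (Φ x s) - fderiv ℝ f (Φ x s) (W x s (y - x)))
      (K := K) (η := η * (L' * ‖y - x‖)) (T := t) hK (by positivity) (by linarith [ht.2])
      (fun s hs => ?_) ?_ (fun s hs => ?_) t ⟨ht.1, le_rfl⟩
    · refine this.trans ?_
      have hexp := Real.exp_pos K
      calc η * (L' * ‖y - x‖) * Real.exp K ≤ η * ((L' + 1) * ‖y - x‖) * Real.exp K := by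
            gcongr; linarith
        _ = c * ‖y - x‖ := by rw [hη]; field_simp
    · have hs' := hIcc s hs
      exact ((hΦd y hy.1 s (hhalf s hs')).sub (hΦd x hx s (hhalf s hs'))).sub
        (by simpa using (((hW x hx).2 s hs').1).clm_apply (hasDerivAt_const s (y - x)))
    · simp [(hΦ x (hxr x hx)).1, (hΦ y (hxr y hy.1)).1, (hW x hx).1]
    · have hs' := hhalf s (hIcc s hs)
      have heq : f (Φ y s) - f (Φ x s) - fderiv ℝ f (Φ x s) (W x s (y - x)) =
          fderiv ℝ f (Φ x s) (Φ y s - Φ x s - W x s (y - x)) +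
          (f (Φ y s) - f (Φ x s) - fderiv ℝ f (Φ x s) (Φ y s - Φ x s)) := by
        simp only [map_sub]; abel
      rw [heq]
      refine (norm_add_le _ _).trans (add_le_add ?_ (hrem s hs))
      exact (ContinuousLinearMap.le_opNorm _ _).trans
        (mul_le_mul_of_nonneg_right (hfK _ (hmem x hx s hs')) (norm_nonneg _))
  -- this derivative is continuous: Grönwall's inequality for `W y - W x`
  have hWc : ∀ t ∈ Ico 0 (ε / 2), ContinuousOn (fun y => W y t) (Metric.ball x₀ δ) := by
    intro t ht x hx
    refine ContinuousAt.continuousWithinAt ?_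
    rw [Metric.continuousAt_iff']
    intro c hc
    set η : ℝ := c / 2 / (Real.exp K * Real.exp K) with hη
    have hηpos : 0 < η := by positivity
    obtain ⟨κ, hκ, hκη⟩ := huc η hηpos
    filter_upwards [hnear x hx κ hκ] with y hy
    have hIcc : ∀ s ∈ Icc 0 t, s ∈ Ioo (-(ε / 2)) (ε / 2) := fun s hs =>
      ⟨by linarith [hs.1], by linarith [hs.2, ht.2]⟩
    have := norm_le_of_norm_deriv_le (f := fun s => W y s - W x s)
      (f' := fun s => (fderiv ℝ f (Φ y s)).comp (W y s) - (fderiv ℝ f (Φ x s)).comp (W x s))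
      (K := K) (η := η * Real.exp K) (T := t) hK (by positivity) (by linarith [ht.2])
      (fun s hs => (((hW y hy.1).2 s (hIcc s hs)).1).sub (((hW x hx).2 s (hIcc s hs)).1))
      (by simp [(hW x hx).1, (hW y hy.1).1]) (fun s hs => ?_) t ⟨ht.1, le_rfl⟩
    · rw [dist_eq_norm]
      refine this.trans_lt ?_
      have : η * Real.exp K * Real.exp K = c / 2 := by rw [hη]; field_simp
      rw [this]; linarith
    · have hs' := hhalf s (hIcc s hs)
      have heq : (fderiv ℝ f (Φ y s)).comp (W y s) - (fderiv ℝ f (Φ x s)).comp (W x s) =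
          (fderiv ℝ f (Φ x s)).comp (W y s - W x s) +
          (fderiv ℝ f (Φ y s) - fderiv ℝ f (Φ x s)).comp (W y s) := by
        rw [ContinuousLinearMap.comp_sub, ContinuousLinearMap.sub_comp]; abel
      rw [heq]
      refine (norm_add_le _ _).trans (add_le_add ?_ ?_)
      · exact (ContinuousLinearMap.opNorm_comp_le _ _).trans
          (mul_le_mul_of_nonneg_right (hfK _ (hmem x hx s hs')) (norm_nonneg _))
      · refine (ContinuousLinearMap.opNorm_comp_le _ _).trans ?_
        gcongr
        · exact (hκη _ (hmem x hx s hs') _ (hmem y hy.1 s hs') (hy.2 s hs')).le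
        · exact hWb y hy.1 s ⟨hs.1, by linarith [hs.2, ht.2]⟩
  refine ⟨δ, hδ, ε / 2, half_pos hε, Φ, W, fun x hx => ⟨(hΦ x (hxr x hx)).1, (hW x hx).1,
    fun t ht => ⟨(hbN _ (hmem x hx t (hhalf t ht))).1, hΦd x hx t (hhalf t ht),
      ((hW x hx).2 t ht).1⟩, fun t ht => ⟨hfd x hx t ht, ?_⟩⟩⟩
  rw [contDiffAt_one_iff]
  exact ⟨fun y => W y t, Metric.ball x₀ δ, Metric.isOpen_ball.mem_nhds hx, hWc t ht,
    fun y hy => hfd y hy t ht⟩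

end LocalFlow

/-! ### The Lie derivative of the metric along the radial field -/

section LieDerivative

variable {E : Type*} [NormedAddCommGroup E] [NormedSpace ℝ E]

/-- If `|a'| ≤ (2k/q) a` along a function with `q' = 2q`, then `a exp(k/q)` decreases and
`a exp(-k/q)` increases, because `(k/q)' = -2k/q`. -/
theorem exp_mul_bounds {a a' q : ℝ → ℝ} {k T : ℝ} (hT : 0 ≤ T)
    (ha : ∀ s ∈ Icc 0 T, HasDerivAt a (a' s) s) (hq : ∀ s ∈ Icc 0 T, HasDerivAt q (2 * q s) s)
    (hq0 : ∀ s ∈ Icc 0 T, 0 < q s) (hb : ∀ s ∈ Icc 0 T, |a' s| ≤ 2 * (k / q s) * a s) :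
    a T * Real.exp (k / q T) ≤ a 0 * Real.exp (k / q 0) ∧
      a 0 * Real.exp (-(k / q 0)) ≤ a T * Real.exp (-(k / q T)) := by
  have hkq : ∀ s ∈ Icc 0 T, HasDerivAt (fun s => k / q s) (-(2 * (k / q s))) s := fun s hs => by
    have h := (hasDerivAt_const s k).div (hq s hs) (hq0 s hs).ne'
    have := (hq0 s hs).ne'
    refine h.congr_deriv ?_
    field_simp; ring
  have hexp := fun s hs => (ha s hs).mul (hkq s hs).exp
  have hexp' := fun s hs => (ha s hs).mul (hkq s hs).neg.exp
  constructor
  · have hanti : AntitoneOn (fun s => a s * Real.exp (k / q s)) (Icc 0 T) := by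
      refine antitoneOn_of_deriv_nonpos (convex_Icc 0 T)
        (fun s hs => (hexp s hs).continuousAt.continuousWithinAt)
        (fun s hs => (hexp s (interior_subset hs)).differentiableAt.differentiableWithinAt)
        fun s hs => ?_
      have hs' := interior_subset hs
      have h := (hexp s hs').deriv
      simp only [Pi.mul_def] at h
      rw [h]
      have := (abs_le.1 (hb s hs')).2
      have := Real.exp_pos (k / q s)
      nlinarith
    exact hanti ⟨le_rfl, hT⟩ ⟨hT, le_rfl⟩ hT
  · have hmono : MonotoneOn (fun s => a s * Real.exp (-(k / q s))) (Icc 0 T) := by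
      refine monotoneOn_of_deriv_nonneg (convex_Icc 0 T)
        (fun s hs => (hexp' s hs).continuousAt.continuousWithinAt)
        (fun s hs => (hexp' s (interior_subset hs)).differentiableAt.differentiableWithinAt)
        fun s hs => ?_
      have hs' := interior_subset hs
      have h := (hexp' s hs').deriv
      simp only [Pi.mul_def, Pi.neg_apply] at h
      rw [h]
      have := (abs_le.1 (hb s hs')).1
      have := Real.exp_pos (-(k / q s))
      nlinarith
    exact hmono ⟨le_rfl, hT⟩ ⟨hT, le_rfl⟩ hT

/-- Cauchy-Schwarz for a positive semidefinite symmetric bilinear form. -/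
theorem sq_le_of_nonneg_form (b : E →L[ℝ] E →L[ℝ] ℝ) (hs : ∀ v w, b v w = b w v)
    (hp : ∀ v, 0 ≤ b v v) (v w : E) : b v w ^ 2 ≤ b v v * b w w := by
  have h : ∀ t : ℝ, 0 ≤ b v v * (t * t) + 2 * b v w * t + b w w := fun t => by
    have := hp (t • v + w)
    simp only [map_add, map_smul, add_apply, smul_apply,
      smul_eq_mul, hs w v] at this
    linarith
  have := discrim_le_zero h
  unfold discrim at this
  linarith

/-- The Hessian of `u` with respect to a metric `B` on a vector space, for a field `Y` that is the
gradient of `u`: `D²u(v, w) - ½ (D_vB(w, Y) + D_wB(v, Y) - D_YB(v, w))`. -/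
def gradHessian (B : E → E →L[ℝ] E →L[ℝ] ℝ) (u : E → ℝ) (Y : E → E) (x v w : E) : ℝ :=
  fderiv ℝ (fderiv ℝ u) x v w -
    (1 / 2) * (fderiv ℝ B x v w (Y x) + fderiv ℝ B x w v (Y x) - fderiv ℝ B x (Y x) v w)

/-- The flow of `X = Y / (2N)`, where `Y = ∇u` and `N = |Y|²/(4u)`, dilates the metric: if the
Hessian of `u` is `θ`-close to `2B` and `N` is close to `1`, then `L_X B` is close to `2B`.
With `T = ∇²u - 2B` one has `L_X B = ∇²u / N - dN ⊗ du / N²` and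
`u dN = (1 - N) du + T(Y, ·) / 2`. -/
theorem lie_derivative_bound {B : E → E →L[ℝ] E →L[ℝ] ℝ} {u : E → ℝ} {Y : E → E} {x : E} {θ : ℝ}
    (hB : DifferentiableAt ℝ B x) (hY : DifferentiableAt ℝ Y x) (hu : DifferentiableAt ℝ u x)
    (hdu : DifferentiableAt ℝ (fderiv ℝ u) x) (hBY : ∀ᶠ y in 𝓝 x, B y (Y y) = fderiv ℝ u y)
    (hsymm : ∀ᶠ y in 𝓝 x, ∀ v w, B y v w = B y w v) (hpos : ∀ v, 0 ≤ B x v v) (hux : 0 < u x)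
    (hN1 : |fderiv ℝ u x (Y x) / (4 * u x) - 1| ≤ 5 / 2 * θ)
    (hN2 : 1 / 4 ≤ fderiv ℝ u x (Y x) / (4 * u x))
    (hH : ∀ v w, |gradHessian B u Y x v w - 2 * B x v w| ≤ θ * √(B x v v) * √(B x w w)) (v : E) :
    |fderiv ℝ B x ((1 / (2 * (fderiv ℝ u x (Y x) / (4 * u x)))) • Y x) v v +
      2 * B x (fderiv ℝ (fun y => (1 / (2 * (fderiv ℝ u y (Y y) / (4 * u y)))) • Y y) x v) v -
      2 * B x v v| ≤ 72 * θ * B x v v := by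
  set N : E → ℝ := fun y => fderiv ℝ u y (Y y) / (4 * u y) with hN
  have hs := hsymm.self_of_nhds
  have hDs : ∀ z v w, fderiv ℝ B x z v w = fderiv ℝ B x z w v := by
    intro z v w
    have h1 : HasFDerivAt (fun y => B y v w) (((fderiv ℝ B x).flip v).flip w) x := by
      have := (hB.hasFDerivAt.clm_apply (hasFDerivAt_const v x)).clm_apply (hasFDerivAt_const w x)
      refine this.congr_fderiv ?_
      ext z; simp
    have h2 : HasFDerivAt (fun y => B y v w) (((fderiv ℝ B x).flip w).flip v) x := by
      have := (hB.hasFDerivAt.clm_apply (hasFDerivAt_const w x)).clm_apply (hasFDerivAt_const v x)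
      have h3 : HasFDerivAt (fun y => B y w v) (((fderiv ℝ B x).flip w).flip v) x := by
        refine this.congr_fderiv ?_
        ext z; simp
      exact h3.congr_of_eventuallyEq (hsymm.mono fun y hy => hy v w)
    have := congrArg (fun L => L z) (h1.unique h2)
    simpa using this
  -- differentiate `B(Y, ·) = du`
  have hBYx := hBY.self_of_nhds
  have hdBY : ∀ z w, fderiv ℝ B x z (Y x) w + B x (fderiv ℝ Y x z) w =
      fderiv ℝ (fderiv ℝ u) x z w := by
    intro z w
    have h1 := hB.hasFDerivAt.clm_apply hY.hasFDerivAt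
    have h2 := h1.unique (hdu.hasFDerivAt.congr_of_eventuallyEq hBY)
    have := congrArg (fun L => L z w) h2
    simp at this
    linarith
  set Nx : ℝ := fderiv ℝ u x (Y x) / (4 * u x) with hNx
  have hNpos : 0 < Nx := by linarith
  have hYY : B x (Y x) (Y x) = 4 * u x * Nx := by
    rw [hBYx, hNx]; field_simp
  -- the differential of `N`
  have hNd : HasFDerivAt N ((4 * u x)⁻¹ • (((fderiv ℝ u x).comp (fderiv ℝ Y x)) +
      (fderiv ℝ (fderiv ℝ u) x).flip (Y x)) - (Nx / u x) • fderiv ℝ u x) x := by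
    have h1 := (hdu.hasFDerivAt.clm_apply hY.hasFDerivAt)
    have h2 : HasFDerivAt (fun y => (4 * u y)⁻¹)
        (-((4 * u x) ^ 2)⁻¹ • ((4 : ℝ) • fderiv ℝ u x)) x :=
      (hasDerivAt_inv (by positivity)).comp_hasFDerivAt x (hu.hasFDerivAt.const_mul 4)
    have h3 := h1.mul h2
    have h4 : N = fun y => fderiv ℝ u y (Y y) * (4 * u y)⁻¹ := by
      ext y; simp [hN, div_eq_mul_inv]
    rw [h4]
    refine h3.congr_fderiv ?_
    ext z
    simp [hNx]
    field_simp
    ring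
  have hdN : ∀ z, fderiv ℝ N x z = ((1 - Nx) * fderiv ℝ u x z +
      (gradHessian B u Y x z (Y x) - 2 * B x z (Y x)) / 2) / u x := by
    intro z
    rw [hNd.fderiv]
    have h1 := hdBY z (Y x)
    have h2 : fderiv ℝ u x (fderiv ℝ Y x z) = B x (fderiv ℝ Y x z) (Y x) := by
      rw [hs, hBYx]
    have h3 : B x z (Y x) = fderiv ℝ u x z := by rw [hs, hBYx]
    simp only [sub_apply, smul_apply,
      add_apply, ContinuousLinearMap.comp_apply,
      ContinuousLinearMap.flip_apply, smul_eq_mul, gradHessian, h2, h3, hDs (Y x) z (Y x)]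
    rw [← h1]
    field_simp
    ring
  -- the differential of `X`
  have hXd : ∀ z, fderiv ℝ (fun y => (1 / (2 * N y)) • Y y) x z =
      (1 / (2 * Nx)) • fderiv ℝ Y x z - (fderiv ℝ N x z / (2 * Nx ^ 2)) • Y x := by
    intro z
    have h2 : HasFDerivAt (fun y => 1 / (2 * N y))
        (-((2 * Nx) ^ 2)⁻¹ • ((2 : ℝ) • fderiv ℝ N x)) x := by
      simp only [one_div]
      exact (hasDerivAt_inv (by positivity)).comp_hasFDerivAt x
        (hNd.differentiableAt.hasFDerivAt.const_mul 2)
    have h3 : HasFDerivAt (fun y => (1 / (2 * N y)) • Y y) _ x := h2.smul hY.hasFDerivAt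
    rw [h3.fderiv]
    simp only [add_apply, smul_apply,
      ContinuousLinearMap.smulRight_apply, smul_eq_mul]
    rw [sub_eq_add_neg, ← neg_smul]
    congr 2
    field_simp
  set T := gradHessian B u Y x v v - 2 * B x v v with hT
  set T' := gradHessian B u Y x v (Y x) - 2 * B x v (Y x) with hT'
  set d := fderiv ℝ u x v with hd
  have hmain : fderiv ℝ B x ((1 / (2 * Nx)) • Y x) v v +
      2 * B x (fderiv ℝ (fun y => (1 / (2 * N y)) • Y y) x v) v - 2 * B x v v =
      (2 * (1 - Nx) * B x v v + T) / Nx - ((1 - Nx) * d ^ 2 + T' * d / 2) / (u x * Nx ^ 2) := by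
    have h1 := hdBY v v
    have h3 : B x (Y x) v = d := by rw [hBYx]
    rw [hXd, hdN]
    simp only [map_smul, map_sub, sub_apply, smul_apply,
      smul_eq_mul, h3]
    have h4 : T = fderiv ℝ (fderiv ℝ u) x v v -
      (1 / 2) * (fderiv ℝ B x v v (Y x) + fderiv ℝ B x v v (Y x) - fderiv ℝ B x (Y x) v v)
        - 2 * B x v v := rfl
    rw [h4, ← h1, hDs v v (Y x)]
    field_simp
    ring
  rw [hmain]
  -- In the estimates `1 / N ≤ 4`, whence `24 = 4 (2 · 5/2 + 1)` and `48 = 4 · 4 (5/2 + 1/2)`.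
  have hb : 0 ≤ B x v v := hpos v
  have hθ : 0 ≤ θ := by nlinarith [abs_nonneg (Nx - 1)]
  have hd2 : d ^ 2 ≤ 4 * u x * Nx * B x v v := by
    have := sq_le_of_nonneg_form (B x) hs hpos (Y x) v
    rw [hYY, hBYx] at this
    exact this
  have hTb : |T| ≤ θ * B x v v := by
    have := hH v v
    rwa [mul_assoc, Real.mul_self_sqrt hb] at this
  have hT'd : |T' * d| ≤ θ * (4 * u x * Nx * B x v v) := by
    have h1 := hH v (Y x)
    rw [abs_mul]
    have h2 : |d| ≤ √(B x (Y x) (Y x)) * √(B x v v) := by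
      rw [← Real.sqrt_mul (hpos _), hYY]
      exact Real.abs_le_sqrt hd2
    calc |T'| * |d| ≤ (θ * √(B x v v) * √(B x (Y x) (Y x))) *
          (√(B x (Y x) (Y x)) * √(B x v v)) := by gcongr
      _ = θ * (√(B x (Y x) (Y x)) * √(B x (Y x) (Y x))) * (√(B x v v) * √(B x v v)) := by ring
      _ = θ * (4 * u x * Nx * B x v v) := by
        rw [Real.mul_self_sqrt hb, Real.mul_self_sqrt (hpos _), hYY]; ring
  have hN1' : |1 - Nx| ≤ 5 / 2 * θ := by rw [abs_sub_comm]; exact hN1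
  have hA : |(2 * (1 - Nx) * B x v v + T) / Nx| ≤ 24 * θ * B x v v := by
    rw [abs_div, abs_of_pos hNpos, div_le_iff₀ hNpos]
    have h1 : |2 * (1 - Nx) * B x v v + T| ≤ 2 * (5 / 2 * θ) * B x v v + θ * B x v v := by
      refine (abs_add_le _ _).trans (add_le_add ?_ hTb)
      rw [abs_mul, abs_mul, abs_of_nonneg hb, abs_two]
      gcongr
    have h2 : 0 ≤ θ * B x v v := mul_nonneg hθ hb
    nlinarith
  have hC : |((1 - Nx) * d ^ 2 + T' * d / 2) / (u x * Nx ^ 2)| ≤ 48 * θ * B x v v := by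
    have hpos' : 0 < u x * Nx ^ 2 := by positivity
    rw [abs_div, abs_of_pos hpos', div_le_iff₀ hpos']
    have h1 : |(1 - Nx) * d ^ 2 + T' * d / 2| ≤
        5 / 2 * θ * (4 * u x * Nx * B x v v) + θ * (4 * u x * Nx * B x v v) / 2 := by
      refine (abs_add_le _ _).trans (add_le_add ?_ ?_)
      · rw [abs_mul, abs_of_nonneg (sq_nonneg d)]
        gcongr
      · rw [abs_div, abs_two]
        gcongr
    have h2 : 0 ≤ θ * B x v v * u x * Nx := by positivity
    nlinarith
  calc |(2 * (1 - Nx) * B x v v + T) / Nx - ((1 - Nx) * d ^ 2 + T' * d / 2) / (u x * Nx ^ 2)|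
      ≤ 24 * θ * B x v v + 48 * θ * B x v v := (abs_sub _ _).trans (add_le_add hA hC)
    _ = 72 * θ * B x v v := by ring

end LieDerivative

/-! ### Coordinates -/

section Coordinates

variable {n : ℕ} {M : Type*} [TopologicalSpace M] [ChartedSpace (EuclideanSpace ℝ (Fin n)) M]

/-- The form field `β` is bilinear at `p`. -/
def IsBilinearAt (β : FormField n M) (p : M) : Prop :=
  ∃ L : TangentSpace (𝓡 n) p →ₗ[ℝ] TangentSpace (𝓡 n) p →ₗ[ℝ] ℝ, ∀ v w, β p v w = L v w

/-- The coordinate vector field of `v` in the chart `φ`, at the point with coordinates `x`. -/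
def coordVector (φ : OpenPartialHomeomorph M (EuclideanSpace ℝ (Fin n)))
    (x v : EuclideanSpace ℝ (Fin n)) : TangentSpace (𝓡 n) (φ.symm x) :=
  mfderiv (𝓡 n) (𝓡 n) φ.symm x v

/-- A form field in the coordinates of a chart, as a field of continuous bilinear forms on `ℝⁿ`. -/
def coordForm (β : FormField n M) (φ : OpenPartialHomeomorph M (EuclideanSpace ℝ (Fin n)))
    (x : EuclideanSpace ℝ (Fin n)) :
    EuclideanSpace ℝ (Fin n) →L[ℝ] EuclideanSpace ℝ (Fin n) →L[ℝ] ℝ :=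
  ∑ i, ∑ j, coordMatrix β φ x i j •
    (EuclideanSpace.proj i : EuclideanSpace ℝ (Fin n) →L[ℝ] ℝ).smulRight
      (EuclideanSpace.proj j : EuclideanSpace ℝ (Fin n) →L[ℝ] ℝ)

theorem coordForm_apply (β : FormField n M)
    (φ : OpenPartialHomeomorph M (EuclideanSpace ℝ (Fin n))) (x v w : EuclideanSpace ℝ (Fin n)) :
    coordForm β φ x v w = ∑ i, ∑ j, coordMatrix β φ x i j * (v i * w j) := by
  simp [coordForm]

theorem sum_smul_single (v : EuclideanSpace ℝ (Fin n)) :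
    v = ∑ i, v i • EuclideanSpace.single i (1 : ℝ) := by
  ext j
  simp [Pi.single_apply]

theorem coordVector_smul (φ : OpenPartialHomeomorph M (EuclideanSpace ℝ (Fin n)))
    (x v : EuclideanSpace ℝ (Fin n)) (c : ℝ) :
    coordVector φ x (c • v) = c • coordVector φ x v :=
  map_smul (mfderiv (𝓡 n) (𝓡 n) φ.symm x) c v

theorem coordVector_eq_sum (φ : OpenPartialHomeomorph M (EuclideanSpace ℝ (Fin n)))
    (x v : EuclideanSpace ℝ (Fin n)) :
    coordVector φ x v = ∑ i, v i • coordVector φ x (EuclideanSpace.single i (1 : ℝ)) := by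
  have h := congrArg (mfderiv (𝓡 n) (𝓡 n) φ.symm x) (sum_smul_single v)
  have h2 := map_sum (mfderiv (𝓡 n) (𝓡 n) φ.symm x)
    (fun i => v i • EuclideanSpace.single i (1 : ℝ)) Finset.univ
  refine (h.trans h2).trans (Finset.sum_congr rfl fun i _ => ?_)
  exact map_smul (mfderiv (𝓡 n) (𝓡 n) φ.symm x) _ _

theorem coordForm_eq {β : FormField n M}
    {φ : OpenPartialHomeomorph M (EuclideanSpace ℝ (Fin n))} {x : EuclideanSpace ℝ (Fin n)}
    (hβ : IsBilinearAt β (φ.symm x)) (v w : EuclideanSpace ℝ (Fin n)) :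
    coordForm β φ x v w = β (φ.symm x) (coordVector φ x v) (coordVector φ x w) := by
  obtain ⟨L, hL⟩ := hβ
  rw [coordForm_apply, hL, coordVector_eq_sum φ x v, coordVector_eq_sum φ x w]
  simp only [map_sum, LinearMap.sum_apply, map_smul, LinearMap.smul_apply, smul_eq_mul]
  rw [Finset.sum_comm]
  refine (Finset.sum_congr rfl fun i _ => ?_)
  rw [Finset.mul_sum]
  refine (Finset.sum_congr rfl fun j _ => ?_)
  rw [← hL]
  change β (φ.symm x) _ _ * _ = _
  simp only [coordVector]
  ring

theorem coordForm_single (β : FormField n M)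
    (φ : OpenPartialHomeomorph M (EuclideanSpace ℝ (Fin n))) (x : EuclideanSpace ℝ (Fin n))
    (i j : Fin n) :
    coordForm β φ x (EuclideanSpace.single i 1) (EuclideanSpace.single j 1) =
      coordMatrix β φ x i j := by
  rw [coordForm_apply]
  simp

theorem coordForm_eq_dotProduct (β : FormField n M)
    (φ : OpenPartialHomeomorph M (EuclideanSpace ℝ (Fin n))) (x v w : EuclideanSpace ℝ (Fin n)) :
    coordForm β φ x v w = v.ofLp ⬝ᵥ (coordMatrix β φ x *ᵥ w.ofLp) := by
  rw [coordForm_apply]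
  simp only [dotProduct, Matrix.mulVec, Finset.mul_sum]
  exact Finset.sum_congr rfl fun i _ => Finset.sum_congr rfl fun j _ => by ring

theorem isBilinearAt_formC1 [IsManifold (𝓡 n) ∞ M] (g : C1Metric n M) (p : M) :
    IsBilinearAt (formC1 g) p :=
  ⟨LinearMap.mk₂ ℝ (fun v w => g.inner p v w) (by simp) (by simp) (by simp) (by simp),
    fun _ _ => rfl⟩

theorem isBilinearAt_formC0 [IsManifold (𝓡 n) ∞ M] (g : C0Metric n M) (p : M) :
    IsBilinearAt (formC0 g) p :=
  ⟨LinearMap.mk₂ ℝ (fun v w => g.inner p v w) (by simp) (by simp) (by simp) (by simp),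
    fun _ _ => rfl⟩

variable {φ : OpenPartialHomeomorph M (EuclideanSpace ℝ (Fin n))}

theorem mdifferentiable_chart (hφ : φ ∈ IsManifold.maximalAtlas (𝓡 n) ∞ M) :
    φ.MDifferentiable (𝓡 n) (𝓡 n) :=
  ⟨(contMDiffOn_of_mem_maximalAtlas hφ).mdifferentiableOn (by simp),
    (contMDiffOn_symm_of_mem_maximalAtlas hφ).mdifferentiableOn (by simp)⟩

/-- The components of a tangent vector in the chart `φ`. -/
def vectorCoord (φ : OpenPartialHomeomorph M (EuclideanSpace ℝ (Fin n))) (p : M)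
    (v : TangentSpace (𝓡 n) p) : EuclideanSpace ℝ (Fin n) :=
  mfderiv (𝓡 n) (𝓡 n) φ p v

theorem vectorCoord_coordVector (hφ : φ ∈ IsManifold.maximalAtlas (𝓡 n) ∞ M)
    {x : EuclideanSpace ℝ (Fin n)} (hx : x ∈ φ.target) (v : EuclideanSpace ℝ (Fin n)) :
    vectorCoord φ (φ.symm x) (coordVector φ x v) = v :=
  congrArg (fun L => L v) ((mdifferentiable_chart hφ).comp_symm_deriv hx)

theorem coordVector_vectorCoord (hφ : φ ∈ IsManifold.maximalAtlas (𝓡 n) ∞ M)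
    {x : EuclideanSpace ℝ (Fin n)} (hx : x ∈ φ.target) (v : TangentSpace (𝓡 n) (φ.symm x)) :
    coordVector φ x (vectorCoord φ (φ.symm x) v) = v := by
  have h := (mdifferentiable_chart hφ).symm_comp_deriv (φ.map_target hx)
  have h2 : coordVector φ (φ (φ.symm x)) (vectorCoord φ (φ.symm x) v) = v :=
    congrArg (fun L => L v) h
  rwa [φ.right_inv hx] at h2

theorem coordVector_injective (hφ : φ ∈ IsManifold.maximalAtlas (𝓡 n) ∞ M)
    {x : EuclideanSpace ℝ (Fin n)} (hx : x ∈ φ.target) {v : EuclideanSpace ℝ (Fin n)}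
    (hv : coordVector φ x v = 0) : v = 0 := by
  rw [← vectorCoord_coordVector hφ hx v, hv]
  exact map_zero (mfderiv (𝓡 n) (𝓡 n) φ (φ.symm x))

theorem differential_coordVector (hφ : φ ∈ IsManifold.maximalAtlas (𝓡 n) ∞ M)
    {x : EuclideanSpace ℝ (Fin n)} (hx : x ∈ φ.target) {f : M → ℝ}
    (hf : MDifferentiableAt (𝓡 n) 𝓘(ℝ, ℝ) f (φ.symm x)) (v : EuclideanSpace ℝ (Fin n)) :
    differential f (φ.symm x) (coordVector φ x v) = fderiv ℝ (f ∘ φ.symm) x v := by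
  have h := mfderiv_comp x hf ((mdifferentiable_chart hφ).mdifferentiableAt_symm hx)
  rw [mfderiv_eq_fderiv] at h
  exact (congrArg (fun L => L v) h).symm

theorem contDiffOn_comp_symm (hφ : φ ∈ IsManifold.maximalAtlas (𝓡 n) ∞ M) {f : M → ℝ} {k : ℕ}
    (hf : ContMDiff (𝓡 n) 𝓘(ℝ, ℝ) k f) : ContDiffOn ℝ k (f ∘ φ.symm) φ.target := by
  rw [← contMDiffOn_iff_contDiffOn]
  exact hf.comp_contMDiffOn
    ((contMDiffOn_symm_of_mem_maximalAtlas hφ).of_le (by exact_mod_cast le_top))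

theorem differential_sq {r : M → ℝ} (hr : MDifferentiable (𝓡 n) 𝓘(ℝ, ℝ) r) (p : M)
    (v : TangentSpace (𝓡 n) p) :
    differential (fun p => r p ^ 2) p v = 2 * r p * differential r p v := by
  have h1 : HasMFDerivAt (𝓡 n) 𝓘(ℝ, ℝ) (fun p => r p ^ 2) p _ :=
    HasMFDerivAt.comp p (g := fun t : ℝ => t ^ 2) (I' := 𝓘(ℝ, ℝ))
    (hasDerivAt_pow 2 (r p)).hasFDerivAt.hasMFDerivAt (hr p).hasMFDerivAt
  have h2 := congrArg (fun L => L v) h1.mfderiv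
  refine h2.trans ?_
  change differential r p v * ((2 : ℕ) * r p ^ (2 - 1)) = _
  norm_num
  ring

end Coordinates

/-! ### Metrics and gradients in coordinates -/

section Metric

variable {n : ℕ} {M : Type*} [TopologicalSpace M] [ChartedSpace (EuclideanSpace ℝ (Fin n)) M]
  [IsManifold (𝓡 n) ∞ M]
variable {φ : OpenPartialHomeomorph M (EuclideanSpace ℝ (Fin n))}

theorem contMDiffOn_coordVector (hφ : φ ∈ IsManifold.maximalAtlas (𝓡 n) ∞ M) {k : ℕ}
    {V : EuclideanSpace ℝ (Fin n) → EuclideanSpace ℝ (Fin n)} (hV : ContDiffOn ℝ k V φ.target) :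
    ContMDiffOn (𝓡 n) (𝓡 n).tangent k
      (fun x => (⟨φ.symm x, coordVector φ x (V x)⟩ : TangentBundle (𝓡 n) M)) φ.target := by
  have h1 : ContMDiffOn (𝓡 n) (𝓡 n).tangent k
      (fun x => (⟨x, V x⟩ : TangentBundle (𝓡 n) (EuclideanSpace ℝ (Fin n)))) φ.target :=
    contMDiffOn_vectorSpace_iff_contDiffOn.2 hV
  have h2 := ((contMDiffOn_symm_of_mem_maximalAtlas hφ)).contMDiffOn_tangentMapWithin (m := k)
    (by exact_mod_cast le_top) φ.open_target.uniqueMDiffOn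
  refine (h2.comp h1 fun x hx => hx).congr fun x hx => ?_
  simp only [tangentMapWithin, Function.comp, coordVector]
  rw [mfderivWithin_of_isOpen φ.open_target hx]

theorem contDiffOn_coordMatrix (g : C1Metric n M) (hφ : φ ∈ IsManifold.maximalAtlas (𝓡 n) ∞ M)
    (i j : Fin n) : ContDiffOn ℝ 1 (fun x => coordMatrix (formC1 g) φ x i j) φ.target := by
  have hv := fun i => contMDiffOn_coordVector hφ (k := 1) (V := fun _ => EuclideanSpace.single i 1)
    contDiffOn_const
  have hg := g.contMDiff.comp_contMDiffOn
    ((contMDiffOn_symm_of_mem_maximalAtlas hφ).of_le (m := 1) (by exact_mod_cast le_top))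
  have := ContMDiffOn.clm_bundle_apply₂ (E₃ := Bundle.Trivial M ℝ) hg (hv i) (hv j)
  intro x hx
  have h2 := this x hx
  simp only [Bundle.contMDiffWithinAt_totalSpace] at h2
  exact contMDiffWithinAt_iff_contDiffWithinAt.1 h2.2

theorem continuousOn_coordMatrix (g : C0Metric n M) (hφ : φ ∈ IsManifold.maximalAtlas (𝓡 n) ∞ M)
    (i j : Fin n) : ContinuousOn (fun x => coordMatrix (formC0 g) φ x i j) φ.target := by
  have hv := fun i => (contMDiffOn_coordVector hφ (k := 0) (V := fun _ => EuclideanSpace.single i 1)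
    contDiffOn_const).continuousOn
  have hg := g.continuous.comp_continuousOn φ.symm.continuousOn
  have := ContinuousOn.clm_bundle_apply₂ (E₃ := Bundle.Trivial M ℝ) hg (hv i) (hv j)
  intro x hx
  have h2 := this x hx
  simp only [FiberBundle.continuousWithinAt_totalSpace] at h2
  exact h2.2

theorem contDiffOn_sum_smul {E F ι : Type*} [NormedAddCommGroup E] [NormedSpace ℝ E]
    [NormedAddCommGroup F] [NormedSpace ℝ F] [Fintype ι] {f : ι → ι → E → ℝ} {c : ι → ι → F}
    {s : Set E} {k : WithTop ℕ∞} (hf : ∀ i j, ContDiffOn ℝ k (f i j) s) :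
    ContDiffOn ℝ k (fun x => ∑ i, ∑ j, f i j x • c i j) s :=
  ContDiffOn.sum fun i _ => ContDiffOn.sum fun j _ => (hf i j).smul contDiffOn_const

theorem contDiffOn_coordForm (g : C1Metric n M) (hφ : φ ∈ IsManifold.maximalAtlas (𝓡 n) ∞ M) :
    ContDiffOn ℝ 1 (coordForm (formC1 g) φ) φ.target := by
  exact contDiffOn_sum_smul fun i j => contDiffOn_coordMatrix g hφ i j

theorem exists_equiv_of_posDef {E : Type*} [NormedAddCommGroup E] [NormedSpace ℝ E]
    [FiniteDimensional ℝ E] (b : E →L[ℝ] E →L[ℝ] ℝ) (hb : ∀ v, v ≠ 0 → 0 < b v v) :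
    ∃ e : E ≃L[ℝ] (E →L[ℝ] ℝ), (e : E →L[ℝ] E →L[ℝ] ℝ) = b := by
  have hinj : Function.Injective b := by
    rw [injective_iff_map_eq_zero]
    intro v hv
    by_contra h
    have := hb v h
    rw [hv] at this
    simp at this
  have hfr : Module.finrank ℝ E = Module.finrank ℝ (E →L[ℝ] ℝ) := by
    rw [(LinearMap.toContinuousLinearMap (𝕜 := ℝ) (E := E) (F' := ℝ)).symm.finrank_eq]
    exact (Subspace.dual_finrank_eq (K := ℝ) (V := E)).symm
  let e := LinearEquiv.ofInjectiveOfFinrankEq (b : E →ₗ[ℝ] E →L[ℝ] ℝ) hinj hfr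
  refine ⟨e.toContinuousLinearEquiv, ?_⟩
  ext v w
  rfl

/-- The defining property of the gradient: the inverse in its definition is not a junk value,
because a metric is nondegenerate. -/
theorem inner_grad (g : C1Metric n M) (f : M → ℝ) (p : M) :
    g.inner p (grad g f p) = differential f p := by
  have key : ∀ (b : EuclideanSpace ℝ (Fin n) →L[ℝ] EuclideanSpace ℝ (Fin n) →L[ℝ] ℝ)
      (_ : ∀ v, v ≠ 0 → 0 < b v v) (l : EuclideanSpace ℝ (Fin n) →L[ℝ] ℝ),
      b (b.inverse l) = l := by
    intro b hb l
    obtain ⟨e, rfl⟩ := exists_equiv_of_posDef b hb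
    simp
  exact key (g.inner p) (g.pos p) (differential f p)

theorem normGradSq_eq (g : C1Metric n M) (f : M → ℝ) (p : M) :
    normGradSq g f p = differential f p (grad g f p) := by
  rw [normGradSq, inner_grad]

/-- Cauchy-Schwarz for a `C¹` metric. -/
theorem inner_sq_le (g : C1Metric n M) (p : M) (v w : TangentSpace (𝓡 n) p) :
    g.inner p v w ^ 2 ≤ g.inner p v v * g.inner p w w :=
  sq_le_of_nonneg_form (E := EuclideanSpace ℝ (Fin n)) (g.inner p) (g.symm p)
    (fun v => by
      by_cases h : v = 0
      · subst h; exact (by simp : (0 : ℝ) ≤ g.inner p 0 0)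
      · exact (g.pos p v h).le) v w

theorem inner_self_nonneg (g : C1Metric n M) (p : M) (v : TangentSpace (𝓡 n) p) :
    0 ≤ g.inner p v v := by
  by_cases h : v = 0
  · subst h; simp
  · exact (g.pos p v h).le

theorem differential_sq_le (g : C1Metric n M) (f : M → ℝ) (p : M) (v : TangentSpace (𝓡 n) p) :
    differential f p v ^ 2 ≤ normGradSq g f p * g.inner p v v := by
  rw [← inner_grad g]
  exact inner_sq_le g p _ v

theorem coordForm_symm (g : C1Metric n M) (x v w : EuclideanSpace ℝ (Fin n)) :
    coordForm (formC1 g) φ x v w = coordForm (formC1 g) φ x w v := by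
  rw [coordForm_eq (isBilinearAt_formC1 g _), coordForm_eq (isBilinearAt_formC1 g _)]
  exact g.symm _ _ _

theorem coordForm_nonneg (g : C1Metric n M) (x v : EuclideanSpace ℝ (Fin n)) :
    0 ≤ coordForm (formC1 g) φ x v v := by
  rw [coordForm_eq (isBilinearAt_formC1 g _)]
  exact inner_self_nonneg g _ _

theorem coordForm_pos (g : C1Metric n M) (hφ : φ ∈ IsManifold.maximalAtlas (𝓡 n) ∞ M)
    {x : EuclideanSpace ℝ (Fin n)} (hx : x ∈ φ.target) {v : EuclideanSpace ℝ (Fin n)}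
    (hv : v ≠ 0) : 0 < coordForm (formC1 g) φ x v v := by
  rw [coordForm_eq (isBilinearAt_formC1 g _)]
  exact g.pos _ _ fun h => hv (coordVector_injective hφ hx h)

/-- The gradient in the coordinates of a chart. -/
def gradCoord (g : C1Metric n M) (φ : OpenPartialHomeomorph M (EuclideanSpace ℝ (Fin n)))
    (f : M → ℝ) (x : EuclideanSpace ℝ (Fin n)) : EuclideanSpace ℝ (Fin n) :=
  (coordForm (formC1 g) φ x).inverse (fderiv ℝ (f ∘ φ.symm) x)

theorem coordForm_gradCoord (g : C1Metric n M) (hφ : φ ∈ IsManifold.maximalAtlas (𝓡 n) ∞ M)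
    (f : M → ℝ) {x : EuclideanSpace ℝ (Fin n)} (hx : x ∈ φ.target) :
    coordForm (formC1 g) φ x (gradCoord g φ f x) = fderiv ℝ (f ∘ φ.symm) x := by
  obtain ⟨e, he⟩ := exists_equiv_of_posDef (coordForm (formC1 g) φ x)
    fun v hv => coordForm_pos g hφ hx hv
  rw [gradCoord, ← he]
  simp

theorem coordVector_gradCoord (g : C1Metric n M) (hφ : φ ∈ IsManifold.maximalAtlas (𝓡 n) ∞ M)
    {f : M → ℝ} (hf : MDifferentiable (𝓡 n) 𝓘(ℝ, ℝ) f) {x : EuclideanSpace ℝ (Fin n)}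
    (hx : x ∈ φ.target) : coordVector φ x (gradCoord g φ f x) = grad g f (φ.symm x) := by
  have h1 : ∀ w, g.inner (φ.symm x) (coordVector φ x (gradCoord g φ f x) - grad g f (φ.symm x)) w
      = 0 := by
    intro w
    rw [map_sub, inner_grad, ← coordVector_vectorCoord hφ hx w, sub_apply,
      differential_coordVector hφ hx (hf _), ← coordForm_gradCoord g hφ f hx,
      coordForm_eq (isBilinearAt_formC1 g _)]
    exact sub_self _
  by_contra h
  exact (g.pos _ _ (sub_ne_zero.2 h)).ne' (h1 _)

theorem contDiffOn_gradCoord (g : C1Metric n M) (hφ : φ ∈ IsManifold.maximalAtlas (𝓡 n) ∞ M)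
    {f : M → ℝ} (hf : ContMDiff (𝓡 n) 𝓘(ℝ, ℝ) 2 f) :
    ContDiffOn ℝ 1 (gradCoord g φ f) φ.target := by
  intro x hx
  obtain ⟨e, he⟩ := exists_equiv_of_posDef (coordForm (formC1 g) φ x)
    fun v hv => coordForm_pos g hφ hx hv
  have h1 : ContDiffAt ℝ 1 (fun x => (coordForm (formC1 g) φ x).inverse) x := by
    refine ContDiffAt.comp x (g := ContinuousLinearMap.inverse) ?_
      ((contDiffOn_coordForm g hφ).contDiffAt (φ.open_target.mem_nhds hx))
    rw [← he]
    exact contDiffAt_map_inverse e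
  have h2 : ContDiffAt ℝ 1 (fderiv ℝ (f ∘ φ.symm)) x :=
    ((contDiffOn_comp_symm hφ (k := 2) hf).contDiffAt (φ.open_target.mem_nhds hx)).fderiv_right
      (by norm_num)
  exact (h1.clm_apply h2).contDiffWithinAt

end Metric

/-! ### The radial field in coordinates -/

section Radial

variable {n : ℕ} {M : Type*} [TopologicalSpace M] [ChartedSpace (EuclideanSpace ℝ (Fin n)) M]
  [IsManifold (𝓡 n) ∞ M] {g : C1Metric n M} {r : M → ℝ} {RS Λ : ℝ}
  {φ : OpenPartialHomeomorph M (EuclideanSpace ℝ (Fin n))}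

namespace IsWeaklyConicalEnd

theorem r_pos (h : IsWeaklyConicalEnd g r RS Λ) (p : M) : 0 < r p := by
  linarith [h.one_le_RS, h.lt_r p]

theorem one_le_r (h : IsWeaklyConicalEnd g r RS Λ) (p : M) : 1 ≤ r p :=
  h.one_le_RS.trans (h.lt_r p).le

theorem contMDiff_sq (h : IsWeaklyConicalEnd g r RS Λ) :
    ContMDiff (𝓡 n) 𝓘(ℝ, ℝ) 2 fun p => r p ^ 2 := h.contMDiff.pow 2

theorem mdifferentiable (h : IsWeaklyConicalEnd g r RS Λ) :
    MDifferentiable (𝓡 n) 𝓘(ℝ, ℝ) r := h.contMDiff.mdifferentiable (by simp)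

theorem continuous (h : IsWeaklyConicalEnd g r RS Λ) : Continuous r := h.contMDiff.continuous

theorem div_quartic_le (h : IsWeaklyConicalEnd g r RS Λ) (p : M) :
    Λ / r p ^ 4 ≤ Λ / r p ^ 2 := by
  have := h.one_le_r p
  exact div_le_div_of_nonneg_left h.nonneg (by positivity) (pow_le_pow_right₀ this (by norm_num))

theorem quarter_le_normGradSq (h : IsWeaklyConicalEnd g r RS Λ) (p : M) :
    1 / 4 ≤ normGradSq g r p := by
  have h1 := abs_le.1 ((h.grad_bound p).trans (h.quartic_le p))
  have h2 := Real.mul_self_sqrt (inner_self_nonneg g p (grad g r p))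
  have h3 : √(normGradSq g r p) * √(normGradSq g r p) = normGradSq g r p := h2
  nlinarith

theorem normGradSq_pos (h : IsWeaklyConicalEnd g r RS Λ) (p : M) : 0 < normGradSq g r p := by
  linarith [h.quarter_le_normGradSq p]

theorem abs_normGradSq_sub_one (h : IsWeaklyConicalEnd g r RS Λ) (p : M) :
    |normGradSq g r p - 1| ≤ 5 / 2 * (Λ / r p ^ 2) := by
  have h1 := abs_le.1 ((h.grad_bound p).trans (h.quartic_le p))
  have h2 := h.grad_bound p
  have h3 : √(normGradSq g r p) * √(normGradSq g r p) = normGradSq g r p :=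
    Real.mul_self_sqrt (inner_self_nonneg g p (grad g r p))
  have h4 : normGradSq g r p - 1 = (√(normGradSq g r p) + 1) * (√(normGradSq g r p) - 1) := by
    linear_combination -h3
  -- `|∇r| ≤ 3/2`, hence the factor `5/2`
  rw [h4, abs_mul, abs_of_nonneg (by positivity : (0 : ℝ) ≤ √(normGradSq g r p) + 1)]
  exact mul_le_mul (by linarith) (h2.trans (h.div_quartic_le p)) (abs_nonneg _) (by norm_num)

end IsWeaklyConicalEnd

theorem grad_sq (hr : MDifferentiable (𝓡 n) 𝓘(ℝ, ℝ) r) (p : M) :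
    grad g (fun p => r p ^ 2) p = (2 * r p) • grad g r p := by
  have h1 : ∀ w, g.inner p (grad g (fun p => r p ^ 2) p - (2 * r p) • grad g r p) w = 0 := by
    intro w
    rw [map_sub, map_smul, inner_grad, inner_grad, sub_apply, smul_apply, differential_sq hr]
    simp
  by_contra h
  exact (g.pos _ _ (sub_ne_zero.2 h)).ne' (h1 _)

/-- The coordinate expression of the radial field, with `|∇r|²` written as `|∇r²|² / (4r²)`. -/
def radialCoord (g : C1Metric n M) (φ : OpenPartialHomeomorph M (EuclideanSpace ℝ (Fin n)))
    (r : M → ℝ) (x : EuclideanSpace ℝ (Fin n)) : EuclideanSpace ℝ (Fin n) :=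
  (1 / (2 * (fderiv ℝ ((fun p => r p ^ 2) ∘ φ.symm) x (gradCoord g φ (fun p => r p ^ 2) x) /
    (4 * ((fun p => r p ^ 2) ∘ φ.symm) x)))) • gradCoord g φ (fun p => r p ^ 2) x

theorem fderiv_gradCoord_div (h : IsWeaklyConicalEnd g r RS Λ)
    (hφ : φ ∈ IsManifold.maximalAtlas (𝓡 n) ∞ M) {x : EuclideanSpace ℝ (Fin n)}
    (hx : x ∈ φ.target) :
    fderiv ℝ ((fun p => r p ^ 2) ∘ φ.symm) x (gradCoord g φ (fun p => r p ^ 2) x) /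
      (4 * ((fun p => r p ^ 2) ∘ φ.symm) x) = normGradSq g r (φ.symm x) := by
  have hsq : MDifferentiable (𝓡 n) 𝓘(ℝ, ℝ) fun p => r p ^ 2 :=
    h.contMDiff_sq.mdifferentiable (by simp)
  rw [← differential_coordVector hφ hx (hsq _), coordVector_gradCoord g hφ hsq hx,
    differential_sq h.mdifferentiable, grad_sq h.mdifferentiable, map_smul, ← normGradSq_eq]
  have := h.r_pos (φ.symm x)
  simp only [smul_eq_mul, Function.comp]
  field_simp
  ring

theorem coordVector_radialCoord (h : IsWeaklyConicalEnd g r RS Λ)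
    (hφ : φ ∈ IsManifold.maximalAtlas (𝓡 n) ∞ M) {x : EuclideanSpace ℝ (Fin n)}
    (hx : x ∈ φ.target) :
    coordVector φ x (radialCoord g φ r x) = radialField g r (φ.symm x) := by
  have hsq : MDifferentiable (𝓡 n) 𝓘(ℝ, ℝ) fun p => r p ^ 2 :=
    h.contMDiff_sq.mdifferentiable (by simp)
  rw [radialCoord, fderiv_gradCoord_div h hφ hx, coordVector_smul,
    coordVector_gradCoord g hφ hsq hx,
    grad_sq h.mdifferentiable, radialField, smul_smul]
  congr 1
  field_simp

theorem contDiffOn_radialCoord (h : IsWeaklyConicalEnd g r RS Λ)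
    (hφ : φ ∈ IsManifold.maximalAtlas (𝓡 n) ∞ M) :
    ContDiffOn ℝ 1 (radialCoord g φ r) φ.target := by
  have hY := contDiffOn_gradCoord g hφ h.contMDiff_sq
  have hu := contDiffOn_comp_symm hφ (k := 2) h.contMDiff_sq
  have hdu : ContDiffOn ℝ 1 (fderiv ℝ ((fun p => r p ^ 2) ∘ φ.symm)) φ.target :=
    hu.fderiv_of_isOpen φ.open_target (by norm_num)
  have hu1 : ContDiffOn ℝ 1 ((fun p => r p ^ 2) ∘ φ.symm) φ.target := hu.of_le (by norm_num)
  refine ContDiffOn.smul (contDiffOn_const.div (contDiffOn_const.mul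
    ((hdu.clm_apply hY).div (contDiffOn_const.mul hu1) ?_)) ?_) hY
  · intro x hx
    have := h.r_pos (φ.symm x)
    simp only [Function.comp]
    positivity
  · intro x hx
    have h1 := fderiv_gradCoord_div h hφ hx
    have h2 := h.normGradSq_pos (φ.symm x)
    simp only [Pi.div_apply]
    rw [h1]
    positivity

theorem contMDiff_radialField (h : IsWeaklyConicalEnd g r RS Λ) :
    ContMDiff (𝓡 n) (𝓡 n).tangent 1
      (fun p => (⟨p, radialField g r p⟩ : TangentBundle (𝓡 n) M)) := by
  intro p
  set φ := chartAt (EuclideanSpace ℝ (Fin n)) p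
  have hφ : φ ∈ IsManifold.maximalAtlas (𝓡 n) ∞ M := IsManifold.chart_mem_maximalAtlas p
  have h1 := contMDiffOn_coordVector hφ (k := 1) (contDiffOn_radialCoord h hφ)
  have h2 := h1.comp
    ((contMDiffOn_of_mem_maximalAtlas hφ).of_le (m := 1) (by exact_mod_cast le_top))
    fun q hq => φ.map_source hq
  refine ((h2.congr fun q hq => ?_).contMDiffAt
    (φ.open_source.mem_nhds (mem_chart_source _ p)))
  simp only [Function.comp]
  rw [coordVector_radialCoord h hφ (φ.map_source hq), φ.left_inv hq]

/-- `𝐗 r = r`. -/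
theorem differential_radialField (h : IsWeaklyConicalEnd g r RS Λ) (p : M) :
    differential r p (radialField g r p) = r p := by
  rw [radialField, map_smul, ← normGradSq_eq, smul_eq_mul,
    div_mul_cancel₀ _ (h.normGradSq_pos p).ne']

theorem fderiv_radialCoord (h : IsWeaklyConicalEnd g r RS Λ)
    (hφ : φ ∈ IsManifold.maximalAtlas (𝓡 n) ∞ M) {x : EuclideanSpace ℝ (Fin n)}
    (hx : x ∈ φ.target) :
    fderiv ℝ ((fun p => r p ^ 2) ∘ φ.symm) x (radialCoord g φ r x) = 2 * r (φ.symm x) ^ 2 := by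
  have hsq : MDifferentiable (𝓡 n) 𝓘(ℝ, ℝ) fun p => r p ^ 2 :=
    h.contMDiff_sq.mdifferentiable (by simp)
  rw [← differential_coordVector hφ hx (hsq _), coordVector_radialCoord h hφ hx,
    differential_sq h.mdifferentiable, differential_radialField h]
  ring

theorem fderiv_coordForm_single (hφ : φ ∈ IsManifold.maximalAtlas (𝓡 n) ∞ M)
    {x : EuclideanSpace ℝ (Fin n)} (hx : x ∈ φ.target) (z : EuclideanSpace ℝ (Fin n))
    (i j : Fin n) :
    fderiv ℝ (coordForm (formC1 g) φ) x z (EuclideanSpace.single i 1) (EuclideanSpace.single j 1) =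
      fderiv ℝ (fun y => coordMatrix (formC1 g) φ y i j) x z := by
  have key : ∀ {E : Type} [NormedAddCommGroup E] [NormedSpace ℝ E] (B : E → E →L[ℝ] E →L[ℝ] ℝ)
      (x z v w : E), DifferentiableAt ℝ B x →
      fderiv ℝ B x z v w = fderiv ℝ (fun y => B y v w) x z := by
    intro E _ _ B x z v w hB
    have := (hB.hasFDerivAt.clm_apply (hasFDerivAt_const v x)).clm_apply (hasFDerivAt_const w x)
    rw [this.fderiv]
    simp
  have hB : DifferentiableAt ℝ (coordForm (formC1 g) φ) x :=
    ((contDiffOn_coordForm g hφ).contDiffAt (φ.open_target.mem_nhds hx)).differentiableAt (by simp)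
  rw [key _ _ _ _ _ hB]
  simp only [coordForm_single]

/-- The entries of the Hessian in terms of Christoffel symbols: with `Y = ∇f` the sum over `k` of
`Γ^k_{ij} ∂_k f` is `½ (∂_i g_{jl} + ∂_j g_{il} - ∂_l g_{ij}) Y^l`. -/
theorem gradHessian_single (hφ : φ ∈ IsManifold.maximalAtlas (𝓡 n) ∞ M)
    {f : M → ℝ} (hf : ContMDiff (𝓡 n) 𝓘(ℝ, ℝ) 2 f)
    {x : EuclideanSpace ℝ (Fin n)} (hx : x ∈ φ.target) (i j : Fin n) :
    gradHessian (coordForm (formC1 g) φ) (f ∘ φ.symm) (gradCoord g φ f) x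
      (EuclideanSpace.single i 1) (EuclideanSpace.single j 1) = hessian (formC1 g) f φ x i j := by
  set A := coordMatrix (formC1 g) φ x with hA
  set Y := gradCoord g φ f x with hY
  have hdet : IsUnit A.det := by
    rw [isUnit_iff_ne_zero]
    intro h0
    obtain ⟨v, hv, hv0⟩ := Matrix.exists_mulVec_eq_zero_iff.2 h0
    have h1 := coordForm_pos g hφ hx (v := WithLp.toLp 2 v) (by simpa using hv)
    rw [coordForm_eq_dotProduct] at h1
    simp [← hA, hv0] at h1
  have hsymm : Aᵀ = A := by
    ext a b
    exact g.symm _ _ _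
  have hAY : A *ᵥ Y.ofLp = fun k => partialDeriv k (f ∘ φ.symm) x := by
    ext k
    have h1 := congrArg (fun L => L (EuclideanSpace.single k 1)) (coordForm_gradCoord g hφ f hx)
    simp only [coordForm_symm g x _ (EuclideanSpace.single k 1)] at h1
    rw [coordForm_eq_dotProduct] at h1
    simpa [partialDeriv] using h1
  have hYl : ∀ l, ∑ k, A⁻¹ k l * partialDeriv k (f ∘ φ.symm) x = Y.ofLp l := by
    intro l
    have h1 : A⁻¹ *ᵥ (A *ᵥ Y.ofLp) = Y.ofLp := by
      rw [Matrix.mulVec_mulVec, Matrix.nonsing_inv_mul _ hdet, Matrix.one_mulVec]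
    have h2 : (A⁻¹)ᵀ = A⁻¹ := by rw [Matrix.transpose_nonsing_inv, hsymm]
    rw [hAY] at h1
    have h3 := congrFun h1 l
    rw [← h2] at h3
    simpa [Matrix.mulVec, dotProduct] using h3
  have hdu : DifferentiableAt ℝ (fderiv ℝ (f ∘ φ.symm)) x :=
    (((contDiffOn_comp_symm hφ (k := 2) hf).contDiffAt (φ.open_target.mem_nhds hx)).fderiv_right
      (m := 1) (by norm_num)).differentiableAt (by simp)
  have hD2 : fderiv ℝ (fderiv ℝ (f ∘ φ.symm)) x (EuclideanSpace.single i 1)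
      (EuclideanSpace.single j 1) = partialDeriv i (partialDeriv j (f ∘ φ.symm)) x := by
    have := hdu.hasFDerivAt.clm_apply (hasFDerivAt_const (EuclideanSpace.single j (1 : ℝ)) x)
    unfold partialDeriv
    rw [this.fderiv]
    simp
  have hsum : ∀ z w : EuclideanSpace ℝ (Fin n), fderiv ℝ (coordForm (formC1 g) φ) x z w Y =
      ∑ l, Y.ofLp l * fderiv ℝ (coordForm (formC1 g) φ) x z w (EuclideanSpace.single l 1) := by
    intro z w
    conv_lhs => rw [sum_smul_single Y]
    simp only [map_sum, map_smul, smul_eq_mul]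
  have hsum' : ∀ v w : EuclideanSpace ℝ (Fin n), fderiv ℝ (coordForm (formC1 g) φ) x Y v w =
      ∑ l, Y.ofLp l * fderiv ℝ (coordForm (formC1 g) φ) x (EuclideanSpace.single l 1) v w := by
    intro v w
    conv_lhs => rw [sum_smul_single Y]
    simp only [map_sum, map_smul, smul_eq_mul, sum_apply, smul_apply]
  unfold gradHessian hessian
  rw [hD2, ← hY, hsum, hsum, hsum', ← Finset.sum_add_distrib, ← Finset.sum_sub_distrib]
  simp only [Matrix.of_apply, christoffel, fderiv_coordForm_single hφ hx]
  congr 1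
  have h3 : ∀ k, (1 / 2 * ∑ l, (coordMatrix (formC1 g) φ x)⁻¹ k l *
      (partialDeriv i (fun y => coordMatrix (formC1 g) φ y j l) x +
        partialDeriv j (fun y => coordMatrix (formC1 g) φ y i l) x -
        partialDeriv l (fun y => coordMatrix (formC1 g) φ y i j) x)) *
      partialDeriv k (f ∘ φ.symm) x = 1 / 2 * ∑ l,
      (partialDeriv i (fun y => coordMatrix (formC1 g) φ y j l) x +
        partialDeriv j (fun y => coordMatrix (formC1 g) φ y i l) x -
        partialDeriv l (fun y => coordMatrix (formC1 g) φ y i j) x) *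
        (A⁻¹ k l * partialDeriv k (f ∘ φ.symm) x) := by
    intro k
    rw [mul_assoc, Finset.sum_mul]
    congr 1
    exact Finset.sum_congr rfl fun l _ => by rw [← hA]; ring
  simp only [h3]
  rw [← Finset.mul_sum, Finset.sum_comm]
  congr 1
  refine Finset.sum_congr rfl fun l _ => ?_
  rw [← Finset.mul_sum, hYl]
  unfold partialDeriv
  ring

theorem gradHessian_eq (hφ : φ ∈ IsManifold.maximalAtlas (𝓡 n) ∞ M)
    {f : M → ℝ} (hf : ContMDiff (𝓡 n) 𝓘(ℝ, ℝ) 2 f)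
    {x : EuclideanSpace ℝ (Fin n)} (hx : x ∈ φ.target) (v w : EuclideanSpace ℝ (Fin n)) :
    gradHessian (coordForm (formC1 g) φ) (f ∘ φ.symm) (gradCoord g φ f) x v w =
      v.ofLp ⬝ᵥ (hessian (formC1 g) f φ x *ᵥ w.ofLp) := by
  -- both sides are bilinear, so that it suffices to compare them on basis vectors
  have hlin : ∀ {E : Type} [NormedAddCommGroup E] [NormedSpace ℝ E] (B : E → E →L[ℝ] E →L[ℝ] ℝ)
      (u : E → ℝ) (Y : E → E) (x : E), ∃ L : E →ₗ[ℝ] E →ₗ[ℝ] ℝ,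
      ∀ v w, gradHessian B u Y x v w = L v w := by
    intro E _ _ B u Y x
    refine ⟨LinearMap.mk₂ ℝ (gradHessian B u Y x) ?_ ?_ ?_ ?_, fun _ _ => rfl⟩ <;>
    · intros
      simp only [gradHessian, map_add, map_smul, add_apply, smul_apply, smul_eq_mul]
      ring
  obtain ⟨L, hL⟩ := hlin (coordForm (formC1 g) φ) (f ∘ φ.symm) (gradCoord g φ f) x
  have h1 := fun i j => gradHessian_single (g := g) hφ hf hx i j
  simp only [hL] at h1 ⊢
  conv_lhs => rw [sum_smul_single v, sum_smul_single w]
  simp only [map_sum, LinearMap.sum_apply, map_smul, LinearMap.smul_apply, smul_eq_mul, h1,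
    dotProduct, Matrix.mulVec, Finset.mul_sum]
  rw [Finset.sum_comm]
  exact Finset.sum_congr rfl fun i _ => Finset.sum_congr rfl fun j _ => by ring

/-- `|L_X g - 2g| ≤ 72 Λ / r²` for the radial field `X`, in coordinates. -/
theorem lie_derivative_radialCoord_bound (h : IsWeaklyConicalEnd g r RS Λ)
    (hφ : φ ∈ IsManifold.maximalAtlas (𝓡 n) ∞ M) {x : EuclideanSpace ℝ (Fin n)}
    (hx : x ∈ φ.target) (v : EuclideanSpace ℝ (Fin n)) :
    |fderiv ℝ (coordForm (formC1 g) φ) x (radialCoord g φ r x) v v +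
      2 * coordForm (formC1 g) φ x (fderiv ℝ (radialCoord g φ r) x v) v -
      2 * coordForm (formC1 g) φ x v v| ≤
      72 * (Λ / r (φ.symm x) ^ 2) * coordForm (formC1 g) φ x v v := by
  have hnb := φ.open_target.mem_nhds hx
  have hu := (contDiffOn_comp_symm hφ (k := 2) h.contMDiff_sq).contDiffAt hnb
  refine lie_derivative_bound (B := coordForm (formC1 g) φ) (u := (fun p => r p ^ 2) ∘ φ.symm)
    (Y := gradCoord g φ fun p => r p ^ 2) (θ := Λ / r (φ.symm x) ^ 2)
    (((contDiffOn_coordForm g hφ).contDiffAt hnb).differentiableAt (by simp))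
    (((contDiffOn_gradCoord g hφ h.contMDiff_sq).contDiffAt hnb).differentiableAt (by simp))
    (hu.differentiableAt (by simp))
    ((hu.fderiv_right (m := 1) (by norm_num)).differentiableAt (by simp))
    (by filter_upwards [hnb] with y hy using coordForm_gradCoord g hφ _ hy)
    (Eventually.of_forall fun y v w => coordForm_symm g y v w)
    (coordForm_nonneg g x) (by have := h.r_pos (φ.symm x); simp only [Function.comp]; positivity)
    ?_ ?_ ?_ v
  · rw [fderiv_gradCoord_div h hφ hx]
    exact h.abs_normGradSq_sub_one _
  · rw [fderiv_gradCoord_div h hφ hx]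
    exact h.quarter_le_normGradSq _
  · intro v w
    have h1 := h.hess_bound φ hφ x hx v.ofLp w.ofLp
    rw [Matrix.sub_mulVec, dotProduct_sub, Matrix.smul_mulVec, dotProduct_smul, smul_eq_mul,
      ← gradHessian_eq hφ h.contMDiff_sq hx, ← coordForm_eq_dotProduct, ← coordForm_eq_dotProduct,
      ← coordForm_eq_dotProduct] at h1
    exact h1

end Radial

/-! ### Distortion of the metric by the flow of the radial field -/

section Flow

variable {n : ℕ} {M : Type*} [TopologicalSpace M] [ChartedSpace (EuclideanSpace ℝ (Fin n)) M]
  [IsManifold (𝓡 n) ∞ M] {g : C1Metric n M} {r : M → ℝ} {RS Λ : ℝ}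

/-- `F` is `C¹` near `p` and `e^{-2t} F^*g` differs from `g` at `p` at most by the factors
`exp(± 36 Λ (r(p)⁻² - r(F p)⁻²))`. Written in this multiplicative form, the bounds for two maps
multiply to the bounds for their composition. -/
def FlowBounds (g : C1Metric n M) (r : M → ℝ) (Λ t : ℝ) (F : M → M) (p : M) : Prop :=
  ContMDiffAt (𝓡 n) (𝓡 n) 1 F p ∧ ∀ v : TangentSpace (𝓡 n) p,
    Real.exp (-(2 * t)) * g.inner (F p) (mfderiv (𝓡 n) (𝓡 n) F p v)
        (mfderiv (𝓡 n) (𝓡 n) F p v) * Real.exp (36 * Λ / r (F p) ^ 2) ≤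
      g.inner p v v * Real.exp (36 * Λ / r p ^ 2) ∧
    g.inner p v v * Real.exp (-(36 * Λ / r p ^ 2)) ≤
      Real.exp (-(2 * t)) * g.inner (F p) (mfderiv (𝓡 n) (𝓡 n) F p v)
        (mfderiv (𝓡 n) (𝓡 n) F p v) * Real.exp (-(36 * Λ / r (F p) ^ 2))

theorem FlowBounds.comp {s t : ℝ} {F F' : M → M} {p : M} (hF : FlowBounds g r Λ s F p)
    (hF' : FlowBounds g r Λ t F' (F p)) : FlowBounds g r Λ (s + t) (F' ∘ F) p := by
  refine ⟨hF'.1.comp p hF.1, fun v => ?_⟩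
  have hd : mfderiv (𝓡 n) (𝓡 n) (F' ∘ F) p v =
      mfderiv (𝓡 n) (𝓡 n) F' (F p) (mfderiv (𝓡 n) (𝓡 n) F p v) :=
    congrArg (fun L => L v) (mfderiv_comp p (hF'.1.mdifferentiableAt (by simp))
      (hF.1.mdifferentiableAt (by simp)))
  have hexp : Real.exp (-(2 * (s + t))) = Real.exp (-(2 * s)) * Real.exp (-(2 * t)) := by
    rw [← Real.exp_add]; ring_nf
  have h1 := hF.2 v
  have h2 := hF'.2 (mfderiv (𝓡 n) (𝓡 n) F p v)
  rw [hd, hexp]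
  have hs := Real.exp_pos (-(2 * s))
  constructor
  · refine le_trans ?_ h1.1
    have := mul_le_mul_of_nonneg_left h2.1 hs.le
    simp only [Function.comp, mul_assoc] at this ⊢
    exact this
  · refine h1.2.trans ?_
    have := mul_le_mul_of_nonneg_left h2.2 hs.le
    simp only [Function.comp, mul_assoc] at this ⊢
    exact this

theorem FlowBounds.congr {t : ℝ} {F F' : M → M} {p : M} (hF : FlowBounds g r Λ t F p)
    (h : F' =ᶠ[𝓝 p] F) : FlowBounds g r Λ t F' p := by
  refine ⟨hF.1.congr_of_eventuallyEq h, fun v => ?_⟩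
  have hp : F' p = F p := h.self_of_nhds
  -- The tangent spaces at `F' p` and `F p` are only propositionally equal.
  have hd : ∀ {p₁ p₂ : M} (L₁ : TangentSpace (𝓡 n) p →L[ℝ] TangentSpace (𝓡 n) p₁)
      (L₂ : TangentSpace (𝓡 n) p →L[ℝ] TangentSpace (𝓡 n) p₂), p₁ = p₂ → HEq L₁ L₂ →
      g.inner p₁ (L₁ v) (L₁ v) = g.inner p₂ (L₂ v) (L₂ v) ∧ r p₁ = r p₂ := by
    rintro p₁ _ L₁ L₂ rfl h
    obtain rfl := eq_of_heq h
    exact ⟨rfl, rfl⟩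
  have hm : HEq (mfderiv (𝓡 n) (𝓡 n) F' p) (mfderiv (𝓡 n) (𝓡 n) F p) := by
    have := h.mfderiv_eq (I := 𝓡 n) (I' := 𝓡 n)
    exact heq_of_eq this
  obtain ⟨h1, h2⟩ := hd (mfderiv (𝓡 n) (𝓡 n) F' p) (mfderiv (𝓡 n) (𝓡 n) F p) hp hm
  rw [h1, h2]
  exact hF.2 v

theorem FlowBounds.id (p : M) : FlowBounds g r Λ 0 id p := by
  refine ⟨contMDiffAt_id, fun v => ?_⟩
  have : mfderiv (𝓡 n) (𝓡 n) (_root_.id : M → M) p v = v :=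
    congrArg (fun L => L v) mfderiv_id
  rw [this]
  simp

/-- Near `q` the radial field has integral curves on the time interval `(-ε, ε)`, and the flow
they define for `0 ≤ t < ε` satisfies the bounds of `FlowBounds`. -/
def HasLocalFlow (g : C1Metric n M) (r : M → ℝ) (Λ ε : ℝ) (q : M) : Prop :=
  ∃ c : M → ℝ → M, ∀ᶠ q' in 𝓝 q, c q' 0 = q' ∧
    IsMIntegralCurveOn (c q') (radialField g r) (Ioo (-ε) ε) ∧
    ∀ t ∈ Ico 0 ε, FlowBounds g r Λ t (fun y => c y t) q'

theorem HasLocalFlow.mono {ε ε' : ℝ} {q : M} (h : HasLocalFlow g r Λ ε q) (hε : ε' ≤ ε) :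
    HasLocalFlow g r Λ ε' q := by
  obtain ⟨c, hc⟩ := h
  refine ⟨c, hc.mono fun q' ⟨h1, h2, h3⟩ => ⟨h1, h2.mono (Ioo_subset_Ioo (by linarith) hε),
    fun t ht => h3 t ⟨ht.1, ht.2.trans_le hε⟩⟩⟩

theorem hasDerivAt_form_along {E : Type*} [NormedAddCommGroup E] [NormedSpace ℝ E]
    (B : E → E →L[ℝ] E →L[ℝ] ℝ) (c w : ℝ → E) (c' w' : E) (s : ℝ)
    (hsymm : ∀ v w, B (c s) v w = B (c s) w v) (hB : DifferentiableAt ℝ B (c s))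
    (hc : HasDerivAt c c' s) (hw : HasDerivAt w w' s) :
    HasDerivAt (fun s => B (c s) (w s) (w s))
      (fderiv ℝ B (c s) c' (w s) (w s) + 2 * B (c s) w' (w s)) s := by
  have h1 : HasDerivAt (fun s => B (c s)) (fderiv ℝ B (c s) c') s :=
    HasFDerivAt.comp_hasDerivAt (F := E) (E := E →L[ℝ] E →L[ℝ] ℝ) (l := B) s hB.hasFDerivAt hc
  refine ((h1.clm_apply hw).clm_apply hw).congr_deriv ?_
  rw [add_apply, hsymm (w s) w']
  ring

/-- The radial field has local flows, uniformly in time near each point, and they satisfy the bounds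
of `FlowBounds`: these follow from `lie_derivative_radialCoord_bound` by integration along the
integral curves, on which `(r²)' = 2 r²`. -/
theorem exists_hasLocalFlow (h : IsWeaklyConicalEnd g r RS Λ) (p : M) :
    ∃ ε > 0, ∀ᶠ q in 𝓝 p, HasLocalFlow g r Λ ε q := by
  set φ := chartAt (EuclideanSpace ℝ (Fin n)) p with hφdef
  have hφ : φ ∈ IsManifold.maximalAtlas (𝓡 n) ∞ M := IsManifold.chart_mem_maximalAtlas p
  have hps : p ∈ φ.source := mem_chart_source _ p
  have hX := contDiffOn_radialCoord h hφ
  obtain ⟨δ, hδ, ε, hε, Φ, W, hΦ⟩ := exists_local_flow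
    (hX.contDiffAt (φ.open_target.mem_nhds (φ.map_source hps)))
    (φ.open_target.mem_nhds (φ.map_source hps))
  refine ⟨ε, hε, ?_⟩
  have hnear : ∀ᶠ q in 𝓝 p, q ∈ φ.source ∧ φ q ∈ Metric.ball (φ p) δ :=
    (φ.open_source.eventually_mem hps).and
      ((φ.continuousAt hps).eventually (Metric.ball_mem_nhds _ hδ))
  filter_upwards [hnear.eventually_nhds] with q₀ hq₀
  refine ⟨fun q t => φ.symm (Φ (φ q) t), ?_⟩
  filter_upwards [hq₀] with q hq
  obtain ⟨hqs, hqb⟩ := hq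
  obtain ⟨hΦ0, hW0, hΦt, hΦs⟩ := hΦ _ hqb
  refine ⟨by simp only [hΦ0, φ.left_inv hqs], fun t ht => ?_, fun t ht => ?_⟩
  · obtain ⟨h1, h2, -⟩ := hΦt t ht
    have h3 := (((mdifferentiable_chart hφ).mdifferentiableAt_symm h1).hasMFDerivAt.comp t
      h2.hasFDerivAt.hasMFDerivAt)
    refine HasMFDerivAt.hasMFDerivWithinAt (h3.congr_mfderiv ?_)
    ext
    symm
    rw [← coordVector_radialCoord h hφ h1]
    change (1 : ℝ) • coordVector φ (Φ (φ q) t) _ =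
      coordVector φ (Φ (φ q) t) ((1 : ℝ) • radialCoord g φ r (Φ (φ q) t))
    rw [one_smul, one_smul]
  · have ht' : t ∈ Ioo (-ε) ε := ⟨by linarith [ht.1], ht.2⟩
    obtain ⟨h1, h2, h3⟩ := hΦt t ht'
    obtain ⟨h4, h5⟩ := hΦs t ht
    have hφq : MDifferentiableAt (𝓡 n) (𝓡 n) φ q := (mdifferentiable_chart hφ).mdifferentiableAt hqs
    refine ⟨?_, fun v => ?_⟩
    · have h6 : ContMDiffAt (𝓡 n) (𝓡 n) 1 φ q :=
        ((contMDiffOn_of_mem_maximalAtlas hφ).contMDiffAt (φ.open_source.mem_nhds hqs)).of_le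
          (by exact_mod_cast le_top)
      have h7 : ContMDiffAt (𝓡 n) (𝓡 n) 1 φ.symm (Φ (φ q) t) :=
        ((contMDiffOn_symm_of_mem_maximalAtlas hφ).contMDiffAt (φ.open_target.mem_nhds h1)).of_le
          (by exact_mod_cast le_top)
      exact ContMDiffAt.comp (g := φ.symm) q h7 (ContMDiffAt.comp (g := fun y => Φ y t) q
        h5.contMDiffAt h6)
    · set V := vectorCoord φ q v with hV
      have hd : mfderiv (𝓡 n) (𝓡 n) (fun y => φ.symm (Φ (φ y) t)) q v =
          coordVector φ (Φ (φ q) t) (W (φ q) t V) := by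
        have h6 := (((mdifferentiable_chart hφ).mdifferentiableAt_symm h1).hasMFDerivAt.comp q
          (HasMFDerivAt.comp q (g := fun y => Φ y t) h4.hasMFDerivAt hφq.hasMFDerivAt))
        exact congrArg (fun L => L v) h6.mfderiv
      set B := coordForm (formC1 g) φ with hB
      have hgt : ∀ s ∈ Icc 0 t, s ∈ Ioo (-ε) ε := fun s hs =>
        ⟨by linarith [hs.1], by linarith [hs.2, ht.2]⟩
      have hBd : ∀ s ∈ Icc 0 t, HasDerivAt (fun s => B (Φ (φ q) s) (W (φ q) s V) (W (φ q) s V))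
          (fderiv ℝ B (Φ (φ q) s) (radialCoord g φ r (Φ (φ q) s)) (W (φ q) s V) (W (φ q) s V) +
            2 * B (Φ (φ q) s) (fderiv ℝ (radialCoord g φ r) (Φ (φ q) s) (W (φ q) s V))
              (W (φ q) s V)) s := by
        intro s hs
        obtain ⟨k1, k2, k3⟩ := hΦt s (hgt s hs)
        have hBs := ((contDiffOn_coordForm g hφ).contDiffAt
          (φ.open_target.mem_nhds k1)).differentiableAt (by simp)
        refine hasDerivAt_form_along B (fun s => Φ (φ q) s) (fun s => W (φ q) s V) _ _ s
          (fun v w => coordForm_symm g _ v w) hBs k2 ?_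
        have := k3.clm_apply (hasDerivAt_const s V)
        simpa using this
      -- `|L_X g - 2g| ≤ 72 Λ r⁻² g` is the hypothesis of `exp_mul_bounds` for `k = 36 Λ`, `q = r²`
      have := exp_mul_bounds (k := 36 * Λ) (T := t)
        (a := fun s => Real.exp (-(2 * s)) * B (Φ (φ q) s) (W (φ q) s V) (W (φ q) s V))
        (q := fun s => r (φ.symm (Φ (φ q) s)) ^ 2) ht.1
        (fun s hs => ((((hasDerivAt_id s).const_mul 2).neg.exp).mul (hBd s hs))) ?_ ?_ ?_
      · simp only [hΦ0, hW0, mul_zero, neg_zero, Real.exp_zero, one_mul,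
          ContinuousLinearMap.id_apply, φ.left_inv hqs] at this
        have e1 : B (φ q) V V = g.inner q v v := by
          rw [hB, coordForm_eq (isBilinearAt_formC1 g _)]
          have e2 : ∀ p', φ.symm (φ q) = p' → ∀ v : TangentSpace (𝓡 n) p',
              formC1 g (φ.symm (φ q)) (coordVector φ (φ q) (vectorCoord φ p' v))
                (coordVector φ (φ q) (vectorCoord φ p' v)) = g.inner p' v v := by
            rintro _ rfl v
            rw [coordVector_vectorCoord hφ (φ.map_source hqs)]
            rfl
          exact e2 q (φ.left_inv hqs) v
        have e3 : B (Φ (φ q) t) (W (φ q) t V) (W (φ q) t V) =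
            g.inner (φ.symm (Φ (φ q) t))
              (mfderiv (𝓡 n) (𝓡 n) (fun y => φ.symm (Φ (φ y) t)) q v)
              (mfderiv (𝓡 n) (𝓡 n) (fun y => φ.symm (Φ (φ y) t)) q v) := by
          rw [hB, coordForm_eq (isBilinearAt_formC1 g _), hd]
          rfl
        rw [e1, e3] at this
        exact this
      · intro s hs
        obtain ⟨k1, k2, -⟩ := hΦt s (hgt s hs)
        have k3 := ((contDiffOn_comp_symm hφ (k := 2) h.contMDiff_sq).contDiffAt
          (φ.open_target.mem_nhds k1)).differentiableAt (by simp)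
        have k4 := k3.hasFDerivAt.comp_hasDerivAt s k2
        rw [fderiv_radialCoord h hφ k1] at k4
        exact k4
      · intro s hs
        have := h.r_pos (φ.symm (Φ (φ q) s))
        positivity
      · intro s hs
        obtain ⟨k1, -, -⟩ := hΦt s (hgt s hs)
        have k2 := lie_derivative_radialCoord_bound h hφ k1 (W (φ q) s V)
        have k3 := Real.exp_pos (-(2 * s))
        have k4 := mul_le_mul_of_nonneg_left k2 k3.le
        rw [← abs_of_pos k3, ← abs_mul, abs_of_pos k3] at k4
        refine le_trans (le_of_eq ?_) (k4.trans (le_of_eq ?_))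
        · congr 1
          simp only [id, Pi.neg_apply, hB]
          ring
        · simp only [hB]
          ring

end Flow

/-! ### The global forward flow -/

section GlobalFlow

variable {n : ℕ} {M : Type*} [TopologicalSpace M] [ChartedSpace (EuclideanSpace ℝ (Fin n)) M]

theorem hasDerivWithinAt_comp_curve {X : ∀ p : M, TangentSpace (𝓡 n) p} {γ : ℝ → M} {t : ℝ}
    {s : Set ℝ}
    (hγ : IsMIntegralCurveOn γ X s) (ht : t ∈ s) {G : M → ℝ}
    (hG : MDifferentiable (𝓡 n) 𝓘(ℝ, ℝ) G) :
    HasDerivWithinAt (G ∘ γ) (differential G (γ t) (X (γ t))) s t := by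
  obtain ⟨L, hL, h1⟩ : ∃ L : ℝ →L[ℝ] ℝ, L 1 = differential G (γ t) (X (γ t)) ∧
      HasFDerivWithinAt (G ∘ γ) L s t := by
    refine ⟨_, ?_, ((hG (γ t)).hasMFDerivAt.comp_hasMFDerivWithinAt t (hγ t ht)).hasFDerivWithinAt⟩
    change differential G (γ t) ((1 : ℝ) • X (γ t)) = _
    rw [one_smul]
  rw [← hL]
  exact h1.hasDerivWithinAt

variable [IsManifold (𝓡 n) ∞ M] {g : C1Metric n M} {r : M → ℝ} {RS Λ : ℝ}

/-- Since `𝐗 r = r`, the function `r` grows exactly exponentially along the integral curves. -/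
theorem r_curve (h : IsWeaklyConicalEnd g r RS Λ) {γ : ℝ → M} {a b t : ℝ}
    (hγ : IsMIntegralCurveOn γ (radialField g r) (Ioo a b)) (h0 : (0 : ℝ) ∈ Ioo a b)
    (ht : t ∈ Ioo a b) : r (γ t) = Real.exp t * r (γ 0) := by
  have hd : ∀ s ∈ Ioo a b, HasDerivAt (fun s => Real.exp (-s) * r (γ s)) 0 s := by
    intro s hs
    have h1 := (hasDerivWithinAt_comp_curve hγ hs h.mdifferentiable).hasDerivAt
      (Ioo_mem_nhds hs.1 hs.2)
    rw [differential_radialField h] at h1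
    have h2 := ((hasDerivAt_id s).neg.exp).mul h1
    refine h2.congr_deriv ?_
    simp
  have h2 := (convex_Ioo a b).is_const_of_fderivWithin_eq_zero
    (f := fun s => Real.exp (-s) * r (γ s)) (𝕜 := ℝ)
    (fun s hs => (hd s hs).differentiableAt.differentiableWithinAt)
    (fun s hs => by
      rw [fderivWithin_of_isOpen isOpen_Ioo hs, (hd s hs).hasFDerivAt.fderiv]
      ext; simp) ht h0
  simp only [neg_zero, Real.exp_zero, one_mul] at h2
  rw [← h2, ← mul_assoc, ← Real.exp_add]
  simp

/-- The flow exists for a uniform time near a compact set. -/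
theorem exists_uniform_hasLocalFlow (h : IsWeaklyConicalEnd g r RS Λ) {K : Set M}
    (hK : IsCompact K) : ∃ ε > 0, ∀ q ∈ K, HasLocalFlow g r Λ ε q := by
  refine hK.induction_on (p := fun S => ∃ ε > 0, ∀ q ∈ S, HasLocalFlow g r Λ ε q)
    ⟨1, one_pos, by simp⟩ ?_ ?_ ?_
  · rintro s t hst ⟨ε, hε, H⟩
    exact ⟨ε, hε, fun q hq => H q (hst hq)⟩
  · rintro s t ⟨ε, hε, H⟩ ⟨ε', hε', H'⟩
    refine ⟨min ε ε', lt_min hε hε', fun q hq => ?_⟩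
    rcases hq with hq | hq
    · exact (H q hq).mono (min_le_left _ _)
    · exact (H' q hq).mono (min_le_right _ _)
  · intro p _
    obtain ⟨ε, hε, H⟩ := exists_hasLocalFlow h p
    exact ⟨_, mem_nhdsWithin_of_mem_nhds H, ε, hε, fun q hq => hq⟩

theorem isCompact_shell (h : IsWeaklyConicalEnd g r RS Λ) (p : M) (b : ℝ) :
    IsCompact (r ⁻¹' Icc (r p) b) :=
  h.proper _ (fun _ hx => (h.lt_r p).trans_le hx.1) isCompact_Icc

variable [T2Space M]

theorem eqOn_curve (h : IsWeaklyConicalEnd g r RS Λ) {γ γ' : ℝ → M} {a b t₀ : ℝ}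
    (ht₀ : t₀ ∈ Ioo a b) (hγ : IsMIntegralCurveOn γ (radialField g r) (Ioo a b))
    (hγ' : IsMIntegralCurveOn γ' (radialField g r) (Ioo a b)) (h0 : γ t₀ = γ' t₀) :
    EqOn γ γ' (Ioo a b) :=
  isMIntegralCurveOn_Ioo_eqOn_of_contMDiff_boundaryless ht₀ (contMDiff_radialField h) hγ hγ' h0

/-- Integral curves of the radial field exist for all positive times: `r` grows exactly
exponentially along them, so that they stay in a compact shell `{r(p) ≤ r ≤ e^T r(p)}` up to time
`T`, where the local flows exist for a uniform time. -/
theorem exists_curve (h : IsWeaklyConicalEnd g r RS Λ) (p : M) :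
    ∃ δ > 0, ∃ γ : ℝ → M, γ 0 = p ∧ IsMIntegralCurveOn γ (radialField g r) (Ioi (-δ)) := by
  obtain ⟨δ, hδ, hp⟩ := exists_hasLocalFlow h p
  obtain ⟨c, hc⟩ := hp.self_of_nhds
  obtain ⟨hc0, hcint, -⟩ := hc.self_of_nhds
  have hfin : ∀ T : ℝ, 0 < T → ∃ γ : ℝ → M, γ 0 = p ∧
      IsMIntegralCurveOn γ (radialField g r) (Ioo (-δ) T) := by
    intro T hT
    obtain ⟨ε', hε', H⟩ := exists_uniform_hasLocalFlow h
      (isCompact_shell h p (Real.exp T * r p))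
    set ε := min ε' δ with hεdef
    have hε : 0 < ε := lt_min hε' hδ
    -- extension by steps of length `ε / 2`, gluing at a point `t₀` of the common domain
    have hstep : ∀ k : ℕ, k * (ε / 2) ≤ T → ∃ γ : ℝ → M, γ 0 = p ∧
        IsMIntegralCurveOn γ (radialField g r) (Ioo (-δ) ((k + 1) * (ε / 2))) := by
      intro k
      induction k with
      | zero =>
        intro _
        refine ⟨c p, hc0, hcint.mono (Ioo_subset_Ioo le_rfl ?_)⟩
        have := min_le_right ε' δ
        norm_num
        linarith
      | succ k ih =>
        intro hk
        push_cast at hk ⊢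
        obtain ⟨γ, hγ0, hγ⟩ := ih (by nlinarith)
        set t₀ : ℝ := (k + 1 / 2) * (ε / 2) with ht₀def
        have hkpos : (0 : ℝ) ≤ k := Nat.cast_nonneg k
        have ht₀0 : 0 < t₀ := by positivity
        have ht₀ : t₀ ∈ Ioo (-δ) ((k + 1) * (ε / 2)) :=
          ⟨by linarith, by rw [ht₀def]; nlinarith⟩
        have hr₀ : r (γ t₀) = Real.exp t₀ * r p := by
          rw [r_curve h hγ ⟨by linarith, by positivity⟩ ht₀, hγ0]
        have hmem : γ t₀ ∈ r ⁻¹' Icc (r p) (Real.exp T * r p) := by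
          have hrp := h.r_pos p
          rw [mem_preimage, hr₀]
          constructor
          · have := Real.one_le_exp ht₀0.le
            nlinarith
          · have : Real.exp t₀ ≤ Real.exp T := Real.exp_le_exp.2 (by rw [ht₀def]; nlinarith)
            nlinarith
        obtain ⟨c', hc'⟩ := H _ hmem
        obtain ⟨h1, h2, -⟩ := hc'.self_of_nhds
        have h3 : IsMIntegralCurveOn (c' (γ t₀) ∘ (· - t₀)) (radialField g r)
            (Ioo (t₀ - ε) (t₀ + ε)) := by
          have := (isMIntegralCurveOn_comp_sub (dt := t₀)).2 h2
          refine this.mono fun s hs => ?_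
          have := min_le_left ε' δ
          change s - t₀ ∈ Ioo (-ε') ε'
          constructor <;> linarith [hs.1, hs.2]
        refine ⟨_, ?_, (isMIntegralCurveOn_piecewise (contMDiff_radialField h) hγ h3 (t₀ := t₀)
          ⟨ht₀, by constructor <;> linarith⟩ (by simp [h1])).mono ?_⟩
        · have h0 : (0 : ℝ) ∈ Ioo (-δ) ((k + 1) * (ε / 2)) := ⟨by linarith, by positivity⟩
          rw [piecewise_eq_of_mem _ _ _ h0, hγ0]
        · intro s hs
          by_cases hs' : s < (k + 1) * (ε / 2)
          · exact Or.inl ⟨hs.1, hs'⟩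
          · refine Or.inr ⟨?_, ?_⟩
            · rw [ht₀def]; nlinarith [not_lt.1 hs']
            · have := hs.2
              rw [ht₀def]; nlinarith
    obtain ⟨γ, h0, hγ⟩ := hstep ⌊T / (ε / 2)⌋₊ (by
      have := Nat.floor_le (a := T / (ε / 2)) (by positivity)
      rwa [le_div_iff₀ (by positivity)] at this)
    refine ⟨γ, h0, hγ.mono (Ioo_subset_Ioo le_rfl ?_)⟩
    have := (Nat.lt_floor_add_one (T / (ε / 2))).le
    rwa [div_le_iff₀ (by positivity)] at this
  have : Nonempty M := ⟨p⟩
  choose! γ hγ0 hγ using hfin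
  -- by uniqueness the curves on the intervals `(-δ, T)` fit together
  refine ⟨δ, hδ, fun t => γ (|t| + 1) t, by simpa using hγ0 1 one_pos, fun t ht => ?_⟩
  have hT : 0 < |t| + 2 := by positivity
  have hmem : t ∈ Ioo (-δ) (|t| + 1) := ⟨ht, by linarith [le_abs_self t]⟩
  have heq : EqOn (fun s => γ (|s| + 1) s) (γ (|t| + 2)) (Ioo (-δ) (|t| + 1)) := by
    intro s hs
    have hs1 : 0 < |s| + 1 := by positivity
    have := eqOn_curve h (t₀ := 0) (a := -δ) (b := min (|s| + 1) (|t| + 2))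
      ⟨by linarith, lt_min hs1 hT⟩
      ((hγ _ hs1).mono (Ioo_subset_Ioo le_rfl (min_le_left _ _)))
      ((hγ _ hT).mono (Ioo_subset_Ioo le_rfl (min_le_right _ _))) (by rw [hγ0 _ hs1, hγ0 _ hT])
    exact this ⟨hs.1, lt_min (by linarith [le_abs_self s]) (by linarith [hs.2])⟩
  have h1 := (hγ _ hT t ⟨ht, by linarith [le_abs_self t]⟩).hasMFDerivAt
    (Ioo_mem_nhds ht (by linarith [le_abs_self t]))
  refine HasMFDerivAt.hasMFDerivWithinAt ?_
  have h2 := h1.congr_of_eventuallyEq (f₁ := fun s => γ (|s| + 1) s)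
    (by filter_upwards [Ioo_mem_nhds hmem.1 hmem.2] with s hs using heq hs)
  have h3 := heq hmem
  simp only at h3 ⊢
  rw [h3]
  exact h2

/-- The forward flow of the radial field follows its integral curves, which moreover extend to a
short interval of negative times. -/
theorem forwardFlow_spec (h : IsWeaklyConicalEnd g r RS Λ) (p : M) :
    ∃ δ > 0, ∃ γ : ℝ → M, γ 0 = p ∧ IsMIntegralCurveOn γ (radialField g r) (Ioi (-δ)) ∧
      ∀ t, 0 ≤ t → forwardFlow (radialField g r) t p = γ t := by
  obtain ⟨δ, hδ, γ, hγ0, hγ⟩ := exists_curve h p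
  refine ⟨δ, hδ, γ, hγ0, hγ, fun t ht => ?_⟩
  have hex : ∃ γ : ℝ → M, γ 0 = p ∧ IsMIntegralCurveOn γ (radialField g r) (Ici 0) :=
    ⟨γ, hγ0, hγ.mono fun s (hs : 0 ≤ s) => by simp only [mem_Ioi]; linarith⟩
  rw [forwardFlow, dif_pos hex]
  obtain ⟨hc0, hc⟩ := hex.choose_spec
  set c := hex.choose
  -- extend `c` to negative times by `γ`, so that uniqueness on open intervals applies
  set c' : ℝ → M := fun s => if s < 0 then γ s else c s with hc'
  have hc'1 : ∀ s, 0 ≤ s → c' s = c s := fun s hs => if_neg (not_lt.2 hs)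
  have hc'2 : ∀ s, s ≤ 0 → c' s = γ s := fun s hs => by
    rcases hs.lt_or_eq with hs | rfl
    · exact if_pos hs
    · rw [hc'1 0 le_rfl, hc0, hγ0]
  have hint : IsMIntegralCurveOn c' (radialField g r) (Ioo (-δ) (t + 1)) := by
    intro s hs
    refine HasMFDerivAt.hasMFDerivWithinAt ?_
    rcases lt_trichotomy s 0 with hs0 | rfl | hs0
    · have := (hγ s hs.1).hasMFDerivAt (Ioi_mem_nhds hs.1)
      rw [hc'2 s hs0.le]
      exact this.congr_of_eventuallyEq
        (by filter_upwards [Iio_mem_nhds hs0] with u hu using hc'2 u (le_of_lt hu))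
    · have h1 : HasMFDerivWithinAt 𝓘(ℝ, ℝ) (𝓡 n) c' (Iic 0) 0
          ((1 : ℝ →L[ℝ] ℝ).smulRight (radialField g r p)) := by
        have := ((hγ 0 hs.1).hasMFDerivAt (Ioi_mem_nhds hs.1)).hasMFDerivWithinAt (s := Iic 0)
        rw [hγ0] at this
        refine this.congr_of_eventuallyEq (by
          filter_upwards [self_mem_nhdsWithin] with u hu using hc'2 u hu) (hc'2 0 le_rfl)
      have h2 : HasMFDerivWithinAt 𝓘(ℝ, ℝ) (𝓡 n) c' (Ici 0) 0
          ((1 : ℝ →L[ℝ] ℝ).smulRight (radialField g r p)) := by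
        have := hc 0 self_mem_Ici
        rw [hc0] at this
        refine this.congr_of_eventuallyEq (by
          filter_upwards [self_mem_nhdsWithin] with u hu using hc'1 u hu) (hc'1 0 le_rfl)
      have h3 := h1.union h2
      rw [Iic_union_Ici] at h3
      rw [hc'1 0 le_rfl, hc0]
      exact h3.hasMFDerivAt univ_mem
    · have := (hc s hs0.le).hasMFDerivAt (Ici_mem_nhds hs0)
      rw [hc'1 s hs0.le]
      exact this.congr_of_eventuallyEq
        (by filter_upwards [Ioi_mem_nhds hs0] with u hu using hc'1 u (le_of_lt hu))
  rw [← hc'1 t ht]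
  exact eqOn_curve h (t₀ := 0) ⟨by linarith, by linarith⟩ hint
    (hγ.mono fun s hs => hs.1) (by rw [hc'1 0 le_rfl, hc0, hγ0]) ⟨by linarith, by linarith⟩

theorem forwardFlow_eq_of_curve (h : IsWeaklyConicalEnd g r RS Λ) {c : ℝ → M} {a b t : ℝ}
    (ha : a < 0) (hc : IsMIntegralCurveOn c (radialField g r) (Ioo a b)) (ht : t ∈ Ico 0 b) :
    forwardFlow (radialField g r) t (c 0) = c t := by
  obtain ⟨δ, hδ, γ, hγ0, hγ, hF⟩ := forwardFlow_spec h (c 0)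
  rw [hF t ht.1]
  have hb : 0 < b := ht.1.trans_lt ht.2
  have hm : max (-δ) a < 0 := max_lt (by linarith) ha
  exact eqOn_curve h (t₀ := 0) (a := max (-δ) a) (b := b) ⟨hm, hb⟩
    (hγ.mono fun s hs => (le_max_left _ _).trans_lt hs.1)
    (hc.mono (Ioo_subset_Ioo (le_max_right _ _) le_rfl)) hγ0 ⟨hm.trans_le ht.1, ht.2⟩

theorem forwardFlow_zero (h : IsWeaklyConicalEnd g r RS Λ) (p : M) :
    forwardFlow (radialField g r) 0 p = p := by
  obtain ⟨δ, hδ, γ, hγ0, hγ, hF⟩ := forwardFlow_spec h p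
  rw [hF 0 le_rfl, hγ0]

theorem forwardFlow_add (h : IsWeaklyConicalEnd g r RS Λ) {s t : ℝ} (hs : 0 ≤ s) (ht : 0 ≤ t)
    (p : M) : forwardFlow (radialField g r) (s + t) p =
      forwardFlow (radialField g r) t (forwardFlow (radialField g r) s p) := by
  obtain ⟨δ, hδ, γ, hγ0, hγ, hF⟩ := forwardFlow_spec h p
  rw [hF _ (add_nonneg hs ht), hF s hs]
  have h1 : IsMIntegralCurveOn (γ ∘ (· + s)) (radialField g r) (Ioo (-δ) (t + 1)) :=
    (hγ.comp_add s).mono fun u hu => by simp; linarith [hu.1]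
  have h2 := forwardFlow_eq_of_curve h (by linarith) h1 ⟨ht, by linarith⟩
  simp only [Function.comp, zero_add] at h2
  rw [h2, add_comm]

theorem r_forwardFlow (h : IsWeaklyConicalEnd g r RS Λ) {t : ℝ} (ht : 0 ≤ t) (p : M) :
    r (forwardFlow (radialField g r) t p) = Real.exp t * r p := by
  obtain ⟨δ, hδ, γ, hγ0, hγ, hF⟩ := forwardFlow_spec h p
  rw [hF t ht, r_curve h (hγ.mono (s' := Ioo (-δ) (t + 1)) fun u hu => hu.1)
    ⟨by linarith, by linarith⟩ ⟨by linarith, by linarith⟩, hγ0]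

theorem forwardFlow_injective (h : IsWeaklyConicalEnd g r RS Λ) {t : ℝ} (ht : 0 ≤ t) :
    Function.Injective (forwardFlow (radialField g r) t) := by
  intro p q hpq
  obtain ⟨δ, hδ, γ, hγ0, hγ, hF⟩ := forwardFlow_spec h p
  obtain ⟨δ', hδ', γ', hγ0', hγ', hF'⟩ := forwardFlow_spec h q
  rw [hF t ht, hF' t ht] at hpq
  have hm : max (-δ) (-δ') < 0 := max_lt (by linarith) (by linarith)
  have := eqOn_curve h (t₀ := t) (a := max (-δ) (-δ')) (b := t + 1) ⟨by linarith, by linarith⟩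
    (hγ.mono fun s hs => (le_max_left _ _).trans_lt hs.1)
    (hγ'.mono fun s hs => (le_max_right _ _).trans_lt hs.1) hpq
  rw [← hγ0, ← hγ0']
  exact this ⟨hm, by linarith⟩

theorem hasDerivWithinAt_comp_forwardFlow (h : IsWeaklyConicalEnd g r RS Λ) {G : M → ℝ}
    (hG : MDifferentiable (𝓡 n) 𝓘(ℝ, ℝ) G) {t : ℝ} (ht : 0 ≤ t) (p : M) :
    HasDerivWithinAt (fun t => G (forwardFlow (radialField g r) t p))
      (differential G (forwardFlow (radialField g r) t p)
        (radialField g r (forwardFlow (radialField g r) t p))) (Ici 0) t := by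
  obtain ⟨δ, hδ, γ, hγ0, hγ, hF⟩ := forwardFlow_spec h p
  rw [hF t ht]
  have := hasDerivWithinAt_comp_curve (hγ.mono (s' := Ici 0) fun s (hs : 0 ≤ s) => by
    simp only [mem_Ioi]; linarith) ht hG
  exact this.congr_of_eventuallyEq
    (by filter_upwards [self_mem_nhdsWithin] with s hs using congrArg G (hF s hs))
    (congrArg G (hF t ht))

theorem continuousOn_forwardFlow (h : IsWeaklyConicalEnd g r RS Λ) (p : M) :
    ContinuousOn (fun t => forwardFlow (radialField g r) t p) (Ici 0) := by
  obtain ⟨δ, hδ, γ, hγ0, hγ, hF⟩ := forwardFlow_spec h p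
  refine (hγ.continuousOn.mono fun s (hs : 0 ≤ s) => ?_).congr fun s hs => hF s hs
  simp only [mem_Ioi]; linarith

/-- The flow of the radial field is `C¹`, and dilates the metric by `e^{2t}` up to the factors
`exp(± 36 Λ (r(p)⁻² - e^{-2t} r(p)⁻²))`. -/
theorem flowBounds_forwardFlow (h : IsWeaklyConicalEnd g r RS Λ) {t : ℝ} (ht : 0 ≤ t) (p : M) :
    FlowBounds g r Λ t (forwardFlow (radialField g r) t) p := by
  obtain ⟨ε, hε, H⟩ := exists_uniform_hasLocalFlow h (isCompact_shell h p (Real.exp t * r p))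
  have hloc : ∀ q, r q ∈ Icc (r p) (Real.exp t * r p) → ∀ s ∈ Ico 0 ε,
      FlowBounds g r Λ s (forwardFlow (radialField g r) s) q := by
    intro q hq s hs
    obtain ⟨c, hc⟩ := H q hq
    obtain ⟨-, -, h3⟩ := hc.self_of_nhds
    refine (h3 s hs).congr ?_
    filter_upwards [hc] with y hy
    have := forwardFlow_eq_of_curve h (by linarith) hy.2.1 hs
    rwa [hy.1] at this
  -- the flow up to time `t` is a composition of `N` flows up to times shorter than `ε`
  obtain ⟨N, hN⟩ := exists_nat_gt (t / ε)
  have hN0 : (0 : ℝ) < N := (by positivity : 0 ≤ t / ε).trans_lt hN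
  set s := t / N with hsdef
  have hs : s ∈ Ico 0 ε := by
    refine ⟨by positivity, ?_⟩
    rw [hsdef, div_lt_iff₀ hN0]
    rw [div_lt_iff₀ hε] at hN
    linarith
  have hk : ∀ k : ℕ, k ≤ N →
      FlowBounds g r Λ (k * s) (forwardFlow (radialField g r) (k * s)) p := by
    intro k
    induction k with
    | zero =>
      intro _
      have := FlowBounds.id (g := g) (r := r) (Λ := Λ) p
      simp only [Nat.cast_zero, zero_mul]
      exact this.congr (Eventually.of_forall fun q => forwardFlow_zero h q)
    | succ k ih =>
      intro hkN
      have h1 := ih (by omega)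
      have hks : 0 ≤ k * s := mul_nonneg (Nat.cast_nonneg k) hs.1
      have h2 : FlowBounds g r Λ s (forwardFlow (radialField g r) s)
          (forwardFlow (radialField g r) (k * s) p) := by
        refine hloc _ ?_ s hs
        rw [r_forwardFlow h hks]
        have hrp := h.r_pos p
        have h3 := Real.one_le_exp hks
        have h4 : Real.exp (k * s) ≤ Real.exp t := by
          refine Real.exp_le_exp.2 ?_
          have : (k : ℝ) ≤ N := by exact_mod_cast (by omega : k ≤ N)
          calc (k : ℝ) * s ≤ N * s := mul_le_mul_of_nonneg_right this hs.1
            _ = t := by rw [hsdef]; field_simp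
        constructor <;> nlinarith
      have h3 := h1.comp h2
      have h4 : ((k + 1 : ℕ) : ℝ) * s = k * s + s := by push_cast; ring
      rw [h4]
      exact h3.congr (Eventually.of_forall fun q => forwardFlow_add h hks hs.1 q)
  have := hk N le_rfl
  have h5 : (N : ℝ) * s = t := by rw [hsdef]; field_simp
  rwa [h5] at this

end GlobalFlow

/-! ### The asymptotic cone metric -/

section Cone

variable {n : ℕ} {M : Type*} [TopologicalSpace M] [ChartedSpace (EuclideanSpace ℝ (Fin n)) M]

theorem polarization {β : FormField n M} {p : M} (hβ : IsBilinearAt β p)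
    (hs : ∀ v w, β p v w = β p w v) (v w : TangentSpace (𝓡 n) p) :
    β p v w = (β p (v + w) (v + w) - β p (v - w) (v - w)) / 4 := by
  obtain ⟨L, hL⟩ := hβ
  simp only [hL] at hs ⊢
  simp only [map_add, map_sub, LinearMap.add_apply, LinearMap.sub_apply, hs w v]
  ring

variable [IsManifold (𝓡 n) ∞ M] {g : C1Metric n M} {r : M → ℝ} {RS Λ : ℝ}

theorem dilation_exp (g : C1Metric n M) (r : M → ℝ) (t : ℝ) :
    dilation g r (Real.exp t) = forwardFlow (radialField g r) t := by
  rw [dilation, Real.log_exp]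

theorem rescaledPullback_exp (t : ℝ) (p : M) (v w : TangentSpace (𝓡 n) p) :
    rescaledPullback g r (Real.exp t) p v w = Real.exp (-(2 * t)) *
      g.inner (forwardFlow (radialField g r) t p)
        (mfderiv (𝓡 n) (𝓡 n) (forwardFlow (radialField g r) t) p v)
        (mfderiv (𝓡 n) (𝓡 n) (forwardFlow (radialField g r) t) p w) := by
  rw [rescaledPullback, dilation_exp]
  congr 1
  rw [← Real.exp_nat_mul, ← Real.exp_neg]
  simp

theorem isBilinearAt_rescaledPullback (τ : ℝ) (p : M) :
    IsBilinearAt (rescaledPullback g r τ) p :=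
  ⟨LinearMap.mk₂ ℝ (rescaledPullback g r τ p)
    (fun v v' w => by simp only [rescaledPullback, map_add, add_apply]; ring)
    (fun c v w => by simp only [rescaledPullback, map_smul, smul_apply, smul_eq_mul]; ring)
    (fun v w w' => by simp only [rescaledPullback, map_add]; ring)
    (fun c v w => by simp only [rescaledPullback, map_smul, smul_eq_mul]; ring),
    fun _ _ => rfl⟩

theorem rescaledPullback_symm (τ : ℝ) (p : M) (v w : TangentSpace (𝓡 n) p) :
    rescaledPullback g r τ p v w = rescaledPullback g r τ p w v := by
  rw [rescaledPullback, rescaledPullback, g.symm]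

namespace IsWeaklyConicalEnd

theorem exponent_nonneg (h : IsWeaklyConicalEnd g r RS Λ) (p : M) : 0 ≤ 36 * Λ / r p ^ 2 := by
  have := h.nonneg
  positivity

theorem exponent_le (h : IsWeaklyConicalEnd g r RS Λ) (p : M) : 36 * Λ / r p ^ 2 ≤ 18 := by
  have := h.quadratic_le p
  rw [mul_div_assoc]
  linarith

end IsWeaklyConicalEnd

variable [T2Space M]

theorem rescaledPullback_bounds (h : IsWeaklyConicalEnd g r RS Λ) {t : ℝ} (ht : 0 ≤ t) (p : M)
    (v : TangentSpace (𝓡 n) p) :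
    rescaledPullback g r (Real.exp t) p v v ≤ Real.exp (36 * Λ / r p ^ 2) * g.inner p v v ∧
      Real.exp (-(36 * Λ / r p ^ 2)) * g.inner p v v ≤
        rescaledPullback g r (Real.exp t) p v v := by
  obtain ⟨h1, h2⟩ := (flowBounds_forwardFlow h ht p).2 v
  rw [← rescaledPullback_exp t p v v] at h1 h2
  have h3 : 0 ≤ rescaledPullback g r (Real.exp t) p v v := by
    rw [rescaledPullback_exp]
    exact mul_nonneg (Real.exp_pos _).le (inner_self_nonneg g _ _)
  have h4 : 1 ≤ Real.exp (36 * Λ / r (forwardFlow (radialField g r) t p) ^ 2) :=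
    Real.one_le_exp (h.exponent_nonneg _)
  have h5 : Real.exp (-(36 * Λ / r (forwardFlow (radialField g r) t p) ^ 2)) ≤ 1 := by
    rw [Real.exp_le_one_iff]
    linarith [h.exponent_nonneg (forwardFlow (radialField g r) t p)]
  constructor <;> nlinarith

/-- The rate at which the rescaled pull-backs `e^{-2t} Π^* g` converge, relative to `g`. At the time
`t` the exponent `36 Λ / r²` of the distortion of `g` by the flow is at most `18 e^{-2t}`. -/
def coneRate (t : ℝ) : ℝ := (Real.exp (18 * Real.exp (-(2 * t))) - 1) * Real.exp 18

theorem tendsto_coneRate : Tendsto coneRate atTop (𝓝 0) := by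
  have h1 : Tendsto (fun t : ℝ => Real.exp (-(2 * t))) atTop (𝓝 0) :=
    Real.tendsto_exp_neg_atTop_nhds_zero.comp (tendsto_id.const_mul_atTop two_pos)
  have h2 := (((Real.continuous_exp.tendsto _).comp (h1.const_mul 18)).sub_const 1).mul_const
    (Real.exp 18)
  change Tendsto (fun t => (Real.exp (18 * Real.exp (-(2 * t))) - 1) * Real.exp 18) atTop (𝓝 0)
  simpa [Function.comp_def] using h2

/-- The rescaled pull-backs form a Cauchy family, by the bounds of `rescaledPullback_bounds` for the
flow from time `s` to time `t`, which starts where `r` is at least `e^s`. -/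
theorem abs_rescaledPullback_sub_le (h : IsWeaklyConicalEnd g r RS Λ) {s t : ℝ} (hs : 0 ≤ s)
    (hst : s ≤ t) (p : M) (v : TangentSpace (𝓡 n) p) :
    |rescaledPullback g r (Real.exp t) p v v - rescaledPullback g r (Real.exp s) p v v| ≤
      coneRate s * g.inner p v v := by
  set F := forwardFlow (radialField g r) with hF
  have hts : 0 ≤ t - s := sub_nonneg.2 hst
  set w := mfderiv (𝓡 n) (𝓡 n) (F s) p v with hw
  have hcomp : F t = F (t - s) ∘ F s := by
    ext q
    have := forwardFlow_add h hs hts q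
    rw [add_sub_cancel] at this
    exact this
  have hd : rescaledPullback g r (Real.exp t) p v v =
      Real.exp (-(2 * s)) * rescaledPullback g r (Real.exp (t - s)) (F s p) w w := by
    rw [rescaledPullback_exp, rescaledPullback_exp, ← mul_assoc, ← Real.exp_add]
    have h1 : -(2 * s) + -(2 * (t - s)) = -(2 * t) := by ring
    rw [h1, ← hF, hcomp]
    have h2 : mfderiv (𝓡 n) (𝓡 n) (F (t - s) ∘ F s) p v =
        mfderiv (𝓡 n) (𝓡 n) (F (t - s)) (F s p) w :=
      congrArg (fun L => L v) (mfderiv_comp p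
        ((flowBounds_forwardFlow h hts _).1.mdifferentiableAt (by simp))
        ((flowBounds_forwardFlow h hs p).1.mdifferentiableAt (by simp)))
    rw [h2]
    rfl
  have hs' : rescaledPullback g r (Real.exp s) p v v =
      Real.exp (-(2 * s)) * g.inner (F s p) w w := rescaledPullback_exp s p v v
  obtain ⟨h1, h2⟩ := rescaledPullback_bounds h hts (F s p) w
  obtain ⟨h3, -⟩ := rescaledPullback_bounds h hs p v
  have hg := inner_self_nonneg g p v
  have hgw := inner_self_nonneg g (F s p) w
  have hexp18 : Real.exp (36 * Λ / r p ^ 2) ≤ Real.exp 18 := Real.exp_le_exp.2 (h.exponent_le p)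
  have hx : 36 * Λ / r (F s p) ^ 2 ≤ 18 * Real.exp (-(2 * s)) := by
    have h5 : r (F s p) = Real.exp s * r p := r_forwardFlow h hs p
    have h6 : 36 * Λ / r (F s p) ^ 2 = 36 * Λ / r p ^ 2 * Real.exp (-(2 * s)) := by
      have h7 : Real.exp s ^ 2 * Real.exp (-(2 * s)) = 1 := by
        rw [← Real.exp_nat_mul, ← Real.exp_add]; simp
      have h8 := h.r_pos p
      have h9 := (Real.exp_pos s).ne'
      rw [h5]
      field_simp
      linear_combination (-Λ) * h7
    rw [h6]
    exact mul_le_mul_of_nonneg_right (h.exponent_le p) (Real.exp_pos _).le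
  set x := 36 * Λ / r (F s p) ^ 2
  set y := 18 * Real.exp (-(2 * s))
  have hxy : Real.exp x ≤ Real.exp y := Real.exp_le_exp.2 hx
  have hxx : 1 - Real.exp (-x) ≤ Real.exp x - 1 := by
    have h5 : Real.exp (-x) * Real.exp x = 1 := by rw [← Real.exp_add]; simp
    nlinarith [Real.exp_pos x, Real.exp_pos (-x), sq_nonneg (Real.exp x - 1)]
  have hbd : |rescaledPullback g r (Real.exp (t - s)) (F s p) w w - g.inner (F s p) w w| ≤
      (Real.exp y - 1) * g.inner (F s p) w w := by
    rw [abs_le]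
    constructor <;> nlinarith
  have hy1 : 0 ≤ Real.exp y - 1 := by
    have : 0 ≤ y := by positivity
    linarith [Real.one_le_exp this]
  rw [hd, hs', ← mul_sub, abs_mul, abs_of_pos (Real.exp_pos _)]
  rw [hs'] at h3
  calc Real.exp (-(2 * s)) * |rescaledPullback g r (Real.exp (t - s)) (F s p) w w
        - g.inner (F s p) w w| ≤ Real.exp (-(2 * s)) * ((Real.exp y - 1) * g.inner (F s p) w w) :=
        mul_le_mul_of_nonneg_left hbd (Real.exp_pos _).le
    _ = (Real.exp y - 1) * (Real.exp (-(2 * s)) * g.inner (F s p) w w) := by ring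
    _ ≤ (Real.exp y - 1) * (Real.exp 18 * g.inner p v v) := by
      refine mul_le_mul_of_nonneg_left (h3.trans ?_) hy1
      exact mul_le_mul_of_nonneg_right hexp18 hg
    _ = coneRate s * g.inner p v v := by rw [coneRate]; ring

theorem abs_rescaledPullback_sub_le' (h : IsWeaklyConicalEnd g r RS Λ) {s t : ℝ} (hs : 0 ≤ s)
    (hst : s ≤ t) (p : M) (v w : TangentSpace (𝓡 n) p) :
    |rescaledPullback g r (Real.exp t) p v w - rescaledPullback g r (Real.exp s) p v w| ≤
      coneRate s * ((g.inner p v v + g.inner p w w) / 2) := by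
  have h1 := abs_le.1 (abs_rescaledPullback_sub_le h hs hst p (v + w))
  have h2 := abs_le.1 (abs_rescaledPullback_sub_le h hs hst p (v - w))
  rw [polarization (isBilinearAt_rescaledPullback _ p) (rescaledPullback_symm _ p) v w,
    polarization (isBilinearAt_rescaledPullback (Real.exp s) p) (rescaledPullback_symm _ p) v w]
  have h3 : g.inner p (v + w) (v + w) + g.inner p (v - w) (v - w) =
      2 * (g.inner p v v + g.inner p w w) := by
    simp only [map_add, map_sub, add_apply, sub_apply]
    ring
  have h4 := congrArg (coneRate s * ·) h3
  simp only [mul_add] at h4 ⊢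
  rw [abs_le]
  constructor <;> linarith

/-- The form field of the asymptotic cone metric: the pointwise limit of the rescaled pull-backs of
`g`. -/
def coneForm (g : C1Metric n M) (r : M → ℝ) : FormField n M :=
  fun p v w => limUnder atTop fun t : ℝ => rescaledPullback g r (Real.exp t) p v w

theorem tendsto_coneForm (h : IsWeaklyConicalEnd g r RS Λ) (p : M) (v w : TangentSpace (𝓡 n) p) :
    Tendsto (fun t : ℝ => rescaledPullback g r (Real.exp t) p v w) atTop
      (𝓝 (coneForm g r p v w)) := by
  refine CauchySeq.tendsto_limUnder ?_
  have h0 := tendsto_coneRate.mul_const ((g.inner p v v + g.inner p w w) / 2)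
  rw [zero_mul] at h0
  refine Metric.cauchySeq_iff'.2 fun ε hε => ?_
  obtain ⟨N, hN⟩ := ((h0.eventually (gt_mem_nhds hε)).and (eventually_ge_atTop 0)).exists
  exact ⟨N, fun t ht => by
    rw [Real.dist_eq]
    exact (abs_rescaledPullback_sub_le' h hN.2 ht p v w).trans_lt hN.1⟩

theorem abs_coneForm_sub_le (h : IsWeaklyConicalEnd g r RS Λ) {s : ℝ} (hs : 0 ≤ s) (p : M)
    (v w : TangentSpace (𝓡 n) p) :
    |coneForm g r p v w - rescaledPullback g r (Real.exp s) p v w| ≤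
      coneRate s * ((g.inner p v v + g.inner p w w) / 2) := by
  refine le_of_tendsto ((tendsto_coneForm h p v w).sub_const _).abs ?_
  filter_upwards [eventually_ge_atTop s] with t ht using abs_rescaledPullback_sub_le' h hs ht p v w

theorem coneForm_bounds (h : IsWeaklyConicalEnd g r RS Λ) (p : M) (v : TangentSpace (𝓡 n) p) :
    coneForm g r p v v ≤ Real.exp 18 * g.inner p v v ∧
      Real.exp (-18) * g.inner p v v ≤ coneForm g r p v v := by
  have hg := inner_self_nonneg g p v
  have h1 := h.exponent_le p
  constructor
  · refine le_of_tendsto (tendsto_coneForm h p v v) ?_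
    filter_upwards [eventually_ge_atTop 0] with t ht
    exact (rescaledPullback_bounds h ht p v).1.trans
      (mul_le_mul_of_nonneg_right (Real.exp_le_exp.2 h1) hg)
  · refine ge_of_tendsto (tendsto_coneForm h p v v) ?_
    filter_upwards [eventually_ge_atTop 0] with t ht
    exact (mul_le_mul_of_nonneg_right (Real.exp_le_exp.2 (by linarith)) hg).trans
      (rescaledPullback_bounds h ht p v).2

theorem isBilinearAt_coneForm (h : IsWeaklyConicalEnd g r RS Λ) (p : M) :
    IsBilinearAt (coneForm g r) p := by
  refine ⟨LinearMap.mk₂ ℝ (coneForm g r p) (fun v v' w => ?_) (fun c v w => ?_)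
    (fun v w w' => ?_) (fun c v w => ?_), fun _ _ => rfl⟩
  · refine tendsto_nhds_unique (tendsto_coneForm h p (v + v') w)
      (((tendsto_coneForm h p v w).add (tendsto_coneForm h p v' w)).congr fun t => ?_)
    simp only [rescaledPullback, map_add, add_apply]; ring
  · refine tendsto_nhds_unique (tendsto_coneForm h p (c • v) w)
      (((tendsto_coneForm h p v w).const_mul c).congr fun t => ?_)
    simp only [rescaledPullback, map_smul, smul_apply, smul_eq_mul]; ring
  · refine tendsto_nhds_unique (tendsto_coneForm h p v (w + w'))
      (((tendsto_coneForm h p v w).add (tendsto_coneForm h p v w')).congr fun t => ?_)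
    simp only [rescaledPullback, map_add]; ring
  · refine tendsto_nhds_unique (tendsto_coneForm h p v (c • w))
      (((tendsto_coneForm h p v w).const_mul c).congr fun t => ?_)
    simp only [rescaledPullback, map_smul, smul_eq_mul]; ring

theorem coneForm_symm (h : IsWeaklyConicalEnd g r RS Λ) (p : M) (v w : TangentSpace (𝓡 n) p) :
    coneForm g r p v w = coneForm g r p w v :=
  tendsto_nhds_unique (tendsto_coneForm h p v w)
    ((tendsto_coneForm h p w v).congr fun _ => rescaledPullback_symm _ p w v)

theorem contMDiff_forwardFlow (h : IsWeaklyConicalEnd g r RS Λ) {t : ℝ} (ht : 0 ≤ t) :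
    ContMDiff (𝓡 n) (𝓡 n) 1 (forwardFlow (radialField g r) t) :=
  fun p => (flowBounds_forwardFlow h ht p).1

theorem continuousOn_coordMatrix_rescaledPullback (h : IsWeaklyConicalEnd g r RS Λ) {t : ℝ}
    (ht : 0 ≤ t) {φ : OpenPartialHomeomorph M (EuclideanSpace ℝ (Fin n))}
    (hφ : φ ∈ IsManifold.maximalAtlas (𝓡 n) ∞ M) (i j : Fin n) :
    ContinuousOn (fun x => coordMatrix (rescaledPullback g r (Real.exp t)) φ x i j) φ.target := by
  have hF := contMDiff_forwardFlow h ht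
  have hv := fun i => (hF.continuous_tangentMap le_rfl).comp_continuousOn
    (contMDiffOn_coordVector hφ (k := 0) (V := fun _ => EuclideanSpace.single i 1)
      contDiffOn_const).continuousOn
  have hg := g.contMDiff.continuous.comp_continuousOn
    (hF.continuous.comp_continuousOn φ.symm.continuousOn)
  have := ContinuousOn.clm_bundle_apply₂ (E₃ := Bundle.Trivial M ℝ) hg (hv i) (hv j)
  have h2 : ContinuousOn (fun x => g.inner (forwardFlow (radialField g r) t (φ.symm x))
      (mfderiv (𝓡 n) (𝓡 n) (forwardFlow (radialField g r) t) (φ.symm x)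
        (coordVector φ x (EuclideanSpace.single i 1)))
      (mfderiv (𝓡 n) (𝓡 n) (forwardFlow (radialField g r) t) (φ.symm x)
        (coordVector φ x (EuclideanSpace.single j 1)))) φ.target := by
    intro x hx
    have h2 := this x hx
    simp only [FiberBundle.continuousWithinAt_totalSpace] at h2
    exact h2.2
  refine (h2.const_smul (Real.exp (-(2 * t)))).congr fun x hx => ?_
  exact rescaledPullback_exp _ _ _ _

theorem tendstoLocallyUniformlyOn_coordMatrix (h : IsWeaklyConicalEnd g r RS Λ)
    {φ : OpenPartialHomeomorph M (EuclideanSpace ℝ (Fin n))}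
    (hφ : φ ∈ IsManifold.maximalAtlas (𝓡 n) ∞ M) (i j : Fin n) :
    TendstoLocallyUniformlyOn
      (fun (t : ℝ) x => coordMatrix (rescaledPullback g r (Real.exp t)) φ x i j)
      (fun x => coordMatrix (coneForm g r) φ x i j) atTop φ.target := by
  rw [Metric.tendstoLocallyUniformlyOn_iff]
  intro ε hε x hx
  set C : EuclideanSpace ℝ (Fin n) → ℝ := fun y =>
    (coordMatrix (formC1 g) φ y i i + coordMatrix (formC1 g) φ y j j) / 2 with hC
  have hCc : ContinuousOn C φ.target :=
    (((contDiffOn_coordMatrix g hφ i i).continuousOn).add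
      (contDiffOn_coordMatrix g hφ j j).continuousOn).div_const 2
  have h1 : ∀ᶠ y in 𝓝 x, C y < C x + 1 ∧ y ∈ φ.target :=
    ((hCc.continuousAt (φ.open_target.mem_nhds hx)).eventually_lt_const (lt_add_one _)).and
      (φ.open_target.eventually_mem hx)
  refine ⟨{y | C y < C x + 1 ∧ y ∈ φ.target}, mem_nhdsWithin_of_mem_nhds h1, ?_⟩
  have h2 := (tendsto_coneRate.mul_const (|C x| + 1))
  rw [zero_mul] at h2
  filter_upwards [h2.eventually (gt_mem_nhds hε), eventually_ge_atTop 0] with t ht ht0 y hy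
  rw [Real.dist_eq]
  refine (abs_coneForm_sub_le h ht0 (φ.symm y) _ _).trans_lt (lt_of_le_of_lt ?_ ht)
  have hrate : 0 ≤ coneRate t := by
    have h3 : 0 ≤ 18 * Real.exp (-(2 * t)) := by positivity
    exact mul_nonneg (by linarith [Real.one_le_exp h3]) (Real.exp_pos _).le
  refine mul_le_mul_of_nonneg_left ?_ hrate
  exact (hy.1.le.trans (by linarith [le_abs_self (C x)]))

end Cone

section ConeMetric

theorem exists_clm₂ {E : Type*} [NormedAddCommGroup E] [NormedSpace ℝ E] [FiniteDimensional ℝ E]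
    (L : E →ₗ[ℝ] E →ₗ[ℝ] ℝ) : ∃ b : E →L[ℝ] E →L[ℝ] ℝ, ∀ v w, b v w = L v w :=
  ⟨LinearMap.toContinuousLinearMap
    ((LinearMap.toContinuousLinearMap : (E →ₗ[ℝ] ℝ) ≃ₗ[ℝ] E →L[ℝ] ℝ).toLinearMap ∘ₗ L),
    fun _ _ => rfl⟩

theorem continuousAt_clm₂ {X E : Type*} [TopologicalSpace X] [NormedAddCommGroup E]
    [NormedSpace ℝ E] [FiniteDimensional ℝ E] {f : X → E →L[ℝ] E →L[ℝ] ℝ} {x : X}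
    (h : ∀ v w, ContinuousAt (fun q => f q v w) x) : ContinuousAt f x :=
  continuousAt_clm_apply.2 fun v => continuousAt_clm_apply.2 fun w => h v w

variable {n : ℕ} {M : Type*} [TopologicalSpace M] [ChartedSpace (EuclideanSpace ℝ (Fin n)) M]

theorem IsBilinearAt.exists_clm {β : FormField n M} {p : M} (hβ : IsBilinearAt β p) :
    ∃ b : TangentSpace (𝓡 n) p →L[ℝ] TangentSpace (𝓡 n) p →L[ℝ] ℝ, ∀ v w, b v w = β p v w := by
  obtain ⟨L, hL⟩ := hβ
  obtain ⟨b, hb⟩ := exists_clm₂ (E := EuclideanSpace ℝ (Fin n)) L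
  exact ⟨b, fun v w => (hb v w).trans (hL v w).symm⟩

variable [IsManifold (𝓡 n) ∞ M]

/-- In the preferred trivialization of the tangent bundle, constant vectors correspond to the
coordinate vector fields. -/
theorem symm_trivializationAt {p q : M} (hq : q ∈ (chartAt (EuclideanSpace ℝ (Fin n)) p).source)
    (v : EuclideanSpace ℝ (Fin n)) :
    (trivializationAt (EuclideanSpace ℝ (Fin n)) (TangentSpace (𝓡 n) (M := M)) p).symm q v =
      coordVector (chartAt (EuclideanSpace ℝ (Fin n)) p)
        (chartAt (EuclideanSpace ℝ (Fin n)) p q) v := by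
  have h := congrArg (fun L => L v) (TangentBundle.symmL_trivializationAt (I := 𝓡 n) hq)
  have hqb : q ∈ (trivializationAt (EuclideanSpace ℝ (Fin n)) (TangentSpace (𝓡 n) (M := M))
    p).baseSet := by simpa using hq
  refine (Eq.trans ?_ h).trans ?_
  · exact (Bundle.Trivialization.symmL_apply _ hqb v).symm
  · rw [show range (𝓡 n) = univ from ModelWithCorners.range_eq_univ _, mfderivWithin_univ]
    rfl

/-- A form field that is positive definite, dominates a multiple of a Riemannian metric and is
continuous in every chart is a `C⁰` Riemannian metric. -/
theorem exists_c0Metric (g : C1Metric n M) {β : FormField n M} (hb : ∀ p, IsBilinearAt β p)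
    (hs : ∀ p v w, β p v w = β p w v) {c : ℝ} (hc : 0 < c)
    (hpos : ∀ p v, c ^ 2 * g.inner p v v ≤ β p v v)
    (hcont : ∀ φ ∈ IsManifold.maximalAtlas (𝓡 n) ∞ M, ∀ i j : Fin n,
      ContinuousOn (fun x => coordMatrix β φ x i j) φ.target) :
    ∃ gC : C0Metric n M, formC0 gC = β := by
  choose b hbβ using fun p => (hb p).exists_clm
  refine ⟨⟨b, fun p v w => ?_, fun p v hv => ?_, fun p => ?_, ?_⟩, ?_⟩
  · rw [hbβ, hbβ, hs]
  · rw [hbβ]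
    exact (mul_pos (by positivity) (g.pos p v hv)).trans_le (hpos p v)
  · refine ((g.isVonNBounded p).image
      (c⁻¹ • ContinuousLinearMap.id ℝ (TangentSpace (𝓡 n) p))).subset fun v hv => ?_
    refine ⟨c • v, ?_, ?_⟩
    · have h1 : b p v v < 1 := hv
      rw [hbβ] at h1
      have h2 : g.inner p (c • v) (c • v) = c ^ 2 * g.inner p v v := by
        simp only [map_smul, smul_apply, smul_eq_mul]; ring
      exact (h2.le.trans (hpos p v)).trans_lt h1
    · simp [smul_smul, hc.ne']
  · rw [continuous_iff_continuousAt]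
    intro p
    rw [continuousAt_hom_bundle]
    refine ⟨continuousAt_id, continuousAt_clm₂ fun v w => ?_⟩
    set φ := chartAt (EuclideanSpace ℝ (Fin n)) p with hφ
    have hφm := IsManifold.chart_mem_maximalAtlas (I := 𝓡 n) (n := ∞) p
    have hc1 : ContinuousAt (fun q => coordForm β φ (φ q) v w) p := by
      simp only [coordForm_apply]
      refine tendsto_finsetSum _ fun i _ => tendsto_finsetSum _ fun j _ => ?_
      refine Tendsto.mul_const _ ?_
      exact ContinuousAt.comp (g := fun x => coordMatrix β φ x i j)
        ((hcont φ hφm i j).continuousAt (φ.open_target.mem_nhds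
          (φ.map_source (mem_chart_source _ p)))) (φ.continuousAt (mem_chart_source _ p))
    refine hc1.congr ?_
    filter_upwards [φ.open_source.mem_nhds (mem_chart_source _ p)] with q hq
    have hqb : q ∈ (trivializationAt (EuclideanSpace ℝ (Fin n)) (TangentSpace (𝓡 n) (M := M))
        p).baseSet := by simpa using hq
    rw [coordForm_eq (hb _), inCoordinates_apply_eq₂ hqb hqb (Set.mem_univ _)]
    have key : ∀ q' : M, q' = q → ∀ v w : EuclideanSpace ℝ (Fin n), β q' v w = b q v w := by
      rintro _ rfl v w
      exact (hbβ _ v w).symm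
    have h1 := symm_trivializationAt hq v
    have h2 := symm_trivializationAt hq w
    refine (key _ (φ.left_inv hq) _ _).trans ?_
    have h3 : ∀ a, (trivializationAt ℝ (Bundle.Trivial M ℝ) p).linearMapAt ℝ q a = a :=
      LinearMap.congr_fun (Bundle.Trivial.linearMapAt_trivialization ℝ M ℝ q)
    refine Eq.trans ?_ (h3 _).symm
    exact congrArg₂ (fun v w : EuclideanSpace ℝ (Fin n) => b q v w) h1.symm h2.symm
  · ext p v w
    exact hbβ p v w

variable [T2Space M] {g : C1Metric n M} {r : M → ℝ} {RS Λ : ℝ}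

theorem exists_coneMetric (h : IsWeaklyConicalEnd g r RS Λ) :
    ∃ gC : C0Metric n M, formC0 gC = coneForm g r := by
  refine exists_c0Metric g (isBilinearAt_coneForm h) (coneForm_symm h) (Real.exp_pos (-9))
    (fun p v => ?_) fun φ hφ i j => ?_
  · rw [← Real.exp_nat_mul]
    norm_num
    exact (coneForm_bounds h p v).2
  · refine (tendstoLocallyUniformlyOn_coordMatrix h hφ i j).continuousOn ?_
    refine Eventually.frequently ?_
    filter_upwards [eventually_ge_atTop 0] with t ht
    exact continuousOn_coordMatrix_rescaledPullback h ht hφ i j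

theorem isAsymptoticConeMetric_of_formC0_eq (h : IsWeaklyConicalEnd g r RS Λ) {gC : C0Metric n M}
    (hC : formC0 gC = coneForm g r) : IsAsymptoticConeMetric g r gC := by
  intro φ hφ i j u hu x hx
  rw [hC]
  obtain ⟨t, ht, h1⟩ := tendstoLocallyUniformlyOn_coordMatrix h hφ i j u hu x hx
  refine ⟨t, ht, ?_⟩
  filter_upwards [Real.tendsto_log_atTop.eventually h1, eventually_gt_atTop 0] with τ hτ h0
  rwa [Real.exp_log h0] at hτ

end ConeMetric

/-! ### Determinants and the Riemannian measure in charts -/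

section Det

/-- A symmetric matrix `H ≥ 1` has determinant at least `1`. -/
theorem one_le_det_of_le {n : ℕ} {H : Matrix (Fin n) (Fin n) ℝ} (hH : H.IsHermitian)
    (h : ∀ v, v ⬝ᵥ v ≤ v ⬝ᵥ (H *ᵥ v)) : 1 ≤ H.det := by
  rw [hH.det_eq_prod_eigenvalues]
  refine Finset.one_le_prod (f := fun i => hH.eigenvalues i) fun i _ => ?_
  have h1 := h (hH.eigenvectorBasis i)
  have h2 := hH.eigenvalues_eq i
  have h3 := hH.eigenvectorBasis.orthonormal.1 i
  have h4 : (hH.eigenvectorBasis i : Fin n → ℝ) ⬝ᵥ (hH.eigenvectorBasis i : Fin n → ℝ) = 1 := by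
    have h5 := EuclideanSpace.real_norm_sq_eq (hH.eigenvectorBasis i)
    rw [h3] at h5
    simp only [dotProduct, ← sq]
    linarith
  simp only [star_trivial, RCLike.re_to_real] at h2
  rw [h2]
  linarith

open scoped MatrixOrder Matrix.Norms.L2Operator in
/-- The determinant is monotone on positive definite matrices: if `A = Pᴴ P`, then `B ≥ A` means
that `P⁻ᴴ B P⁻¹ ≥ 1`. -/
theorem det_le_det_of_le {n : ℕ} {A B : Matrix (Fin n) (Fin n) ℝ} (hA : A.PosDef)
    (hB : B.IsHermitian) (h : ∀ v, v ⬝ᵥ (A *ᵥ v) ≤ v ⬝ᵥ (B *ᵥ v)) : A.det ≤ B.det := by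
  obtain ⟨P, hP⟩ : ∃ P : Matrix (Fin n) (Fin n) ℝ, A = Pᴴ * P :=
    CStarAlgebra.nonneg_iff_eq_star_mul_self.mp hA.posSemidef.nonneg
  have hdet : A.det = P.det * P.det := by
    rw [hP, Matrix.det_mul, Matrix.det_conjTranspose]; simp
  have hP0 : IsUnit P.det := by
    rw [isUnit_iff_ne_zero]
    intro h0
    have := hA.det_pos
    simp [hdet, h0] at this
  set H := P⁻¹ᴴ * B * P⁻¹ with hHdef
  have hH : H.IsHermitian := Matrix.isHermitian_conjTranspose_mul_mul _ hB
  have h1 : 1 ≤ H.det := by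
    refine one_le_det_of_le hH fun v => ?_
    have e : ∀ (C : Matrix (Fin n) (Fin n) ℝ), v ⬝ᵥ ((P⁻¹ᴴ * C * P⁻¹) *ᵥ v) =
        (P⁻¹ *ᵥ v) ⬝ᵥ (C *ᵥ (P⁻¹ *ᵥ v)) := by
      intro C
      rw [← Matrix.mulVec_mulVec, ← Matrix.mulVec_mulVec, Matrix.dotProduct_mulVec,
        Matrix.conjTranspose_eq_transpose_of_trivial, Matrix.vecMul_transpose]
    have h2 := h (P⁻¹ *ᵥ v)
    rw [← e, ← e] at h2
    refine le_trans (le_of_eq ?_) h2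
    have : P⁻¹ᴴ * A * P⁻¹ = 1 := by
      rw [hP, Matrix.mul_assoc, Matrix.mul_assoc, Matrix.mul_nonsing_inv _ hP0, Matrix.mul_one,
        ← Matrix.conjTranspose_mul, Matrix.mul_nonsing_inv _ hP0, Matrix.conjTranspose_one]
    rw [this, Matrix.one_mulVec]
  have h2 : P.det * P.det * H.det = B.det := by
    rw [hHdef, Matrix.det_mul, Matrix.det_mul, Matrix.det_conjTranspose]
    have := Matrix.det_nonsing_inv P
    have h3 : P.det * P⁻¹.det = 1 := by
      rw [← Matrix.det_mul, Matrix.mul_nonsing_inv _ hP0, Matrix.det_one]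
    simp only [star_trivial]
    linear_combination (B.det * (P.det * P⁻¹.det + 1)) * h3
  rw [hdet, ← h2]
  exact le_mul_of_one_le_right (mul_self_nonneg _) h1

end Det

section ChartVolume

theorem measurableSet_target_inter {X Y : Type*} [TopologicalSpace X] [TopologicalSpace Y]
    [MeasurableSpace X] [BorelSpace X] [MeasurableSpace Y] [BorelSpace Y]
    (φ : OpenPartialHomeomorph X Y) {A : Set X} (hA : MeasurableSet A) :
    MeasurableSet (φ.target ∩ φ.symm ⁻¹' A) := by
  have h1 : Measurable (φ.target.domRestrict φ.symm) :=
    (continuousOn_iff_continuous_domRestrict.1 φ.symm.continuousOn).measurable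
  have h2 := φ.open_target.measurableSet.subtype_image (h1 hA)
  convert h2 using 1
  ext x
  simp [and_comm]

variable {n : ℕ} {M : Type*} [TopologicalSpace M] [ChartedSpace (EuclideanSpace ℝ (Fin n)) M]

/-- The pull-back of a form field. -/
def pullbackForm (Φ : M → M) (β : FormField n M) : FormField n M :=
  fun p v w => β (Φ p) (mfderiv (𝓡 n) (𝓡 n) Φ p v) (mfderiv (𝓡 n) (𝓡 n) Φ p w)

/-- The density of the Riemannian measure in a chart. -/
def chartDensity (β : FormField n M) (φ : OpenPartialHomeomorph M (EuclideanSpace ℝ (Fin n)))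
    (x : EuclideanSpace ℝ (Fin n)) : ℝ :=
  √(coordMatrix β φ x).det

variable {φ ψ : OpenPartialHomeomorph M (EuclideanSpace ℝ (Fin n))} {β β' : FormField n M}

theorem coordForm_vectorCoord [IsManifold (𝓡 n) ∞ M] (hφ : φ ∈ IsManifold.maximalAtlas (𝓡 n) ∞ M)
    {q : M} (hβ : IsBilinearAt β q) (hq : q ∈ φ.source) (v w : TangentSpace (𝓡 n) q) :
    coordForm β φ (φ q) (vectorCoord φ q v) (vectorCoord φ q w) = β q v w := by
  obtain ⟨x, hx, rfl⟩ : ∃ x ∈ φ.target, φ.symm x = q := ⟨φ q, φ.map_source hq, φ.left_inv hq⟩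
  rw [φ.right_inv hx, coordForm_eq hβ, coordVector_vectorCoord hφ hx, coordVector_vectorCoord hφ hx]

variable [MeasurableSpace M] [BorelSpace M]

theorem chartVolume_apply (β : FormField n M)
    (φ : OpenPartialHomeomorph M (EuclideanSpace ℝ (Fin n))) {A : Set M} (hA : MeasurableSet A) :
    chartVolume β φ A =
      ∫⁻ x in φ.target ∩ φ.symm ⁻¹' A, ENNReal.ofReal (chartDensity β φ x) := by
  have h1 : AEMeasurable φ.symm (volume.restrict φ.target) :=
    φ.symm.continuousOn.aemeasurable φ.open_target.measurableSet
  rw [chartVolume, Measure.map_apply_of_aemeasurable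
    (h1.mono_ac (withDensity_absolutelyContinuous _ _)) hA, withDensity_apply',
    Measure.restrict_restrict' φ.open_target.measurableSet, inter_comm]
  rfl

theorem chartVolume_inter_source (β : FormField n M)
    (φ : OpenPartialHomeomorph M (EuclideanSpace ℝ (Fin n))) {A : Set M} (hA : MeasurableSet A) :
    chartVolume β φ (A ∩ φ.source) = chartVolume β φ A := by
  rw [chartVolume_apply β φ (hA.inter φ.open_source.measurableSet), chartVolume_apply β φ hA]
  congr 2
  ext x
  simp only [mem_inter_iff, mem_preimage]
  exact ⟨fun h => ⟨h.1, h.2.1⟩, fun h => ⟨h.1, h.2, φ.map_target h.1⟩⟩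

variable [IsManifold (𝓡 n) ∞ M]

/-- The change of variables formula for the Riemannian measure, within a pair of charts. -/
theorem chartVolume_image (hβ : ∀ p, IsBilinearAt β p)
    (hφ : φ ∈ IsManifold.maximalAtlas (𝓡 n) ∞ M)
    (hψ : ψ ∈ IsManifold.maximalAtlas (𝓡 n) ∞ M) {Φ : M → M} (hΦ : MDifferentiable (𝓡 n) (𝓡 n) Φ)
    {A : Set M} (hA : MeasurableSet A) (hAφ : A ⊆ φ.source) (hAψ : MapsTo Φ A ψ.source)
    (hinj : InjOn Φ A) :
    MeasurableSet (Φ '' A) ∧ chartVolume β ψ (Φ '' A) = chartVolume (pullbackForm Φ β) φ A := by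
  set S := φ.target ∩ φ.symm ⁻¹' A with hS
  have hSm : MeasurableSet S := measurableSet_target_inter φ hA
  set f : EuclideanSpace ℝ (Fin n) → EuclideanSpace ℝ (Fin n) := ψ ∘ Φ ∘ φ.symm with hf
  have hfd : ∀ x ∈ S, MDifferentiableAt (𝓡 n) (𝓡 n) f x := fun x hx =>
    ((mdifferentiable_chart hψ).mdifferentiableAt (hAψ hx.2)).comp x
      ((hΦ _).comp x ((mdifferentiable_chart hφ).mdifferentiableAt_symm hx.1))
  have hfd' : ∀ x ∈ S, HasFDerivWithinAt f (fderiv ℝ f x) S x := fun x hx =>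
    (mdifferentiableAt_iff_differentiableAt.1 (hfd x hx)).hasFDerivAt.hasFDerivWithinAt
  have hfinj : InjOn f S := by
    intro x hx y hy hxy
    have h1 := hinj hx.2 hy.2 (ψ.injOn (hAψ hx.2) (hAψ hy.2) hxy)
    exact φ.symm.injOn hx.1 hy.1 h1
  have himage : f '' S = ψ.target ∩ ψ.symm ⁻¹' (Φ '' A) := by
    ext y
    constructor
    · rintro ⟨x, hx, rfl⟩
      refine ⟨ψ.map_source (hAψ hx.2), φ.symm x, hx.2, ?_⟩
      exact (ψ.left_inv (hAψ hx.2)).symm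
    · rintro ⟨hy, p, hp, hpy⟩
      refine ⟨φ p, ⟨φ.map_source (hAφ hp), ?_⟩, ?_⟩
      · simpa [φ.left_inv (hAφ hp)] using hp
      · simp only [hf, Function.comp, φ.left_inv (hAφ hp), hpy, ψ.right_inv hy]
  have hmeas : MeasurableSet (Φ '' A) := by
    have h1 := measurableSet_target_inter ψ.symm
      (measurable_image_of_fderivWithin hSm hfd' hfinj)
    rw [himage] at h1
    convert h1 using 1
    ext q
    constructor
    · rintro ⟨p, hp, rfl⟩
      have hq := hAψ hp
      exact ⟨hq, ψ.map_source hq, p, hp, (ψ.left_inv hq).symm⟩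
    · rintro ⟨hq, -, p, hp, hpq⟩
      refine ⟨p, hp, ?_⟩
      rw [hpq]
      exact ψ.left_inv hq
  refine ⟨hmeas, ?_⟩
  rw [chartVolume_apply β ψ hmeas, chartVolume_apply _ φ hA, ← himage,
    lintegral_image_eq_lintegral_abs_det_fderiv_mul volume hSm hfd' hfinj]
  refine setLIntegral_congr_fun hSm fun x hx => ?_
  rw [← ENNReal.ofReal_mul (abs_nonneg _)]
  congr 1
  have hJ : ∀ v, fderiv ℝ f x v = vectorCoord ψ (Φ (φ.symm x))
      (mfderiv (𝓡 n) (𝓡 n) Φ (φ.symm x) (coordVector φ x v)) := by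
    intro v
    have h2 := (mdifferentiable_chart hφ).mdifferentiableAt_symm hx.1
    have h1 := mfderiv_comp x ((mdifferentiable_chart hψ).mdifferentiableAt (hAψ hx.2))
      ((hΦ (φ.symm x)).comp x h2)
    have h3 := mfderiv_comp x (hΦ (φ.symm x)) h2
    rw [h3, mfderiv_eq_fderiv] at h1
    exact congrArg (fun L => L v) h1
  set J : Matrix (Fin n) (Fin n) ℝ := LinearMap.toMatrix
    (EuclideanSpace.basisFun (Fin n) ℝ).toBasis (EuclideanSpace.basisFun (Fin n) ℝ).toBasis
    (fderiv ℝ f x).toLinearMap with hJdef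
  have hJa : ∀ k i, J k i = fderiv ℝ f x (EuclideanSpace.single i 1) k := by
    intro k i
    rw [hJdef, LinearMap.toMatrix_apply]
    simp
  have hdet : (fderiv ℝ f x).det = J.det := by
    rw [hJdef, LinearMap.det_toMatrix]
  have hmat : coordMatrix (pullbackForm Φ β) φ x = Jᵀ * coordMatrix β ψ (f x) * J := by
    ext i j
    have h1 : coordMatrix (pullbackForm Φ β) φ x i j = coordForm β ψ (f x)
        (fderiv ℝ f x (EuclideanSpace.single i 1)) (fderiv ℝ f x (EuclideanSpace.single j 1)) := by
      rw [hJ, hJ]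
      exact (coordForm_vectorCoord hψ (hβ _) (hAψ hx.2) _ _).symm
    rw [h1, coordForm_apply, Matrix.mul_apply]
    simp only [Matrix.mul_apply, Matrix.transpose_apply, hJa, Finset.sum_mul]
    rw [Finset.sum_comm]
    exact Finset.sum_congr rfl fun k _ => Finset.sum_congr rfl fun l _ => by ring
  rw [chartDensity, chartDensity, hmat, Matrix.det_mul, Matrix.det_mul, Matrix.det_transpose, hdet,
    show J.det * (coordMatrix β ψ (f x)).det * J.det = J.det ^ 2 * (coordMatrix β ψ (f x)).det by
      ring, Real.sqrt_mul (sq_nonneg _), Real.sqrt_sq_eq_abs]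

end ChartVolume

/-! ### The Riemannian measure -/

section RiemannianVolume

/-- A neighbourhood assignment on a second countable space is refined by a countable measurable
partition. -/
theorem exists_measurable_partition {X : Type*} [TopologicalSpace X] [SecondCountableTopology X]
    [MeasurableSpace X] [BorelSpace X] [Nonempty X] {U : X → Set X} (hU : ∀ x, IsOpen (U x))
    (hx : ∀ x, x ∈ U x) :
    ∃ A : ℕ → Set X, (∀ k, MeasurableSet (A k)) ∧ Pairwise (Function.onFun Disjoint A) ∧
      ⋃ k, A k = univ ∧ ∀ k, ∃ x, A k ⊆ U x := by
  obtain ⟨s, hs, hs'⟩ := TopologicalSpace.countable_cover_nhds fun x => (hU x).mem_nhds (hx x)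
  have hne : s.Nonempty := by
    by_contra h
    rw [not_nonempty_iff_eq_empty] at h
    rw [h] at hs'
    simp only [mem_empty_iff_false, iUnion_false, iUnion_empty] at hs'
    exact empty_ne_univ hs'
  obtain ⟨f, rfl⟩ := hs.exists_eq_range hne
  refine ⟨disjointed (U ∘ f), fun k => MeasurableSet.disjointed
    (fun i => (hU (f i)).measurableSet) k, disjoint_disjointed _, ?_,
    fun k => ⟨f k, disjointed_subset _ k⟩⟩
  rw [iUnion_disjointed]
  simpa using hs'

variable {n : ℕ} {M : Type*} [TopologicalSpace M] [ChartedSpace (EuclideanSpace ℝ (Fin n)) M]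

/-- The form field `β` consists of inner products. -/
structure IsInnerField (β : FormField n M) : Prop where
  bilin : ∀ p, IsBilinearAt β p
  symm : ∀ p v w, β p v w = β p w v
  pos : ∀ p v, v ≠ 0 → 0 < β p v v

theorem isInnerField_formC1 [IsManifold (𝓡 n) ∞ M] (g : C1Metric n M) : IsInnerField (formC1 g) :=
  ⟨isBilinearAt_formC1 g, g.symm, g.pos⟩

theorem isInnerField_formC0 [IsManifold (𝓡 n) ∞ M] (g : C0Metric n M) : IsInnerField (formC0 g) :=
  ⟨isBilinearAt_formC0 g, g.symm, g.pos⟩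

theorem isBilinearAt_pullbackForm {β : FormField n M} (Φ : M → M) {p : M}
    (h : IsBilinearAt β (Φ p)) : IsBilinearAt (pullbackForm Φ β) p := by
  obtain ⟨L, hL⟩ := h
  exact ⟨L.compl₁₂ (mfderiv (𝓡 n) (𝓡 n) Φ p).toLinearMap (mfderiv (𝓡 n) (𝓡 n) Φ p).toLinearMap,
    fun v w => hL _ _⟩

variable {φ ψ : OpenPartialHomeomorph M (EuclideanSpace ℝ (Fin n))} {β β' : FormField n M}

theorem dotProduct_coordMatrix {x : EuclideanSpace ℝ (Fin n)} (hβ : IsBilinearAt β (φ.symm x))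
    (v : Fin n → ℝ) : v ⬝ᵥ (coordMatrix β φ x *ᵥ v) =
      β (φ.symm x) (coordVector φ x (WithLp.toLp 2 v)) (coordVector φ x (WithLp.toLp 2 v)) := by
  rw [← coordForm_eq hβ, coordForm_eq_dotProduct]

theorem isHermitian_coordMatrix {x : EuclideanSpace ℝ (Fin n)}
    (hβ : ∀ v w, β (φ.symm x) v w = β (φ.symm x) w v) : (coordMatrix β φ x).IsHermitian := by
  ext i j
  exact hβ _ _

theorem continuousOn_chartDensity
    (hc : ∀ i j, ContinuousOn (fun x => coordMatrix β φ x i j) φ.target) :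
    ContinuousOn (chartDensity β φ) φ.target := by
  have h1 : ContinuousOn (coordMatrix β φ) φ.target :=
    continuousOn_pi.2 fun i => continuousOn_pi.2 fun j => hc i j
  have h2 : ContinuousOn (fun x => (coordMatrix β φ x).det) φ.target := by
    rw [continuousOn_iff_continuous_domRestrict] at h1 ⊢
    exact h1.matrix_det
  exact Real.continuous_sqrt.comp_continuousOn h2

theorem IsInnerField.posDef (hβ : IsInnerField β) (hφ : φ ∈ IsManifold.maximalAtlas (𝓡 n) ∞ M)
    {x : EuclideanSpace ℝ (Fin n)} (hx : x ∈ φ.target) : (coordMatrix β φ x).PosDef := by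
  refine Matrix.PosDef.of_dotProduct_mulVec_pos (isHermitian_coordMatrix (hβ.symm _))
    fun v hv => ?_
  rw [star_trivial, dotProduct_coordMatrix (hβ.bilin _)]
  refine hβ.pos _ _ fun h => hv ?_
  have := coordVector_injective hφ hx h
  simpa using this

theorem IsInnerField.chartDensity_pos (hβ : IsInnerField β)
    (hφ : φ ∈ IsManifold.maximalAtlas (𝓡 n) ∞ M)
    {x : EuclideanSpace ℝ (Fin n)} (hx : x ∈ φ.target) : 0 < chartDensity β φ x :=
  Real.sqrt_pos.2 (hβ.posDef hφ hx).det_pos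

theorem chartDensity_le (hβ : IsInnerField β) (hφ : φ ∈ IsManifold.maximalAtlas (𝓡 n) ∞ M)
    {x : EuclideanSpace ℝ (Fin n)} (hx : x ∈ φ.target) (hb : IsBilinearAt β' (φ.symm x))
    (hs : ∀ v w, β' (φ.symm x) v w = β' (φ.symm x) w v) {c : ℝ} (hc : 0 ≤ c)
    (h : ∀ v, β (φ.symm x) v v ≤ c ^ 2 * β' (φ.symm x) v v) :
    chartDensity β φ x ≤ c ^ n * chartDensity β' φ x := by
  have h1 : (coordMatrix β φ x).det ≤ (c ^ 2 • coordMatrix β' φ x).det := by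
    refine det_le_det_of_le (hβ.posDef hφ hx) ?_ fun v => ?_
    · exact IsSelfAdjoint.smul (IsSelfAdjoint.all _) (isHermitian_coordMatrix hs)
    · rw [Matrix.smul_mulVec, dotProduct_smul, dotProduct_coordMatrix (hβ.bilin _),
        dotProduct_coordMatrix hb, smul_eq_mul]
      exact h _
  rw [Matrix.det_smul, Fintype.card_fin, ← pow_mul, mul_comm 2 n, pow_mul] at h1
  refine (Real.sqrt_le_sqrt h1).trans_eq ?_
  rw [Real.sqrt_mul (sq_nonneg _), Real.sqrt_sq (pow_nonneg hc n)]
  rfl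

variable [MeasurableSpace M] [BorelSpace M]

theorem chartVolume_le (hβ : IsInnerField β) (hφ : φ ∈ IsManifold.maximalAtlas (𝓡 n) ∞ M)
    {A : Set M} (hA : MeasurableSet A) (hb : ∀ p ∈ A, IsBilinearAt β' p)
    (hs : ∀ p ∈ A, ∀ v w, β' p v w = β' p w v) {c : ℝ} (hc : 0 ≤ c)
    (h : ∀ p ∈ A, ∀ v, β p v v ≤ c ^ 2 * β' p v v) :
    chartVolume β φ A ≤ ENNReal.ofReal (c ^ n) * chartVolume β' φ A := by
  rw [chartVolume_apply β φ hA, chartVolume_apply β' φ hA,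
    ← lintegral_const_mul' _ _ ENNReal.ofReal_ne_top]
  refine setLIntegral_mono' (measurableSet_target_inter φ hA) fun x hx => ?_
  rw [← ENNReal.ofReal_mul (pow_nonneg hc n)]
  exact ENNReal.ofReal_le_ofReal
    (chartDensity_le hβ hφ hx.1 (hb _ hx.2) (hs _ hx.2) hc (h _ hx.2))

variable [IsManifold (𝓡 n) ∞ M]

theorem chartVolume_eq_chartVolume (hβ : ∀ p, IsBilinearAt β p)
    (hφ : φ ∈ IsManifold.maximalAtlas (𝓡 n) ∞ M) (hψ : ψ ∈ IsManifold.maximalAtlas (𝓡 n) ∞ M)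
    {A : Set M} (hA : MeasurableSet A) (hAφ : A ⊆ φ.source) (hAψ : A ⊆ ψ.source) :
    chartVolume β φ A = chartVolume β ψ A := by
  have h := (chartVolume_image hβ hφ hψ (Φ := id) mdifferentiable_id hA hAφ hAψ
    Function.injective_id.injOn).2
  have hid : pullbackForm id β = β := by
    funext p v w
    simp only [pullbackForm, id, mfderiv_id]
    rfl
  rw [image_id, hid] at h
  exact h.symm

variable [SecondCountableTopology M] [Nonempty M]

/-- The Riemannian measure is given in each chart of the maximal atlas by the usual formula. The
supremum of the measures of the charts is computed by gluing them along a countable partition of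
`M` into pieces of chart domains. -/
theorem riemannianVolume_eq_chartVolume (hβ : ∀ p, IsBilinearAt β p)
    (hφ : φ ∈ IsManifold.maximalAtlas (𝓡 n) ∞ M) {A : Set M} (hA : MeasurableSet A)
    (hAφ : A ⊆ φ.source) : riemannianVolume β A = chartVolume β φ A := by
  obtain ⟨P, hPm, hPd, hPu, hPs⟩ := exists_measurable_partition
    (U := fun p : M => (chartAt (EuclideanSpace ℝ (Fin n)) p).source)
    (fun p => (chartAt _ p).open_source) fun p => mem_chart_source _ p
  choose x hx using hPs
  have hsplit : ∀ (μ : Measure M) {A : Set M}, MeasurableSet A → μ A = ∑' k, μ (A ∩ P k) := by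
    intro μ A hA
    rw [← measure_iUnion (fun i j hij => (hPd hij).mono inter_subset_right inter_subset_right)
      (fun k => hA.inter (hPm k)), ← inter_iUnion, hPu, inter_univ]
  set ν : Measure M :=
    Measure.sum fun k => (chartVolume β (chartAt _ (x k))).restrict (P k) with hν
  have hνa : ∀ {A : Set M}, MeasurableSet A →
      ν A = ∑' k, chartVolume β (chartAt _ (x k)) (A ∩ P k) := by
    intro A hA
    rw [hν, Measure.sum_apply _ hA]
    exact tsum_congr fun k => Measure.restrict_apply hA
  have hφν : ∀ φ ∈ IsManifold.maximalAtlas (𝓡 n) ∞ M, ∀ {A : Set M}, MeasurableSet A →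
      A ⊆ φ.source → chartVolume β φ A = ν A := by
    intro φ hφ A hA hAφ
    rw [hsplit _ hA, hνa hA]
    exact tsum_congr fun k => chartVolume_eq_chartVolume hβ hφ
      (IsManifold.chart_mem_maximalAtlas _) (hA.inter (hPm k)) (inter_subset_left.trans hAφ)
      (inter_subset_right.trans (hx k))
  have hle : riemannianVolume β ≤ ν := by
    refine iSup₂_le fun φ hφ => Measure.le_iff.2 fun A hA => ?_
    rw [← chartVolume_inter_source β φ hA, hφν φ (IsManifold.subset_maximalAtlas hφ)
      (hA.inter φ.open_source.measurableSet) inter_subset_right]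
    exact measure_mono inter_subset_left
  have hge : ν ≤ riemannianVolume β := by
    refine Measure.le_iff.2 fun A hA => ?_
    rw [hνa hA, hsplit (riemannianVolume β) hA]
    refine ENNReal.tsum_le_tsum fun k => ?_
    exact (le_iSup₂ (f := fun φ (_ : φ ∈ atlas (EuclideanSpace ℝ (Fin n)) M) => chartVolume β φ)
      (chartAt _ (x k)) (chart_mem_atlas _ (x k))) _
  rw [le_antisymm hle hge, hφν φ hφ hA hAφ]

/-- If `Φ` is injective and `β ≤ c² Φ^*β'` on `S`, then the volume of a part of `S` is at most `cⁿ`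
times the volume of its image. -/
theorem map_riemannianVolume_le (hβ : IsInnerField β) (hβ' : IsInnerField β') {Φ : M → M}
    (hΦ : MDifferentiable (𝓡 n) (𝓡 n) Φ) (hinj : Function.Injective Φ) {S : Set M}
    (hS : MeasurableSet S) {c : ℝ} (hc : 0 ≤ c)
    (h : ∀ p ∈ S, ∀ v, β p v v ≤ c ^ 2 * pullbackForm Φ β' p v v) :
    ((riemannianVolume β).restrict S).map Φ ≤ ENNReal.ofReal (c ^ n) • riemannianVolume β' := by
  refine Measure.le_iff.2 fun B hB => ?_
  have hΦm : Measurable Φ := hΦ.continuous.measurable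
  rw [Measure.map_apply hΦm hB, Measure.restrict_apply (hΦm hB), Measure.smul_apply, smul_eq_mul]
  set U : M → Set M := fun p => (chartAt (EuclideanSpace ℝ (Fin n)) p).source ∩
    Φ ⁻¹' (chartAt (EuclideanSpace ℝ (Fin n)) (Φ p)).source with hU
  obtain ⟨P, hPm, hPd, hPu, hPs⟩ := exists_measurable_partition (U := U)
    (fun p => (chartAt _ p).open_source.inter
      ((chartAt _ (Φ p)).open_source.preimage hΦ.continuous))
    fun p => ⟨mem_chart_source _ p, mem_chart_source _ (Φ p)⟩
  choose x hx using hPs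
  set A : ℕ → Set M := fun k => Φ ⁻¹' B ∩ S ∩ P k with hAdef
  have hAm : ∀ k, MeasurableSet (A k) := fun k => ((hΦm hB).inter hS).inter (hPm k)
  have hAd : Pairwise (Function.onFun Disjoint A) :=
    fun i j hij => (hPd hij).mono inter_subset_right inter_subset_right
  have hAu : Φ ⁻¹' B ∩ S = ⋃ k, A k := by rw [hAdef, ← inter_iUnion, hPu, inter_univ]
  have hchart := fun p : M => IsManifold.chart_mem_maximalAtlas (I := 𝓡 n) (n := ∞) p
  have key : ∀ k, MeasurableSet (Φ '' A k) ∧ riemannianVolume β (A k) ≤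
      ENNReal.ofReal (c ^ n) * riemannianVolume β' (Φ '' A k) := by
    intro k
    have h1 : A k ⊆ (chartAt (EuclideanSpace ℝ (Fin n)) (x k)).source :=
      fun p hp => (hx k hp.2).1
    have h2 : MapsTo Φ (A k) (chartAt (EuclideanSpace ℝ (Fin n)) (Φ (x k))).source :=
      fun p hp => (hx k hp.2).2
    obtain ⟨h3, h4⟩ := chartVolume_image hβ'.bilin (hchart (x k)) (hchart (Φ (x k))) hΦ (hAm k) h1
      h2 hinj.injOn
    refine ⟨h3, ?_⟩
    rw [riemannianVolume_eq_chartVolume hβ.bilin (hchart (x k)) (hAm k) h1,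
      riemannianVolume_eq_chartVolume hβ'.bilin (hchart (Φ (x k))) h3 h2.image_subset, h4]
    exact chartVolume_le hβ (hchart _) (hAm k)
      (fun p _ => isBilinearAt_pullbackForm Φ (hβ'.bilin _))
      (fun p _ v w => hβ'.symm _ _ _) hc fun p hp => h p hp.1.2
  rw [hAu, measure_iUnion hAd hAm]
  calc ∑' k, riemannianVolume β (A k)
      ≤ ∑' k, ENNReal.ofReal (c ^ n) * riemannianVolume β' (Φ '' A k) :=
        ENNReal.tsum_le_tsum fun k => (key k).2
    _ = ENNReal.ofReal (c ^ n) * riemannianVolume β' (⋃ k, Φ '' A k) := by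
        rw [ENNReal.tsum_mul_left, measure_iUnion (fun i j hij =>
          (disjoint_image_iff hinj).2 (hAd hij)) fun k => (key k).1]
    _ ≤ ENNReal.ofReal (c ^ n) * riemannianVolume β' B := by
        gcongr
        exact iUnion_subset fun k => image_subset_iff.2 fun p hp => hp.1.1

theorem riemannianVolume_le (hβ : IsInnerField β) (hβ' : IsInnerField β') {c : ℝ} (hc : 0 ≤ c)
    (h : ∀ p v, β p v v ≤ c ^ 2 * β' p v v) :
    riemannianVolume β ≤ ENNReal.ofReal (c ^ n) • riemannianVolume β' := by
  have h1 := map_riemannianVolume_le hβ hβ' (Φ := id) mdifferentiable_id Function.injective_id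
    MeasurableSet.univ hc (fun p _ v => by
      simp only [pullbackForm, id, mfderiv_id]
      exact h p v)
  simpa using h1

/-- The Riemannian measure of a continuous metric is locally finite. -/
theorem isLocallyFiniteMeasure_riemannianVolume (hβ : ∀ p, IsBilinearAt β p)
    (hc : ∀ φ ∈ IsManifold.maximalAtlas (𝓡 n) ∞ M, ∀ i j,
      ContinuousOn (fun x => coordMatrix β φ x i j) φ.target) :
    IsLocallyFiniteMeasure (riemannianVolume β) := by
  refine ⟨fun p => ?_⟩
  set φ := chartAt (EuclideanSpace ℝ (Fin n)) p with hφdef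
  have hφ : φ ∈ IsManifold.maximalAtlas (𝓡 n) ∞ M := IsManifold.chart_mem_maximalAtlas p
  have hps : p ∈ φ.source := mem_chart_source _ p
  have hd := (continuousOn_chartDensity (hc φ hφ)).continuousAt
    (φ.open_target.mem_nhds (φ.map_source hps))
  obtain ⟨V, hV, hVo, hxV⟩ := mem_nhds_iff.1
    ((hd.eventually_lt_const (lt_add_one _)).and ((φ.open_target.eventually_mem
      (φ.map_source hps)).and (Metric.ball_mem_nhds (φ p) one_pos)))
  refine ⟨φ.source ∩ φ ⁻¹' V, (φ.isOpen_inter_preimage hVo).mem_nhds ⟨hps, hxV⟩, ?_⟩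
  have hm : MeasurableSet (φ.source ∩ φ ⁻¹' V) := (φ.isOpen_inter_preimage hVo).measurableSet
  rw [riemannianVolume_eq_chartVolume hβ hφ hm inter_subset_left, chartVolume_apply _ _ hm]
  have hsub : φ.target ∩ φ.symm ⁻¹' (φ.source ∩ φ ⁻¹' V) ⊆ V := by
    rintro x ⟨hx, -, hxV⟩
    rwa [mem_preimage, φ.right_inv hx] at hxV
  refine (lintegral_mono_set hsub).trans_lt ?_
  refine (setLIntegral_mono' hVo.measurableSet (g := fun _ =>
    ENNReal.ofReal (chartDensity β φ (φ p) + 1)) fun x hx =>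
    ENNReal.ofReal_le_ofReal (hV hx).1.le).trans_lt ?_
  rw [setLIntegral_const]
  refine ENNReal.mul_lt_top ENNReal.ofReal_lt_top ?_
  exact (measure_mono fun x hx => (hV hx).2.2).trans_lt measure_ball_lt_top

theorem lintegral_chart (hβ : IsInnerField β) (hφ : φ ∈ IsManifold.maximalAtlas (𝓡 n) ∞ M)
    (hc : ∀ i j, ContinuousOn (fun x => coordMatrix β φ x i j) φ.target)
    {f : M → ℝ≥0∞} (hf : Measurable f) :
    ∫⁻ x in φ.target, ENNReal.ofReal (chartDensity β φ x) * f (φ.symm x) =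
      ∫⁻ p in φ.source, f p ∂(riemannianVolume β) := by
  have h1 : (riemannianVolume β).restrict φ.source = chartVolume β φ := by
    refine Measure.ext fun A hA => ?_
    rw [Measure.restrict_apply hA, ← chartVolume_inter_source β φ hA]
    exact riemannianVolume_eq_chartVolume hβ.bilin hφ (hA.inter φ.open_source.measurableSet)
      inter_subset_right
  have h2 : AEMeasurable φ.symm (volume.restrict φ.target) :=
    φ.symm.continuousOn.aemeasurable φ.open_target.measurableSet
  have hac := withDensity_absolutelyContinuous (volume.restrict φ.target)
    (fun x => ENNReal.ofReal (√(coordMatrix β φ x).det))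
  have h3 : AEMeasurable (fun x => ENNReal.ofReal (√(coordMatrix β φ x).det))
      (volume.restrict φ.target) :=
    ((continuousOn_chartDensity hc).aemeasurable φ.open_target.measurableSet).ennreal_ofReal
  rw [h1, chartVolume, lintegral_map' hf.aemeasurable (h2.mono_ac hac),
    lintegral_withDensity_eq_lintegral_mul₀ h3 (g := fun x => f (φ.symm x))
      (hf.comp_aemeasurable h2)]
  rfl

end RiemannianVolume

/-! ### Energy along integral curves -/

section Calculus

/-- A weighted Cauchy-Schwarz inequality for the increments of a function on `[0, ∞)`. -/
theorem ofReal_sub_sq_le {u u' : ℝ → ℝ} (hu : ∀ t, 0 ≤ t → HasDerivWithinAt u (u' t) (Ici 0) t)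
    (hu' : ContinuousOn u' (Ici 0)) {a b : ℝ} (ha : 0 ≤ a) (hab : a ≤ b) :
    ENNReal.ofReal ((u b - u a) ^ 2) ≤ ENNReal.ofReal (Real.exp (-a)) *
      ∫⁻ s in Ioi 0, ENNReal.ofReal (Real.exp s * u' s ^ 2) := by
  have hsub : Icc a b ⊆ Ici 0 := fun s hs => ha.trans hs.1
  have hc : ContinuousOn u' (uIcc a b) := by rw [uIcc_of_le hab]; exact hu'.mono hsub
  have hI : ∫ s in a..b, u' s = u b - u a := by
    refine intervalIntegral.integral_eq_sub_of_hasDeriv_right_of_le hab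
      (fun s hs => (hu s (hsub hs)).continuousWithinAt.mono hsub) (fun s hs => ?_)
      hc.intervalIntegrable
    exact (hu s (ha.trans hs.1.le)).mono fun y hy => (ha.trans hs.1.le).trans (le_of_lt hy)
  have hA : ∫ s in a..b, Real.exp (-s) = Real.exp (-a) - Real.exp (-b) := by
    rw [intervalIntegral.integral_comp_neg, integral_exp]
  have hBc : ContinuousOn (fun s => Real.exp s * u' s ^ 2) (uIcc a b) :=
    Real.continuous_exp.continuousOn.mul (hc.pow 2)
  set I := u b - u a
  set B := ∫ s in a..b, Real.exp s * u' s ^ 2 with hB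
  -- The square `eˢ (u' - l e⁻ˢ)²` is integrated with the choice `l = I eᵃ`.
  have hlc : ∀ l : ℝ, ContinuousOn (fun s => 2 * l * u' s) (uIcc a b) :=
    fun l => continuousOn_const.mul hc
  have key : ∀ l : ℝ, 0 ≤ B - 2 * l * I + l ^ 2 * (Real.exp (-a) - Real.exp (-b)) := by
    intro l
    have hdc : ContinuousOn (fun s => Real.exp s * u' s ^ 2 - 2 * l * u' s) (uIcc a b) :=
      hBc.sub (hlc l)
    rw [← hA, ← hI, hB, ← intervalIntegral.integral_const_mul,
      ← intervalIntegral.integral_const_mul,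
      ← intervalIntegral.integral_sub hBc.intervalIntegrable (hlc l).intervalIntegrable,
      ← intervalIntegral.integral_add hdc.intervalIntegrable
        (Continuous.intervalIntegrable (by fun_prop) _ _)]
    refine intervalIntegral.integral_nonneg hab fun s _ => ?_
    have h1 : Real.exp s * Real.exp (-s) = 1 := by rw [← Real.exp_add]; simp
    have h2 : Real.exp s * u' s ^ 2 - 2 * l * u' s + l ^ 2 * Real.exp (-s) =
        Real.exp s * (u' s - l * Real.exp (-s)) ^ 2 := by
      linear_combination (2 * l * u' s - l ^ 2 * Real.exp (-s)) * h1
    rw [h2]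
    positivity
  have hIB : I ^ 2 ≤ Real.exp (-a) * B := by
    have h1 := key (I * Real.exp a)
    have h2 : Real.exp a * Real.exp (-a) = 1 := by rw [← Real.exp_add]; simp
    have h3 := Real.exp_pos (-a)
    have h4 := mul_nonneg h3.le h1
    have h6 : Real.exp (-a) * (B - 2 * (I * Real.exp a) * I +
        (I * Real.exp a) ^ 2 * (Real.exp (-a) - Real.exp (-b))) =
        Real.exp (-a) * B - I ^ 2 - Real.exp (-a) * (I * Real.exp a) ^ 2 * Real.exp (-b) := by
      linear_combination (I ^ 2 * (Real.exp a * Real.exp (-a) - 1)) * h2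
    have h5 : 0 ≤ Real.exp (-a) * (I * Real.exp a) ^ 2 * Real.exp (-b) := by positivity
    linarith
  calc ENNReal.ofReal (I ^ 2) ≤ ENNReal.ofReal (Real.exp (-a) * B) := ENNReal.ofReal_le_ofReal hIB
    _ = ENNReal.ofReal (Real.exp (-a)) * ENNReal.ofReal B :=
      ENNReal.ofReal_mul (Real.exp_pos _).le
    _ ≤ _ := by
      gcongr
      rw [hB, intervalIntegral.integral_of_le hab, ofReal_integral_eq_lintegral_ofReal
        ((intervalIntegrable_iff_integrableOn_Ioc_of_le hab).1 hBc.intervalIntegrable)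
        (Eventually.of_forall fun s => by positivity)]
      exact lintegral_mono_set fun s hs => ha.trans_lt hs.1

end Calculus

section Continuity

variable {n : ℕ} {M : Type*} [TopologicalSpace M] [ChartedSpace (EuclideanSpace ℝ (Fin n)) M]

theorem continuousOn_fderiv_comp_symm {φ : OpenPartialHomeomorph M (EuclideanSpace ℝ (Fin n))}
    (hφ : φ ∈ IsManifold.maximalAtlas (𝓡 n) ∞ M) {G : M → ℝ} (hG : ContMDiff (𝓡 n) 𝓘(ℝ, ℝ) 1 G) :
    ContinuousOn (fderiv ℝ (G ∘ φ.symm)) φ.target :=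
  (contDiffOn_comp_symm hφ (k := 1) hG).continuousOn_fderiv_of_isOpen φ.open_target le_rfl

variable [IsManifold (𝓡 n) ∞ M]

theorem continuous_of_comp_symm {f : M → ℝ}
    (h : ∀ φ ∈ IsManifold.maximalAtlas (𝓡 n) ∞ M, ContinuousOn (f ∘ φ.symm) φ.target) :
    Continuous f := by
  rw [continuous_iff_continuousAt]
  intro p
  set φ := chartAt (EuclideanSpace ℝ (Fin n)) p
  have hps : p ∈ φ.source := mem_chart_source _ p
  have h1 : ContinuousAt ((f ∘ φ.symm) ∘ φ) p :=
    ((h φ (IsManifold.chart_mem_maximalAtlas p)).continuousAt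
      (φ.open_target.mem_nhds (φ.map_source hps))).comp (φ.continuousAt hps)
  refine h1.congr ?_
  filter_upwards [φ.open_source.mem_nhds hps] with q hq
  simp [φ.left_inv hq]

variable {g : C1Metric n M} {r : M → ℝ} {RS Λ : ℝ} {G : M → ℝ}

theorem continuous_normGradSq (g : C1Metric n M) (hG : ContMDiff (𝓡 n) 𝓘(ℝ, ℝ) 1 G) :
    Continuous (normGradSq g G) := by
  refine continuous_of_comp_symm (n := n) fun φ hφ => ?_
  have hGd : MDifferentiable (𝓡 n) 𝓘(ℝ, ℝ) G := hG.mdifferentiable (by simp)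
  have h1 := continuousOn_fderiv_comp_symm hφ hG
  have h2 : ContinuousOn (gradCoord g φ G) φ.target := by
    intro x hx
    obtain ⟨e, he⟩ := exists_equiv_of_posDef (coordForm (formC1 g) φ x)
      fun v hv => coordForm_pos g hφ hx hv
    have h3 : ContinuousAt (fun x => (coordForm (formC1 g) φ x).inverse) x := by
      refine ContinuousAt.comp (g := ContinuousLinearMap.inverse) ?_
        ((contDiffOn_coordForm g hφ).continuousOn.continuousAt (φ.open_target.mem_nhds hx))
      rw [← he]
      exact (contDiffAt_map_inverse e (n := 0)).continuousAt
    exact (h3.continuousWithinAt.clm_apply (h1 x hx))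
  refine (h1.clm_apply h2).congr fun x hx => ?_
  dsimp only
  rw [← differential_coordVector hφ hx (hGd _), coordVector_gradCoord g hφ hGd hx]
  exact normGradSq_eq g G _

/-- The derivative of `G` along the radial field `𝐗`. -/
def dilationDeriv (g : C1Metric n M) (r G : M → ℝ) (p : M) : ℝ :=
  differential G p (radialField g r p)

theorem continuous_dilationDeriv (h : IsWeaklyConicalEnd g r RS Λ)
    (hG : ContMDiff (𝓡 n) 𝓘(ℝ, ℝ) 1 G) : Continuous (dilationDeriv g r G) := by
  refine continuous_of_comp_symm (n := n) fun φ hφ => ?_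
  have hGd : MDifferentiable (𝓡 n) 𝓘(ℝ, ℝ) G := hG.mdifferentiable (by simp)
  refine ((continuousOn_fderiv_comp_symm hφ hG).clm_apply
    (contDiffOn_radialCoord h hφ).continuousOn).congr fun x hx => ?_
  dsimp only
  rw [← differential_coordVector hφ hx (hGd _), coordVector_radialCoord h hφ hx]
  rfl

theorem dilationDeriv_eq (p : M) :
    dilationDeriv g r G p = r p / normGradSq g r p * radialDeriv g r G p := by
  rw [dilationDeriv, radialField, map_smul, radialDeriv, smul_eq_mul]

end Continuity

/-! ### Transport of the weighted measure by the flow -/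

section Transport

variable {n : ℕ} {M : Type*} [TopologicalSpace M] [ChartedSpace (EuclideanSpace ℝ (Fin n)) M]
  [IsManifold (𝓡 n) ∞ M] {g : C1Metric n M} {r : M → ℝ} {RS Λ : ℝ} {G : M → ℝ}

theorem IsWeaklyConicalEnd.nonempty (h : IsWeaklyConicalEnd g r RS Λ) : Nonempty M := by
  by_contra hM
  rw [not_nonempty_iff] at hM
  exact h.unbounded (by rw [range_eq_empty]; exact bddAbove_empty)

theorem IsWeaklyConicalEnd.isOpen_outerRegion (h : IsWeaklyConicalEnd g r RS Λ) (R : ℝ) :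
    IsOpen (outerRegion r R) := isOpen_lt continuous_const h.continuous

theorem IsWeaklyConicalEnd.outerRegion_eq_univ (h : IsWeaklyConicalEnd g r RS Λ) :
    outerRegion r RS = univ := eq_univ_of_forall h.lt_r

/-- The weight `r^{-n}`. -/
def decayWeight (n : ℕ) (r : M → ℝ) (p : M) : ℝ≥0∞ := ENNReal.ofReal (r p ^ (-(n : ℤ)))

variable [MeasurableSpace M] [BorelSpace M]

theorem measurable_decayWeight (h : IsWeaklyConicalEnd g r RS Λ) :
    Measurable (decayWeight n r) :=
  (h.continuous.measurable.pow_const _).ennreal_ofReal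

variable [T2Space M] [SecondCountableTopology M]

/-- The flow of the radial field carries `r⁻ⁿ dμ_g` to itself, up to a factor that tends to `1` at
infinity. -/
theorem lintegral_forwardFlow_le (h : IsWeaklyConicalEnd g r RS Λ) {t R : ℝ} (ht : 0 ≤ t)
    (hR : 0 < R) {f : M → ℝ≥0∞} (hf : Measurable f) :
    ∫⁻ p in outerRegion r R, decayWeight n r p * f (forwardFlow (radialField g r) t p)
        ∂(riemannianVolume (formC1 g)) ≤
      ENNReal.ofReal (Real.exp (18 * n * Λ / R ^ 2)) *
        ∫⁻ p in outerRegion r (Real.exp t * R), decayWeight n r p * f p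
          ∂(riemannianVolume (formC1 g)) := by
  have := h.nonempty
  set F := forwardFlow (radialField g r) t with hF
  set μ := riemannianVolume (formC1 g)
  -- `F` expands lengths at least by the factor `1 / c`.
  set c := Real.exp (-t) * Real.exp (18 * Λ / R ^ 2) with hc
  have hmap : (μ.restrict (outerRegion r R)).map F ≤ ENNReal.ofReal (c ^ n) • μ := by
    refine map_riemannianVolume_le (isInnerField_formC1 g) (isInnerField_formC1 g)
      ((contMDiff_forwardFlow h ht).mdifferentiable (by simp)) (forwardFlow_injective h ht)
      (h.isOpen_outerRegion R).measurableSet (by positivity) fun p hp v => ?_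
    have h1 := (flowBounds_forwardFlow h ht p).2 v |>.2
    have h2 : 36 * Λ / r p ^ 2 ≤ 36 * Λ / R ^ 2 := by
      have := h.nonneg
      have hp' : R < r p := hp
      gcongr
    have h3 : c ^ 2 = Real.exp (-(2 * t)) * Real.exp (36 * Λ / R ^ 2) := by
      rw [hc, mul_pow, ← Real.exp_nat_mul, ← Real.exp_nat_mul]
      congr 2 <;> push_cast <;> ring
    have h5 := inner_self_nonneg g p v
    have h6 : Real.exp (-(36 * Λ / R ^ 2)) ≤ Real.exp (-(36 * Λ / r p ^ 2)) :=
      Real.exp_le_exp.2 (by linarith)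
    have h7 : Real.exp (36 * Λ / R ^ 2) * Real.exp (-(36 * Λ / R ^ 2)) = 1 := by
      rw [← Real.exp_add]; simp
    change g.inner p v v ≤ c ^ 2 * g.inner (F p) (mfderiv (𝓡 n) (𝓡 n) F p v)
      (mfderiv (𝓡 n) (𝓡 n) F p v)
    have hy := inner_self_nonneg g (F p) (mfderiv (𝓡 n) (𝓡 n) F p v)
    have h8 : Real.exp (-(36 * Λ / r (F p) ^ 2)) ≤ 1 := by
      rw [Real.exp_le_one_iff]
      linarith [h.exponent_nonneg (F p)]
    set y := g.inner (F p) (mfderiv (𝓡 n) (𝓡 n) F p v) (mfderiv (𝓡 n) (𝓡 n) F p v)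
    calc g.inner p v v
        = Real.exp (36 * Λ / R ^ 2) * (g.inner p v v * Real.exp (-(36 * Λ / R ^ 2))) := by
          rw [mul_left_comm, h7, mul_one]
      _ ≤ Real.exp (36 * Λ / R ^ 2) * (g.inner p v v * Real.exp (-(36 * Λ / r p ^ 2))) := by
          gcongr
      _ ≤ Real.exp (36 * Λ / R ^ 2) * (Real.exp (-(2 * t)) * y) :=
          mul_le_mul_of_nonneg_left (h1.trans (mul_le_of_le_one_right
            (mul_nonneg (Real.exp_pos _).le hy) h8)) (Real.exp_pos _).le
      _ = c ^ 2 * y := by rw [h3]; ring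
  have hFm : Measurable F := (contMDiff_forwardFlow h ht).continuous.measurable
  have hwm := measurable_decayWeight h
  set E := outerRegion r (Real.exp t * R) with hE
  have hEm : MeasurableSet E := (h.isOpen_outerRegion _).measurableSet
  have hind : Measurable (E.indicator fun p => decayWeight n r p * f p) :=
    (hwm.mul hf).indicator hEm
  -- `r⁻ⁿ ∘ F = e^{-nt} r⁻ⁿ` offsets the factor `e^{-nt}` of the volumes.
  have h1 : ∀ p ∈ outerRegion r R, decayWeight n r p * f (F p) =
      ENNReal.ofReal (Real.exp (n * t)) * (E.indicator fun p => decayWeight n r p * f p) (F p) := by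
    intro p hp
    have hr : r (F p) = Real.exp t * r p := r_forwardFlow h ht p
    have hFp : F p ∈ E := by
      change Real.exp t * R < r (F p)
      rw [hr]
      exact mul_lt_mul_of_pos_left hp (Real.exp_pos _)
    rw [indicator_of_mem hFp, ← mul_assoc]
    congr 1
    have h2 : Real.exp (n * t) * Real.exp t ^ (-(n : ℤ)) = 1 := by
      rw [zpow_neg, zpow_natCast, ← Real.exp_nat_mul, mul_inv_cancel₀ (Real.exp_pos _).ne']
    rw [decayWeight, decayWeight, ← ENNReal.ofReal_mul (Real.exp_pos _).le, hr, mul_zpow,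
      ← mul_assoc, h2, one_mul]
  calc ∫⁻ p in outerRegion r R, decayWeight n r p * f (F p) ∂μ
      = ∫⁻ p in outerRegion r R, ENNReal.ofReal (Real.exp (n * t)) *
          (E.indicator fun p => decayWeight n r p * f p) (F p) ∂μ :=
        setLIntegral_congr_fun (h.isOpen_outerRegion R).measurableSet h1
    _ = ENNReal.ofReal (Real.exp (n * t)) *
          ∫⁻ p, (E.indicator fun p => decayWeight n r p * f p) p
            ∂((μ.restrict (outerRegion r R)).map F) := by
        rw [lintegral_map hind hFm]
        exact lintegral_const_mul _ (hind.comp hFm)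
    _ ≤ ENNReal.ofReal (Real.exp (n * t)) *
          ∫⁻ p, (E.indicator fun p => decayWeight n r p * f p) p
            ∂(ENNReal.ofReal (c ^ n) • μ) := by
        gcongr
    _ = _ := by
        rw [lintegral_smul_measure, smul_eq_mul, ← mul_assoc,
          ← ENNReal.ofReal_mul (Real.exp_pos _).le, lintegral_indicator hEm]
        congr 2
        rw [hc, mul_pow, ← Real.exp_nat_mul, ← Real.exp_nat_mul, ← mul_assoc, ← Real.exp_add,
          show (n : ℝ) * t + n * -t = 0 by ring, Real.exp_zero, one_mul]
        congr 1
        ring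

end Transport

/-! ### The limit along the radial field -/

section Limit

theorem lintegral_exp_neg_Ioi : ∫⁻ s in Ioi (0 : ℝ), ENNReal.ofReal (Real.exp (-s)) = 1 := by
  rw [← ofReal_integral_eq_lintegral_ofReal (integrableOn_exp_neg_Ioi 0)
    (Eventually.of_forall fun s => (Real.exp_pos _).le), integral_exp_neg_Ioi_zero]
  simp

variable {n : ℕ} {M : Type*} [TopologicalSpace M] [ChartedSpace (EuclideanSpace ℝ (Fin n)) M]
  [IsManifold (𝓡 n) ∞ M] {g : C1Metric n M} {r : M → ℝ} {RS Λ : ℝ} {G : M → ℝ}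

/-- The weighted energy of `G` along the integral curve of the radial field that starts at `q`. -/
def radialEnergy (g : C1Metric n M) (r G : M → ℝ) (q : M) : ℝ≥0∞ :=
  ∫⁻ s in Ioi (0 : ℝ),
    ENNReal.ofReal (Real.exp s * dilationDeriv g r G (forwardFlow (radialField g r) s q) ^ 2)

/-- The limit of `G` along the integral curve of the radial field that starts at `q`; a junk value
if there is no limit. -/
def asymptoticLimit (g : C1Metric n M) (r G : M → ℝ) (q : M) : ℝ :=
  limUnder atTop fun t : ℝ => G (forwardFlow (radialField g r) t q)

/-- The flow is only meaningful for times `s ≥ 0`; replacing `s` by `max s 0` makes the integrand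
jointly measurable on `ℝ × M`. -/
theorem radialEnergy_eq (q : M) : radialEnergy g r G q = ∫⁻ s in Ioi (0 : ℝ), ENNReal.ofReal
      (Real.exp s * dilationDeriv g r G (forwardFlow (radialField g r) (max s 0) q) ^ 2) :=
  setLIntegral_congr_fun measurableSet_Ioi fun s hs => by
    simp only [max_eq_left (le_of_lt (mem_Ioi.1 hs))]

theorem isLocallyFiniteMeasure_riemannianVolume_formC1 [MeasurableSpace M] [BorelSpace M]
    [SecondCountableTopology M] [Nonempty M] (g : C1Metric n M) :
    IsLocallyFiniteMeasure (riemannianVolume (formC1 g)) :=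
  isLocallyFiniteMeasure_riemannianVolume (isBilinearAt_formC1 g)
    fun _ hφ i j => (contDiffOn_coordMatrix g hφ i j).continuousOn

variable [T2Space M]

theorem ofReal_flow_sub_sq_le (h : IsWeaklyConicalEnd g r RS Λ) (hG : ContMDiff (𝓡 n) 𝓘(ℝ, ℝ) 1 G)
    {a b : ℝ} (ha : 0 ≤ a) (hab : a ≤ b) (q : M) :
    ENNReal.ofReal ((G (forwardFlow (radialField g r) b q) -
      G (forwardFlow (radialField g r) a q)) ^ 2) ≤
      ENNReal.ofReal (Real.exp (-a)) * radialEnergy g r G q :=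
  ofReal_sub_sq_le (u := fun t => G (forwardFlow (radialField g r) t q))
    (fun _ ht => hasDerivWithinAt_comp_forwardFlow h (hG.mdifferentiable (by simp)) ht q)
    ((continuous_dilationDeriv h hG).comp_continuousOn (continuousOn_forwardFlow h q)) ha hab

theorem tendsto_asymptoticLimit (h : IsWeaklyConicalEnd g r RS Λ)
    (hG : ContMDiff (𝓡 n) 𝓘(ℝ, ℝ) 1 G) {q : M} (hq : radialEnergy g r G q ≠ ⊤) :
    Tendsto (fun t : ℝ => G (forwardFlow (radialField g r) t q)) atTop
      (𝓝 (asymptoticLimit g r G q)) := by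
  refine CauchySeq.tendsto_limUnder (Metric.cauchySeq_iff'.2 fun ε hε => ?_)
  have h1 : Tendsto (fun t : ℝ => Real.exp (-t) * (radialEnergy g r G q).toReal) atTop (𝓝 0) := by
    simpa using Real.tendsto_exp_neg_atTop_nhds_zero.mul_const (radialEnergy g r G q).toReal
  obtain ⟨N, hN, hN0⟩ := ((h1.eventually (gt_mem_nhds (pow_pos hε 2))).and
    (eventually_ge_atTop 0)).exists
  refine ⟨N, fun t ht => ?_⟩
  have h2 := ofReal_flow_sub_sq_le h hG hN0 ht q
  rw [← ENNReal.ofReal_toReal hq, ← ENNReal.ofReal_mul (Real.exp_pos _).le,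
    ENNReal.ofReal_le_ofReal_iff (by positivity)] at h2
  rw [Real.dist_eq]
  exact abs_lt_of_sq_lt_sq (h2.trans_lt hN) hε.le

/-- The limit of `G` is constant along integral curves. The equality is one of junk values where
there is no limit. -/
theorem asymptoticLimit_forwardFlow (h : IsWeaklyConicalEnd g r RS Λ) {t : ℝ} (ht : 0 ≤ t)
    (q : M) : asymptoticLimit g r G (forwardFlow (radialField g r) t q) =
      asymptoticLimit g r G q := by
  have h1 : map (fun s : ℝ => G (forwardFlow (radialField g r) s
      (forwardFlow (radialField g r) t q))) atTop =
      map (fun s : ℝ => G (forwardFlow (radialField g r) s q)) atTop := by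
    conv_rhs => rw [← map_add_atTop_eq t, map_map]
    refine Filter.map_congr ?_
    filter_upwards [eventually_ge_atTop 0] with s hs
    rw [← forwardFlow_add h ht hs, add_comm]
    rfl
  rw [asymptoticLimit, asymptoticLimit, limUnder, limUnder, h1]

theorem ofReal_asymptoticLimit_sub_sq_le (h : IsWeaklyConicalEnd g r RS Λ)
    (hG : ContMDiff (𝓡 n) 𝓘(ℝ, ℝ) 1 G) (q : M) :
    ENNReal.ofReal ((asymptoticLimit g r G q - G q) ^ 2) ≤ radialEnergy g r G q := by
  by_cases hq : radialEnergy g r G q = ⊤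
  · rw [hq]; exact le_top
  have h1 : Tendsto
      (fun t : ℝ => ENNReal.ofReal ((G (forwardFlow (radialField g r) t q) - G q) ^ 2))
      atTop (𝓝 (ENNReal.ofReal ((asymptoticLimit g r G q - G q) ^ 2))) :=
    ENNReal.tendsto_ofReal (((tendsto_asymptoticLimit h hG hq).sub_const _).pow 2)
  refine le_of_tendsto h1 ?_
  filter_upwards [eventually_ge_atTop 0] with t ht
  have h2 := ofReal_flow_sub_sq_le h hG le_rfl ht q
  simpa [forwardFlow_zero h q] using h2

variable [MeasurableSpace M] [BorelSpace M]

theorem measurable_uncurry_flow (h : IsWeaklyConicalEnd g r RS Λ)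
    (hG : ContMDiff (𝓡 n) 𝓘(ℝ, ℝ) 1 G) :
    Measurable (Function.uncurry fun (s : ℝ) (q : M) => ENNReal.ofReal
      (Real.exp s * dilationDeriv g r G (forwardFlow (radialField g r) (max s 0) q) ^ 2)) := by
  have hc := continuous_dilationDeriv h hG
  have h1 : Measurable (Function.uncurry fun (s : ℝ) (q : M) =>
      dilationDeriv g r G (forwardFlow (radialField g r) (max s 0) q)) := by
    refine measurable_uncurry_of_continuous_of_measurable (fun q => ?_) fun s => ?_
    · exact hc.comp ((continuousOn_forwardFlow h q).comp_continuous
        (continuous_id.max continuous_const) fun s => mem_Ici.2 (le_max_right _ _))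
    · exact (hc.comp (contMDiff_forwardFlow h (le_max_right _ _)).continuous).measurable
  exact ((Real.measurable_exp.comp measurable_fst).mul (h1.pow_const 2)).ennreal_ofReal

theorem measurable_radialEnergy (h : IsWeaklyConicalEnd g r RS Λ)
    (hG : ContMDiff (𝓡 n) 𝓘(ℝ, ℝ) 1 G) : Measurable (radialEnergy g r G) := by
  simp only [funext (radialEnergy_eq (g := g) (r := r) (G := G))]
  exact Measurable.lintegral_prod_right' (f := fun z : M × ℝ => ENNReal.ofReal (Real.exp z.2 *
    dilationDeriv g r G (forwardFlow (radialField g r) (max z.2 0) z.1) ^ 2))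
    ((measurable_uncurry_flow h hG).comp measurable_swap)

variable [SecondCountableTopology M]

/-- Hardy's inequality in its simplest form: quadratic decay of the energy of `𝐗 G` outside
`{r ≤ R}` controls the integral of the weighted energies along the integral curves. -/
theorem lintegral_radialEnergy_le (h : IsWeaklyConicalEnd g r RS Λ)
    (hG : ContMDiff (𝓡 n) 𝓘(ℝ, ℝ) 1 G) {R C : ℝ} (hR : 0 < R)
    (hC : ∀ R', R ≤ R' → ∫⁻ p in outerRegion r R',
      decayWeight n r p * ENNReal.ofReal (dilationDeriv g r G p ^ 2)
        ∂(riemannianVolume (formC1 g)) ≤ ENNReal.ofReal (C * (R' ^ 2)⁻¹)) :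
    ∫⁻ p in outerRegion r R, decayWeight n r p * radialEnergy g r G p
        ∂(riemannianVolume (formC1 g)) ≤
      ENNReal.ofReal (Real.exp (18 * n * Λ / R ^ 2)) * ENNReal.ofReal (C * (R ^ 2)⁻¹) := by
  have := h.nonempty
  have := isLocallyFiniteMeasure_riemannianVolume_formC1 g
  set μ := riemannianVolume (formC1 g)
  have hwm := measurable_decayWeight h
  have hm := measurable_uncurry_flow h hG
  have hdm : Measurable fun p => ENNReal.ofReal (dilationDeriv g r G p ^ 2) :=
    ((continuous_dilationDeriv h hG).measurable.pow_const 2).ennreal_ofReal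
  have h1 : ∀ p, decayWeight n r p * radialEnergy g r G p = ∫⁻ s in Ioi (0 : ℝ),
      decayWeight n r p * ENNReal.ofReal (Real.exp s *
        dilationDeriv g r G (forwardFlow (radialField g r) (max s 0) p) ^ 2) := by
    intro p
    rw [radialEnergy_eq]
    exact (lintegral_const_mul' _ _ ENNReal.ofReal_ne_top).symm
  simp only [h1]
  rw [lintegral_lintegral_swap
    (((hwm.comp measurable_fst).mul (hm.comp measurable_swap)).aemeasurable)]
  -- The flow at time `s` transports the energy outside of `{r ≤ e^s R}`, which is at most
  -- `C e^{-2s} R⁻²`; the weight `e^s` leaves a factor `e^{-s}` of integral `1`.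
  calc _ ≤ ∫⁻ s in Ioi (0 : ℝ), ENNReal.ofReal (Real.exp (18 * n * Λ / R ^ 2)) *
        ENNReal.ofReal (C * (R ^ 2)⁻¹) * ENNReal.ofReal (Real.exp (-s)) := by
        refine setLIntegral_mono' measurableSet_Ioi fun s hs => ?_
        have hs0 : 0 ≤ s := le_of_lt hs
        simp only [max_eq_left hs0, ENNReal.ofReal_mul (Real.exp_pos _).le]
        have h2 : ∀ p, decayWeight n r p * (ENNReal.ofReal (Real.exp s) *
            ENNReal.ofReal (dilationDeriv g r G (forwardFlow (radialField g r) s p) ^ 2)) =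
            ENNReal.ofReal (Real.exp s) * (decayWeight n r p *
            ENNReal.ofReal (dilationDeriv g r G (forwardFlow (radialField g r) s p) ^ 2)) :=
          fun p => mul_left_comm _ _ _
        simp only [h2]
        rw [lintegral_const_mul' _ _ ENNReal.ofReal_ne_top]
        have h3 := lintegral_forwardFlow_le h hs0 hR hdm
        have h4 := hC (Real.exp s * R) (le_mul_of_one_le_left hR.le (Real.one_le_exp hs0))
        have h5 : C * ((Real.exp s * R) ^ 2)⁻¹ =
            Real.exp (-s) * (Real.exp (-s) * (C * (R ^ 2)⁻¹)) := by
          rw [Real.exp_neg]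
          field_simp
        rw [h5, ENNReal.ofReal_mul (Real.exp_pos _).le,
          ENNReal.ofReal_mul (Real.exp_pos _).le] at h4
        have h6 : ENNReal.ofReal (Real.exp s) * ENNReal.ofReal (Real.exp (-s)) = 1 := by
          rw [← ENNReal.ofReal_mul (Real.exp_pos _).le, ← Real.exp_add]; simp
        calc _ ≤ ENNReal.ofReal (Real.exp s) * (ENNReal.ofReal (Real.exp (18 * n * Λ / R ^ 2)) *
              (ENNReal.ofReal (Real.exp (-s)) * (ENNReal.ofReal (Real.exp (-s)) *
                ENNReal.ofReal (C * (R ^ 2)⁻¹)))) := by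
              gcongr
              exact h3.trans (by gcongr)
          _ = (ENNReal.ofReal (Real.exp s) * ENNReal.ofReal (Real.exp (-s))) *
              (ENNReal.ofReal (Real.exp (18 * n * Λ / R ^ 2)) *
              (ENNReal.ofReal (C * (R ^ 2)⁻¹) * ENNReal.ofReal (Real.exp (-s)))) := by ring
          _ = _ := by rw [h6, one_mul, mul_assoc (ENNReal.ofReal _)]
    _ = _ := by
        rw [lintegral_const_mul _ (by fun_prop),
          lintegral_exp_neg_Ioi, mul_one]

end Limit

/-! ### Consequences of the decay of the energy -/

section L2

theorem eLpNorm_two_eq {X : Type*} [MeasurableSpace X] (μ : Measure X) (f : X → ℝ) :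
    eLpNorm f 2 μ = (∫⁻ x, ENNReal.ofReal (f x ^ 2) ∂μ) ^ (1 / 2 : ℝ) := by
  rw [eLpNorm_eq_lintegral_rpow_enorm_toReal (by simp) (by simp)]
  simp only [ENNReal.toReal_ofNat]
  congr 2
  ext x
  rw [Real.enorm_eq_ofReal_abs, ENNReal.ofReal_rpow_of_nonneg (abs_nonneg _) (by norm_num)]
  norm_num

theorem ae_of_forall_isCompact {X : Type*} [TopologicalSpace X] [SigmaCompactSpace X]
    [MeasurableSpace X] {μ : Measure X} {P : X → Prop}
    (h : ∀ K, IsCompact K → ∀ᵐ x ∂(μ.restrict K), P x) : ∀ᵐ x ∂μ, P x := by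
  rw [← Measure.restrict_univ (μ := μ), ← iUnion_compactCovering X, ae_restrict_iUnion_iff]
  exact fun k => h _ (isCompact_compactCovering X k)

end L2

section Estimates

variable {n : ℕ} {M : Type*} [TopologicalSpace M] [ChartedSpace (EuclideanSpace ℝ (Fin n)) M]
  [IsManifold (𝓡 n) ∞ M] {g : C1Metric n M} {r : M → ℝ} {RS Λ : ℝ} {G : M → ℝ} {α RH : ℝ}

variable [MeasurableSpace M]

/-- The energy of `G` outside of `{r ≤ R}` is at most `α² R⁻²`, for all `R ≥ RH`. -/
def HasEnergyDecay (g : C1Metric n M) (r G : M → ℝ) (α RH : ℝ) : Prop :=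
  ∀ R : ℝ, RH ≤ R → ∫⁻ p in outerRegion r R,
    ENNReal.ofReal (r p ^ (-(n : ℤ)) * normGradSq g G p
      + r p ^ (2 - (n : ℤ)) * radialDeriv g r G p ^ 2) ∂(riemannianVolume (formC1 g))
    ≤ ENNReal.ofReal (α ^ 2 * (R ^ 2)⁻¹)

theorem HasEnergyDecay.lintegral_normGradSq_le (hE : HasEnergyDecay g r G α RH)
    (h : IsWeaklyConicalEnd g r RS Λ) {R : ℝ} (hR : RH ≤ R) :
    ∫⁻ p in outerRegion r R, decayWeight n r p * ENNReal.ofReal (normGradSq g G p)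
      ∂(riemannianVolume (formC1 g)) ≤ ENNReal.ofReal (α ^ 2 * (R ^ 2)⁻¹) := by
  refine le_trans (lintegral_mono fun p => ?_) (hE R hR)
  have hr := h.r_pos p
  rw [decayWeight, ← ENNReal.ofReal_mul (by positivity)]
  exact ENNReal.ofReal_le_ofReal (le_add_of_nonneg_right (by positivity))

variable [BorelSpace M]

/-- The radial part of the energy controls `𝐗 G = r ∂_r G / |∇r|²`, with a constant `κ ≥ |∇r|⁻⁴`. -/
theorem HasEnergyDecay.lintegral_dilationDeriv_le (hE : HasEnergyDecay g r G α RH)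
    (h : IsWeaklyConicalEnd g r RS Λ) {R κ : ℝ} (hR : RH ≤ R) (hκ : 0 ≤ κ)
    (hN : ∀ p ∈ outerRegion r R, 1 ≤ κ * normGradSq g r p ^ 2) :
    ∫⁻ p in outerRegion r R, decayWeight n r p * ENNReal.ofReal (dilationDeriv g r G p ^ 2)
      ∂(riemannianVolume (formC1 g)) ≤ ENNReal.ofReal (κ * α ^ 2 * (R ^ 2)⁻¹) := by
  rw [mul_assoc, ENNReal.ofReal_mul hκ]
  refine le_trans (le_trans
    (setLIntegral_mono' (h.isOpen_outerRegion R).measurableSet fun p hp => ?_)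
    (lintegral_const_mul' (ENNReal.ofReal κ) _ ENNReal.ofReal_ne_top).le)
    (mul_le_mul_right (hE R hR) (ENNReal.ofReal κ))
  have hr := h.r_pos p
  have hNp := h.normGradSq_pos p
  rw [decayWeight, ← ENNReal.ofReal_mul (by positivity), ← ENNReal.ofReal_mul hκ, dilationDeriv_eq]
  refine ENNReal.ofReal_le_ofReal ?_
  have h1 : r p ^ (-(n : ℤ)) * (r p / normGradSq g r p * radialDeriv g r G p) ^ 2 =
      (normGradSq g r p ^ 2)⁻¹ * (r p ^ (2 - (n : ℤ)) * radialDeriv g r G p ^ 2) := by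
    rw [sub_eq_add_neg, zpow_add₀ hr.ne']
    have : r p ^ (2 : ℤ) = r p ^ 2 := by norm_cast
    rw [this]
    field_simp
  have h2 : (normGradSq g r p ^ 2)⁻¹ ≤ κ := by
    rw [inv_le_iff_one_le_mul₀ (by positivity)]
    exact hN p hp
  rw [h1]
  have h3 := inner_self_nonneg g p (grad g G p)
  have h4 : 0 ≤ normGradSq g G p := h3
  refine mul_le_mul h2 (le_add_of_nonneg_left (by positivity)) (by positivity) hκ

variable [T2Space M] [SecondCountableTopology M]

theorem HasEnergyDecay.lintegral_radialEnergy_le (hE : HasEnergyDecay g r G α RH)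
    (h : IsWeaklyConicalEnd g r RS Λ) (hG : ContMDiff (𝓡 n) 𝓘(ℝ, ℝ) 1 G) (hRS : RS ≤ RH)
    {R κ : ℝ} (hR : RH ≤ R) (hκ : 0 ≤ κ)
    (hN : ∀ p ∈ outerRegion r R, 1 ≤ κ * normGradSq g r p ^ 2) :
    ∫⁻ p in outerRegion r R, decayWeight n r p * radialEnergy g r G p
      ∂(riemannianVolume (formC1 g)) ≤ ENNReal.ofReal (Real.exp (18 * n * Λ / R ^ 2)) *
        ENNReal.ofReal (κ * α ^ 2 * (R ^ 2)⁻¹) :=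
  WeaklyConical.lintegral_radialEnergy_le h hG (by linarith [h.one_le_RS]) fun _ hR' =>
    hE.lintegral_dilationDeriv_le h (hR.trans hR') hκ fun p hp => hN p (hR'.trans_lt hp)

/-- The energies along the integral curves after time `t`, integrated over the whole end, decay
exponentially in `t`. -/
theorem HasEnergyDecay.lintegral_flow_le (hE : HasEnergyDecay g r G α RH)
    (h : IsWeaklyConicalEnd g r RS Λ) (hG : ContMDiff (𝓡 n) 𝓘(ℝ, ℝ) 1 G) (hRS : RS ≤ RH)
    {t : ℝ} (ht : 0 ≤ t) (hRH : RH ≤ Real.exp t * RS) :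
    ∫⁻ p, decayWeight n r p * radialEnergy g r G (forwardFlow (radialField g r) t p)
      ∂(riemannianVolume (formC1 g)) ≤ ENNReal.ofReal (Real.exp (18 * n * Λ / RS ^ 2)) *
        (ENNReal.ofReal (Real.exp (18 * n * Λ / RS ^ 2)) *
          ENNReal.ofReal (16 * α ^ 2 * ((Real.exp t * RS) ^ 2)⁻¹)) := by
  have hRS0 : 0 < RS := by linarith [h.one_le_RS]
  have h1 := lintegral_forwardFlow_le h ht hRS0 (measurable_radialEnergy h hG)
  rw [h.outerRegion_eq_univ, Measure.restrict_univ] at h1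
  refine h1.trans (mul_le_mul_right ?_ _)
  -- `|∇r|² ≥ 1/4` on the whole end, hence `κ = 16`
  refine (hE.lintegral_radialEnergy_le h hG hRS hRH (κ := 16) (by norm_num) fun p _ => ?_).trans
    (mul_le_mul_left (ENNReal.ofReal_le_ofReal (Real.exp_le_exp.2 ?_)) _)
  · nlinarith [h.quarter_le_normGradSq p]
  · have h0 := h.nonneg
    refine div_le_div_of_nonneg_left (by positivity) (by positivity) ?_
    exact pow_le_pow_left₀ hRS0.le (le_mul_of_one_le_left hRS0.le (Real.one_le_exp ht)) 2

theorem HasEnergyDecay.tendsto_lintegral_flow (hE : HasEnergyDecay g r G α RH)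
    (h : IsWeaklyConicalEnd g r RS Λ) (hG : ContMDiff (𝓡 n) 𝓘(ℝ, ℝ) 1 G) (hRS : RS ≤ RH) :
    (∀ᶠ t in atTop, ∫⁻ p, decayWeight n r p * radialEnergy g r G (forwardFlow (radialField g r) t p)
      ∂(riemannianVolume (formC1 g)) ≠ ⊤) ∧
    Tendsto (fun t : ℝ => ∫⁻ p, decayWeight n r p *
      ENNReal.ofReal ((G (forwardFlow (radialField g r) t p) - asymptoticLimit g r G p) ^ 2)
        ∂(riemannianVolume (formC1 g))) atTop (𝓝 0) := by
  have hRS0 : 0 < RS := by linarith [h.one_le_RS]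
  have hev : ∀ᶠ t : ℝ in atTop, 0 ≤ t ∧ RH ≤ Real.exp t * RS :=
    (eventually_ge_atTop 0).and
      ((Real.tendsto_exp_atTop.atTop_mul_const hRS0).eventually_ge_atTop RH)
  constructor
  · filter_upwards [hev] with t ht
    refine ne_top_of_le_ne_top ?_ (hE.lintegral_flow_le h hG hRS ht.1 ht.2)
    exact ENNReal.mul_ne_top ENNReal.ofReal_ne_top
      (ENNReal.mul_ne_top ENNReal.ofReal_ne_top ENNReal.ofReal_ne_top)
  · have h1 : Tendsto (fun t : ℝ => 16 * α ^ 2 * ((Real.exp t * RS) ^ 2)⁻¹) atTop (𝓝 0) := by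
      have h2 : Tendsto (fun t : ℝ => (Real.exp t * RS) ^ 2) atTop atTop :=
        (tendsto_pow_atTop two_ne_zero).comp (Real.tendsto_exp_atTop.atTop_mul_const hRS0)
      simpa using h2.inv_tendsto_atTop.const_mul (16 * α ^ 2)
    have h2 := ENNReal.tendsto_ofReal h1
    rw [ENNReal.ofReal_zero] at h2
    have h3 := ENNReal.Tendsto.const_mul (a := ENNReal.ofReal (Real.exp (18 * n * Λ / RS ^ 2)))
      (ENNReal.Tendsto.const_mul (a := ENNReal.ofReal (Real.exp (18 * n * Λ / RS ^ 2))) h2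
        (Or.inr ENNReal.ofReal_ne_top)) (Or.inr ENNReal.ofReal_ne_top)
    rw [mul_zero, mul_zero] at h3
    refine tendsto_of_tendsto_of_tendsto_of_le_of_le' tendsto_const_nhds h3
      (Eventually.of_forall fun _ => zero_le) ?_
    filter_upwards [hev] with t ht
    refine le_trans (lintegral_mono fun p => ?_) (hE.lintegral_flow_le h hG hRS ht.1 ht.2)
    gcongr
    have h4 := ofReal_asymptoticLimit_sub_sq_le h hG (forwardFlow (radialField g r) t p)
    rwa [asymptoticLimit_forwardFlow h ht.1, ← neg_sq, neg_sub] at h4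

/-- `G` converges along almost every integral curve of the radial field. -/
theorem HasEnergyDecay.ae_tendsto (hE : HasEnergyDecay g r G α RH)
    (h : IsWeaklyConicalEnd g r RS Λ) (hG : ContMDiff (𝓡 n) 𝓘(ℝ, ℝ) 1 G) (hRS : RS ≤ RH) :
    ∀ᵐ p ∂(riemannianVolume (formC1 g)),
      Tendsto (fun t : ℝ => G (forwardFlow (radialField g r) t p)) atTop
        (𝓝 (asymptoticLimit g r G p)) := by
  obtain ⟨t, htop, ht⟩ :=
    ((hE.tendsto_lintegral_flow h hG hRS).1.and (eventually_ge_atTop 0)).exists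
  have hm : Measurable fun p => decayWeight n r p *
      radialEnergy g r G (forwardFlow (radialField g r) t p) :=
    (measurable_decayWeight h).mul
      ((measurable_radialEnergy h hG).comp (contMDiff_forwardFlow h ht).continuous.measurable)
  filter_upwards [ae_lt_top hm htop] with p hp
  have hw : decayWeight n r p ≠ 0 := by
    have := h.r_pos p
    rw [decayWeight, ne_eq, ENNReal.ofReal_eq_zero, not_le]
    positivity
  have hq : radialEnergy g r G (forwardFlow (radialField g r) t p) ≠ ⊤ := by
    intro h0
    rw [h0, ENNReal.mul_top hw] at hp
    exact hp.ne rfl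
  have h1 := tendsto_asymptoticLimit h hG hq
  rw [asymptoticLimit_forwardFlow h ht] at h1
  have h2 := h1.comp (tendsto_atTop_add_const_right atTop (-t) tendsto_id)
  refine h2.congr' ?_
  filter_upwards [eventually_ge_atTop t] with s hs
  simp only [Function.comp, id]
  rw [← forwardFlow_add h ht (by linarith)]
  congr 2
  ring

theorem HasEnergyDecay.aemeasurable_asymptoticLimit (hE : HasEnergyDecay g r G α RH)
    (h : IsWeaklyConicalEnd g r RS Λ) (hG : ContMDiff (𝓡 n) 𝓘(ℝ, ℝ) 1 G) (hRS : RS ≤ RH) :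
    AEMeasurable (asymptoticLimit g r G) (riemannianVolume (formC1 g)) := by
  refine aemeasurable_of_tendsto_metrizable_ae atTop
    (f := fun (k : ℕ) p => G (forwardFlow (radialField g r) k p)) (fun k => ?_) ?_
  · exact (hG.continuous.comp
      (contMDiff_forwardFlow h (Nat.cast_nonneg k)).continuous).measurable.aemeasurable
  · filter_upwards [hE.ae_tendsto h hG hRS] with p hp
    exact hp.comp tendsto_natCast_atTop_atTop

/-- The quantitative form of the convergence of `G` to its limit along the radial field. -/
theorem HasEnergyDecay.lintegral_asymptoticLimit_sub_sq_le (hE : HasEnergyDecay g r G α RH)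
    (h : IsWeaklyConicalEnd g r RS Λ) (hG : ContMDiff (𝓡 n) 𝓘(ℝ, ℝ) 1 G) (hRS : RS ≤ RH)
    {R κ : ℝ} (hR : RH ≤ R) (hκ : 0 ≤ κ)
    (hN : ∀ p ∈ outerRegion r R, 1 ≤ κ * normGradSq g r p ^ 2) :
    ∫⁻ p in outerRegion r R,
        ENNReal.ofReal (r p ^ (-(n : ℤ)) * (asymptoticLimit g r G p - G p) ^ 2)
      ∂(riemannianVolume (formC1 g)) ≤
      ENNReal.ofReal (Real.exp (18 * n * Λ / R ^ 2) * κ * α ^ 2 * (R ^ 2)⁻¹) := by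
  have h1 := hE.lintegral_radialEnergy_le h hG hRS hR hκ hN
  rw [← ENNReal.ofReal_mul (Real.exp_pos _).le, ← mul_assoc, ← mul_assoc] at h1
  refine le_trans (lintegral_mono fun p => ?_) h1
  have hr := h.r_pos p
  rw [ENNReal.ofReal_mul (by positivity)]
  exact mul_le_mul_right (ofReal_asymptoticLimit_sub_sq_le h hG p) _

end Estimates

/-! ### The leading term -/

section LeadingTerm

variable {n : ℕ} {M : Type*} [TopologicalSpace M] [ChartedSpace (EuclideanSpace ℝ (Fin n)) M]
  [IsManifold (𝓡 n) ∞ M] {g : C1Metric n M} {r : M → ℝ} {RS Λ : ℝ} {gC : C0Metric n M}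
  {G F F' : M → ℝ} {α RH : ℝ}
  [MeasurableSpace M]

theorem isLeadingTerm_zero_iff : IsLeadingTerm g r gC 0 G F ↔
    MemL2Loc (riemannianVolume (formC1 g)) G ∧
    (MemL2Loc (riemannianVolume (formC0 gC)) F ∧ ∀ τ : ℝ, 1 ≤ τ →
      (fun p => F (dilation g r τ p)) =ᵐ[riemannianVolume (formC0 gC)] F) ∧
    TendstoL2Loc (riemannianVolume (formC0 gC)) (fun τ p => G (dilation g r τ p)) F := by
  simp only [IsLeadingTerm, IsHomogeneousOfDegree, neg_zero, Real.rpow_zero, one_mul]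

theorem tendsto_dilation_iff {μ : Measure M} : TendstoL2Loc μ (fun τ p => G (dilation g r τ p)) F ↔
    ∀ K, IsCompact K → Tendsto (fun t : ℝ => eLpNorm (fun p =>
      G (forwardFlow (radialField g r) t p) - F p) 2 (μ.restrict K)) atTop (𝓝 0) := by
  refine forall₂_congr fun K hK => ⟨fun H => ?_, fun H => ?_⟩
  · have := H.comp Real.tendsto_exp_atTop
    simpa only [Function.comp_def, dilation_exp] using this
  · exact H.comp Real.tendsto_log_atTop

variable [BorelSpace M]

theorem memL2Loc_of_continuous [T2Space M] {μ : Measure M} [IsLocallyFiniteMeasure μ]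
    (hG : Continuous G) :
    MemL2Loc μ G := by
  intro K hK
  obtain ⟨C, hC⟩ := hK.exists_bound_of_continuousOn hG.continuousOn
  have : IsFiniteMeasure (μ.restrict K) := ⟨by
    rw [Measure.restrict_apply_univ]; exact hK.measure_lt_top⟩
  exact MemLp.of_bound hG.measurable.aestronglyMeasurable C
    ((ae_restrict_iff' hK.isClosed.measurableSet).2 (Eventually.of_forall hC))

variable [SecondCountableTopology M]

theorem isLocallyFiniteMeasure_riemannianVolume_formC0 [Nonempty M] (gC : C0Metric n M) :
    IsLocallyFiniteMeasure (riemannianVolume (formC0 gC)) :=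
  isLocallyFiniteMeasure_riemannianVolume (isBilinearAt_formC0 gC)
    fun _ hφ i j => continuousOn_coordMatrix gC hφ i j

theorem sigmaCompactSpace_of_charts (n : ℕ) (M : Type*) [TopologicalSpace M]
    [ChartedSpace (EuclideanSpace ℝ (Fin n)) M] [SecondCountableTopology M] :
    SigmaCompactSpace M := by
  have := ChartedSpace.locallyCompactSpace (EuclideanSpace ℝ (Fin n)) M
  infer_instance

variable [T2Space M]

/-- `μ_C` and `μ_g` are comparable, since `e^{-18} g ≤ g_C ≤ e^{18} g`; this and the next lemma are
the two directions. -/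
theorem coneVolume_le (h : IsWeaklyConicalEnd g r RS Λ) (hC : formC0 gC = coneForm g r) :
    riemannianVolume (formC0 gC) ≤
      ENNReal.ofReal (Real.exp 9 ^ n) • riemannianVolume (formC1 g) := by
  have := h.nonempty
  refine riemannianVolume_le (isInnerField_formC0 gC) (isInnerField_formC1 g) (Real.exp_pos 9).le
    fun p v => ?_
  rw [hC, ← Real.exp_nat_mul]
  norm_num
  exact (coneForm_bounds h p v).1

theorem le_coneVolume (h : IsWeaklyConicalEnd g r RS Λ) (hC : formC0 gC = coneForm g r) :
    riemannianVolume (formC1 g) ≤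
      ENNReal.ofReal (Real.exp 9 ^ n) • riemannianVolume (formC0 gC) := by
  have := h.nonempty
  refine riemannianVolume_le (isInnerField_formC1 g) (isInnerField_formC0 gC) (Real.exp_pos 9).le
    fun p v => ?_
  rw [hC, ← Real.exp_nat_mul]
  norm_num
  have h1 := mul_le_mul_of_nonneg_left (coneForm_bounds h p v).2 (Real.exp_pos 18).le
  rw [← mul_assoc, ← Real.exp_add] at h1
  norm_num at h1
  exact h1

theorem absolutelyContinuous_of_le_smul {X : Type*} [MeasurableSpace X] {μ ν : Measure X}
    {c : ℝ≥0∞}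
    (h : μ ≤ c • ν) : μ ≪ ν :=
  (Measure.absolutelyContinuous_of_le h).trans (Measure.smul_absolutelyContinuous)

/-- On compact sets the norm of `L²(μ_C)` is controlled by the weighted norm of `L²(r⁻ⁿ μ_g)`. -/
theorem exists_eLpNorm_restrict_le (h : IsWeaklyConicalEnd g r RS Λ)
    (hC : formC0 gC = coneForm g r) {K : Set M} (hK : IsCompact K) :
    ∃ B : ℝ≥0∞, B ≠ ⊤ ∧ ∀ f : M → ℝ, eLpNorm f 2 ((riemannianVolume (formC0 gC)).restrict K) ≤
      (B * ∫⁻ p, decayWeight n r p * ENNReal.ofReal (f p ^ 2)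
        ∂(riemannianVolume (formC1 g))) ^ (1 / 2 : ℝ) := by
  obtain ⟨ρ, hρ⟩ := (hK.image h.continuous).bddAbove
  refine ⟨ENNReal.ofReal (Real.exp 9 ^ n) * ENNReal.ofReal (ρ ^ n),
    ENNReal.mul_ne_top ENNReal.ofReal_ne_top ENNReal.ofReal_ne_top, fun f => ?_⟩
  rw [eLpNorm_two_eq]
  refine ENNReal.rpow_le_rpow ?_ (by norm_num)
  have hw : ∀ p ∈ K, 1 ≤ ENNReal.ofReal (ρ ^ n) * decayWeight n r p := by
    intro p hp
    have hr := h.r_pos p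
    have hrρ : r p ≤ ρ := hρ (mem_image_of_mem r hp)
    have hρ0 : 0 < ρ := hr.trans_le hrρ
    rw [decayWeight, ← ENNReal.ofReal_mul (by positivity), ENNReal.one_le_ofReal, zpow_neg,
      zpow_natCast, ← div_eq_mul_inv, one_le_div (by positivity)]
    exact pow_le_pow_left₀ hr.le hrρ n
  calc ∫⁻ p in K, ENNReal.ofReal (f p ^ 2) ∂(riemannianVolume (formC0 gC))
      ≤ ∫⁻ p in K, ENNReal.ofReal (f p ^ 2)
          ∂(ENNReal.ofReal (Real.exp 9 ^ n) • riemannianVolume (formC1 g)) :=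
        lintegral_mono' (Measure.restrict_mono le_rfl (coneVolume_le h hC)) le_rfl
    _ = ENNReal.ofReal (Real.exp 9 ^ n) *
          ∫⁻ p in K, ENNReal.ofReal (f p ^ 2) ∂(riemannianVolume (formC1 g)) := by
        rw [Measure.restrict_smul, lintegral_smul_measure, smul_eq_mul]
    _ ≤ ENNReal.ofReal (Real.exp 9 ^ n) * ∫⁻ p in K, ENNReal.ofReal (ρ ^ n) *
          (decayWeight n r p * ENNReal.ofReal (f p ^ 2)) ∂(riemannianVolume (formC1 g)) := by
        refine mul_le_mul_right ?_ _
        refine setLIntegral_mono' hK.isClosed.measurableSet fun p hp => ?_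
        rw [← mul_assoc]
        exact le_mul_of_one_le_left zero_le (hw p hp)
    _ ≤ ENNReal.ofReal (Real.exp 9 ^ n) * ∫⁻ p, ENNReal.ofReal (ρ ^ n) *
          (decayWeight n r p * ENNReal.ofReal (f p ^ 2)) ∂(riemannianVolume (formC1 g)) := by
        gcongr
        exact Measure.restrict_le_self
    _ = _ := by
        rw [lintegral_const_mul' _ _ ENNReal.ofReal_ne_top, mul_assoc]

theorem HasEnergyDecay.tendstoL2Loc (hE : HasEnergyDecay g r G α RH)
    (h : IsWeaklyConicalEnd g r RS Λ) (hC : formC0 gC = coneForm g r)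
    (hG : ContMDiff (𝓡 n) 𝓘(ℝ, ℝ) 1 G) (hRS : RS ≤ RH) {K : Set M} (hK : IsCompact K) :
    Tendsto (fun t : ℝ => eLpNorm (fun p => G (forwardFlow (radialField g r) t p) -
      asymptoticLimit g r G p) 2 ((riemannianVolume (formC0 gC)).restrict K)) atTop (𝓝 0) := by
  obtain ⟨B, hB, hle⟩ := exists_eLpNorm_restrict_le h hC hK
  have h1 := (ENNReal.Tendsto.const_mul (hE.tendsto_lintegral_flow h hG hRS).2
    (Or.inr hB)).ennrpow_const (1 / 2)
  rw [mul_zero, ENNReal.zero_rpow_of_pos (by norm_num)] at h1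
  exact tendsto_of_tendsto_of_tendsto_of_le_of_le tendsto_const_nhds h1 (fun _ => zero_le)
    fun t => hle _

/-- The pointwise limit of `G` along the radial field is a leading term of `G`. -/
theorem HasEnergyDecay.isLeadingTerm (hE : HasEnergyDecay g r G α RH)
    (h : IsWeaklyConicalEnd g r RS Λ) (hC : formC0 gC = coneForm g r)
    (hG : ContMDiff (𝓡 n) 𝓘(ℝ, ℝ) 1 G) (hRS : RS ≤ RH) :
    IsLeadingTerm g r gC 0 G (asymptoticLimit g r G) := by
  have := h.nonempty
  have := isLocallyFiniteMeasure_riemannianVolume_formC1 g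
  have := isLocallyFiniteMeasure_riemannianVolume_formC0 gC
  rw [isLeadingTerm_zero_iff]
  refine ⟨memL2Loc_of_continuous hG.continuous, ⟨fun K hK => ?_, fun τ hτ => ?_⟩,
    tendsto_dilation_iff.2 fun K hK => hE.tendstoL2Loc h hC hG hRS hK⟩
  -- the limit is in `L²_loc` because it differs from some `G ∘ Π` by a function in `L²_loc`
  · obtain ⟨t, hlt, ht⟩ := (((hE.tendstoL2Loc h hC hG hRS hK).eventually
      (gt_mem_nhds one_pos)).and (eventually_ge_atTop 0)).exists
    have hF : AEStronglyMeasurable (asymptoticLimit g r G)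
        ((riemannianVolume (formC0 gC)).restrict K) :=
      (((hE.aemeasurable_asymptoticLimit h hG hRS).mono_ac (absolutelyContinuous_of_le_smul
        (coneVolume_le h hC))).mono_measure Measure.restrict_le_self).aestronglyMeasurable
    have hGt := memL2Loc_of_continuous (μ := riemannianVolume (formC0 gC))
      (hG.continuous.comp (contMDiff_forwardFlow h ht).continuous) K hK
    have h1 : MemLp (fun p => G (forwardFlow (radialField g r) t p) - asymptoticLimit g r G p) 2
        ((riemannianVolume (formC0 gC)).restrict K) :=
      ⟨hGt.1.sub hF, hlt.trans ENNReal.one_lt_top⟩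
    refine (hGt.sub h1).congr_norm hF (Eventually.of_forall fun p => ?_)
    simp
  · exact Eventually.of_forall fun p => asymptoticLimit_forwardFlow h (Real.log_nonneg hτ) p

/-- The leading term is unique, as a limit in `L²_loc`. -/
theorem ae_eq_of_isLeadingTerm (h : IsWeaklyConicalEnd g r RS Λ)
    (hC : formC0 gC = coneForm g r) (hG : ContMDiff (𝓡 n) 𝓘(ℝ, ℝ) 1 G)
    (hF : IsLeadingTerm g r gC 0 G F) (hF' : IsLeadingTerm g r gC 0 G F') :
    F =ᵐ[riemannianVolume (formC1 g)] F' := by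
  have := h.nonempty
  have := isLocallyFiniteMeasure_riemannianVolume_formC0 gC
  have := sigmaCompactSpace_of_charts n M
  rw [isLeadingTerm_zero_iff, tendsto_dilation_iff] at hF hF'
  refine (absolutelyContinuous_of_le_smul (le_coneVolume h hC)).ae_eq
    (ae_of_forall_isCompact fun K hK => ?_)
  set μ := (riemannianVolume (formC0 gC)).restrict K
  have hm := hF.2.1.1 K hK
  have hm' := hF'.2.1.1 K hK
  have h0 : eLpNorm (fun p => F p - F' p) 2 μ = 0 := by
    have h1 := (hF.2.2 K hK).add (hF'.2.2 K hK)
    rw [add_zero] at h1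
    refine le_antisymm (ge_of_tendsto h1 ?_) zero_le
    filter_upwards [eventually_ge_atTop 0] with t ht
    have hGt := memL2Loc_of_continuous (μ := riemannianVolume (formC0 gC))
      (hG.continuous.comp (contMDiff_forwardFlow h ht).continuous) K hK
    have h2 := eLpNorm_sub_le (p := 2) (hGt.1.sub hm'.1) (hGt.1.sub hm.1) (by norm_num)
    rw [add_comm]
    refine le_trans (le_of_eq ?_) h2
    congr 1
    ext p
    simp
  filter_upwards [(eLpNorm_eq_zero_iff (hm.1.sub hm'.1) (by norm_num)).1 h0] with p hp
  exact sub_eq_zero.1 hp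

end LeadingTerm

/-! ### Weak derivatives of limits -/

section WeakLimits

/-- A bounded sequence in a Hilbert space converges weakly along some ultrafilter. -/
theorem exists_weak_limit {H : Type*} [NormedAddCommGroup H] [InnerProductSpace ℝ H]
    [CompleteSpace H] {v : ℕ → H} {C : ℝ} (hv : ∀ k, ‖v k‖ ≤ C) :
    ∃ v₀ : H, ∀ u : H, Tendsto (fun k => inner ℝ (v k) u) (hyperfilter ℕ) (𝓝 (inner ℝ v₀ u)) := by
  let T : ℕ → WeakDual ℝ H := fun k => StrongDual.toWeakDual (InnerProductSpace.toDual ℝ H (v k))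
  obtain ⟨x, -, hx⟩ := (WeakDual.isCompact_closedBall (𝕜 := ℝ) (E := H) 0 C).ultrafilter_le_nhds
    ((hyperfilter ℕ).map T) (by
      rw [Ultrafilter.coe_map, le_principal_iff, mem_map]
      refine Eventually.of_forall fun k => ?_
      change InnerProductSpace.toDual ℝ H (v k) ∈ Metric.closedBall 0 C
      rw [mem_closedBall_zero_iff, LinearIsometryEquiv.norm_map]
      exact hv k)
  refine ⟨(InnerProductSpace.toDual ℝ H).symm (WeakDual.toStrongDual x), fun u => ?_⟩
  rw [InnerProductSpace.toDual_symm_apply]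
  exact ((WeakDual.eval_continuous u).tendsto x).comp hx

variable {n : ℕ} {U : Set (EuclideanSpace ℝ (Fin n))} {i : Fin n}
  {ψ : EuclideanSpace ℝ (Fin n) → ℝ}

theorem continuous_mul_of_tsupport_subset {X : Type*} [TopologicalSpace X] {U : Set X}
    (hU : IsOpen U) {a b : X → ℝ} (ha : ContinuousOn a U) (hb : Continuous b)
    (hbU : tsupport b ⊆ U) : Continuous fun x => a x * b x :=
  continuous_of_tsupport fun _ hx =>
    (ha.continuousAt (hU.mem_nhds (hbU (tsupport_mul_subset_right hx)))).mul hb.continuousAt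

theorem hasCompactSupport_partialDeriv (hψs : HasCompactSupport ψ) :
    HasCompactSupport (partialDeriv i ψ) := hψs.fderiv_apply (𝕜 := ℝ) _

theorem tsupport_partialDeriv_subset : tsupport (partialDeriv i ψ) ⊆ tsupport ψ :=
  tsupport_fderiv_apply_subset ℝ _

theorem continuous_partialDeriv (hψ : ContDiff ℝ ∞ ψ) : Continuous (partialDeriv i ψ) :=
  (hψ.continuous_fderiv (by simp)).clm_apply continuous_const

theorem continuousOn_partialDeriv (hU : IsOpen U) {f : EuclideanSpace ℝ (Fin n) → ℝ}
    (hf : ContDiffOn ℝ 1 f U) : ContinuousOn (partialDeriv i f) U :=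
  (hf.continuousOn_fderiv_of_isOpen hU le_rfl).clm_apply continuousOn_const

theorem integral_eq_setIntegral_of_tsupport {f : EuclideanSpace ℝ (Fin n) → ℝ}
    {K : Set (EuclideanSpace ℝ (Fin n))} (hK : tsupport ψ ⊆ K) :
    ∫ x in K, f x * ψ x = ∫ x, f x * ψ x := by
  refine setIntegral_eq_integral_of_forall_compl_eq_zero fun x hx => ?_
  rw [image_eq_zero_of_notMem_tsupport fun h => hx (hK h), mul_zero]

theorem integral_mul_partialDeriv (hU : IsOpen U) {f : EuclideanSpace ℝ (Fin n) → ℝ}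
    (hf : ContDiffOn ℝ 1 f U) (hψ : ContDiff ℝ ∞ ψ) (hψs : HasCompactSupport ψ)
    (hψU : tsupport ψ ⊆ U) :
    ∫ x in U, f x * partialDeriv i ψ x = -∫ x in U, partialDeriv i f x * ψ x := by
  rw [integral_eq_setIntegral_of_tsupport hψU,
    integral_eq_setIntegral_of_tsupport (tsupport_partialDeriv_subset.trans hψU)]
  refine integral_mul_fderiv_eq_neg_fderiv_mul_of_integrable
    (Continuous.integrable_of_hasCompactSupport ?_ hψs.mul_left)
    (Continuous.integrable_of_hasCompactSupport ?_ (hasCompactSupport_partialDeriv hψs).mul_left)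
    (Continuous.integrable_of_hasCompactSupport ?_ hψs.mul_left)
    (fun x hx => ?_) fun x _ => hψ.differentiable (by simp) x
  · exact continuous_mul_of_tsupport_subset hU (continuousOn_partialDeriv hU hf) hψ.continuous hψU
  · exact continuous_mul_of_tsupport_subset hU hf.continuousOn (continuous_partialDeriv hψ)
      (tsupport_partialDeriv_subset.trans hψU)
  · exact continuous_mul_of_tsupport_subset hU hf.continuousOn hψ.continuous hψU
  · exact (hf.contDiffAt (hU.mem_nhds (hψU hx))).differentiableAt one_ne_zero

/-- Convergence in `L²` on the support of a test function implies convergence of the pairings. -/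
theorem tendsto_setIntegral_mul {f : ℕ → EuclideanSpace ℝ (Fin n) → ℝ}
    {f₀ : EuclideanSpace ℝ (Fin n) → ℝ} {K : Set (EuclideanSpace ℝ (Fin n))} (hK : IsCompact K)
    (hf : ∀ k, MemLp (f k) 2 (volume.restrict K)) (hf₀ : MemLp f₀ 2 (volume.restrict K))
    (hlim : Tendsto (fun k => eLpNorm (f k - f₀) 2 (volume.restrict K)) atTop (𝓝 0))
    (hψ : Continuous ψ) :
    Tendsto (fun k => ∫ x in K, f k x * ψ x) atTop (𝓝 (∫ x in K, f₀ x * ψ x)) := by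
  obtain ⟨C, hC⟩ := hK.exists_bound_of_continuousOn hψ.continuousOn
  have hfin : IsFiniteMeasure (volume.restrict K) := ⟨by
    rw [Measure.restrict_apply_univ]; exact hK.measure_lt_top⟩
  have hCae : ∀ᵐ x ∂(volume.restrict K), ‖ψ x‖ ≤ C :=
    (ae_restrict_iff' hK.measurableSet).2 (Eventually.of_forall hC)
  have hm : ∀ u : EuclideanSpace ℝ (Fin n) → ℝ, AEStronglyMeasurable u (volume.restrict K) →
      eLpNorm (fun x => u x * ψ x) 1 (volume.restrict K) ≤ ENNReal.ofReal C *
        (eLpNorm u 2 (volume.restrict K) * volume K ^ (1 / 2 : ℝ)) := by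
    intro u hu
    refine (eLpNorm_le_mul_eLpNorm_of_ae_le_mul (c := C) (g := u) ?_ 1).trans ?_
    · filter_upwards [hCae] with x hx
      rw [norm_mul, mul_comm]
      exact mul_le_mul_of_nonneg_right hx (norm_nonneg _)
    · refine mul_le_mul_right ?_ _
      have := eLpNorm_le_eLpNorm_mul_rpow_measure_univ (p := 1) (q := 2) (by norm_num) hu
      rw [Measure.restrict_apply_univ] at this
      norm_num at this ⊢
      exact this
  have hKfin : volume K ^ (1 / 2 : ℝ) ≠ ⊤ :=
    ENNReal.rpow_ne_top_of_nonneg (by norm_num) hK.measure_lt_top.ne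
  have hi : ∀ u : EuclideanSpace ℝ (Fin n) → ℝ, MemLp u 2 (volume.restrict K) →
      Integrable (fun x => u x * ψ x) (volume.restrict K) := by
    intro u hu
    exact (hu.integrable (by norm_num)).mul_bdd hψ.aestronglyMeasurable hCae
  refine tendsto_integral_of_L1' _ (hi f₀ hf₀).1 (Eventually.of_forall fun k => hi _ (hf k)) ?_
  have h1 := ENNReal.Tendsto.const_mul (ENNReal.Tendsto.mul_const hlim (Or.inr hKfin))
    (Or.inr (ENNReal.ofReal_ne_top (r := C)))
  rw [zero_mul, mul_zero] at h1
  refine tendsto_of_tendsto_of_tendsto_of_le_of_le tendsto_const_nhds h1 (fun _ => zero_le)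
    fun k => ?_
  refine le_trans (le_of_eq ?_) (hm _ ((hf k).1.sub hf₀.1))
  congr 1
  ext x
  simp [sub_mul]

/-- The limit in `L²_loc` of `C¹` functions whose partial derivatives are bounded in a weighted
`L²` space has a weak partial derivative in `L²_loc`. -/
theorem exists_weakDeriv_of_bounded (hU : IsOpen U) {f : ℕ → EuclideanSpace ℝ (Fin n) → ℝ}
    {f₀ σ : EuclideanSpace ℝ (Fin n) → ℝ} (hf : ∀ k, ContDiffOn ℝ 1 (f k) U)
    (hf₀ : ∀ K ⊆ U, IsCompact K → MemLp f₀ 2 (volume.restrict K))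
    (hlim : ∀ K ⊆ U, IsCompact K →
      Tendsto (fun k => eLpNorm (f k - f₀) 2 (volume.restrict K)) atTop (𝓝 0))
    (hσ : ContinuousOn σ U) (hσ0 : ∀ x ∈ U, 0 < σ x) {B : ℝ≥0∞} (hB : B ≠ ⊤)
    (hbound : ∀ k, ∫⁻ x in U, ENNReal.ofReal (σ x * partialDeriv i (f k) x ^ 2) ≤ B) :
    ∃ w : EuclideanSpace ℝ (Fin n) → ℝ,
      (∀ K ⊆ U, IsCompact K → MemLp w 2 (volume.restrict K)) ∧
      ∀ ψ : EuclideanSpace ℝ (Fin n) → ℝ, ContDiff ℝ ∞ ψ → HasCompactSupport ψ →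
        tsupport ψ ⊆ U → ∫ x in U, f₀ x * partialDeriv i ψ x = -∫ x in U, w x * ψ x := by
  have hUm := hU.measurableSet
  have hs : ContinuousOn (fun x => √(σ x)) U := hσ.sqrt
  have hs0 : ∀ x ∈ U, 0 < √(σ x) := fun x hx => Real.sqrt_pos.2 (hσ0 x hx)
  have hsi : ContinuousOn (fun x => (√(σ x))⁻¹) U := hs.inv₀ fun x hx => (hs0 x hx).ne'
  have hB' : B ^ (1 / 2 : ℝ) ≠ ⊤ := ENNReal.rpow_ne_top_of_nonneg (by norm_num) hB
  -- The functions `√σ ∂ᵢ f_k` are bounded in `L²(U)`. If `v₀` is a weak limit of them, then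
  -- `v₀ / √σ` is the weak derivative of `f₀`.
  have hnorm : ∀ k, eLpNorm (fun x => √(σ x) * partialDeriv i (f k) x) 2 (volume.restrict U)
      ≤ B ^ (1 / 2 : ℝ) := by
    intro k
    rw [eLpNorm_two_eq]
    refine ENNReal.rpow_le_rpow (le_trans (le_of_eq ?_) (hbound k)) (by norm_num)
    refine setLIntegral_congr_fun hUm fun x hx => ?_
    rw [mul_pow, Real.sq_sqrt (hσ0 x hx).le]
  have hv : ∀ k, MemLp (fun x => √(σ x) * partialDeriv i (f k) x) 2 (volume.restrict U) :=
    fun k => ⟨(hs.mul (continuousOn_partialDeriv hU (hf k))).aestronglyMeasurable hUm,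
      (hnorm k).trans_lt hB'.lt_top⟩
  obtain ⟨v₀, hv₀⟩ := exists_weak_limit (v := fun k => (hv k).toLp) (C := (B ^ (1 / 2 : ℝ)).toReal)
    fun k => by
      rw [Lp.norm_toLp]
      exact ENNReal.toReal_mono hB' (hnorm k)
  refine ⟨fun x => (√(σ x))⁻¹ * v₀ x, fun K hKU hK => ?_, fun ψ hψ hψs hψU => ?_⟩
  · obtain ⟨C, hC⟩ := hK.exists_bound_of_continuousOn (hsi.mono hKU)
    have hv₀K : MemLp v₀ 2 (volume.restrict K) :=
      (Lp.memLp v₀).mono_measure (Measure.restrict_mono hKU le_rfl)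
    refine hv₀K.of_le_mul (c := C)
      (((hsi.mono hKU).aestronglyMeasurable hK.measurableSet).mul hv₀K.1) ?_
    refine (ae_restrict_iff' hK.measurableSet).2 (Eventually.of_forall fun x hx => ?_)
    rw [norm_mul]
    exact mul_le_mul_of_nonneg_right (hC x hx) (norm_nonneg _)
  -- the identity for `f₀` is the limit of integration by parts for `f_k`
  · have hK : IsCompact (tsupport ψ) := hψs
    have hL : Tendsto (fun k => ∫ x in U, f k x * partialDeriv i ψ x) atTop
        (𝓝 (∫ x in U, f₀ x * partialDeriv i ψ x)) := by
      have h1 := tendsto_setIntegral_mul (ψ := partialDeriv i ψ) hK (fun k => ?_) (hf₀ _ hψU hK)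
        (hlim _ hψU hK) (continuous_partialDeriv hψ)
      · simpa only [integral_eq_setIntegral_of_tsupport (tsupport_partialDeriv_subset.trans hψU),
          integral_eq_setIntegral_of_tsupport (tsupport_partialDeriv_subset (ψ := ψ) (i := i))]
          using h1
      · obtain ⟨C, hC⟩ := hK.exists_bound_of_continuousOn ((hf k).continuousOn.mono hψU)
        have : IsFiniteMeasure (volume.restrict (tsupport ψ)) := ⟨by
          rw [Measure.restrict_apply_univ]; exact hK.measure_lt_top⟩
        exact MemLp.of_bound (((hf k).continuousOn.mono hψU).aestronglyMeasurable hK.measurableSet)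
          C ((ae_restrict_iff' hK.measurableSet).2 (Eventually.of_forall hC))
    have hu : MemLp (fun x => (√(σ x))⁻¹ * ψ x) 2 (volume.restrict U) :=
      ((continuous_mul_of_tsupport_subset hU hsi hψ.continuous hψU).memLp_of_hasCompactSupport
        hψs.mul_left).mono_measure Measure.restrict_le_self
    have hin : ∀ (z : Lp ℝ 2 (volume.restrict U)) (a : EuclideanSpace ℝ (Fin n) → ℝ),
        z =ᵐ[volume.restrict U] a →
        inner ℝ z hu.toLp = ∫ x in U, a x * ((√(σ x))⁻¹ * ψ x) := by
      intro z a hza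
      rw [L2.inner_def]
      refine integral_congr_ae ?_
      filter_upwards [hza, hu.coeFn_toLp] with x hx hux
      rw [hx, hux]
      simp [mul_comm]
    have hR := (hv₀ hu.toLp).neg
    refine tendsto_nhds_unique (hL.mono_left Nat.hyperfilter_le_atTop) ?_
    convert hR using 1
    · ext k
      rw [integral_mul_partialDeriv hU (hf k) hψ hψs hψU, hin _ _ (hv k).coeFn_toLp]
      congr 1
      refine setIntegral_congr_fun hUm fun x hx => ?_
      have := (hs0 x hx).ne'
      field_simp
    · rw [hin _ _ (EventuallyEq.refl _ _)]
      congr 2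
      refine setIntegral_congr_fun hUm fun x hx => ?_
      dsimp only
      ring

end WeakLimits

/-! ### Sobolev regularity of the leading term -/

section Sobolev

variable {n : ℕ} {M : Type*} [TopologicalSpace M] [ChartedSpace (EuclideanSpace ℝ (Fin n)) M]
  [IsManifold (𝓡 n) ∞ M] {g : C1Metric n M} {r : M → ℝ} {RS Λ : ℝ} {gC : C0Metric n M}
  {G F : M → ℝ} {α RH t : ℝ} {φ : OpenPartialHomeomorph M (EuclideanSpace ℝ (Fin n))}
  [T2Space M]

theorem differential_comp_forwardFlow_sq_le (h : IsWeaklyConicalEnd g r RS Λ) (ht : 0 ≤ t)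
    (hG : ContMDiff (𝓡 n) 𝓘(ℝ, ℝ) 1 G) (p : M) (v : TangentSpace (𝓡 n) p) :
    differential (G ∘ forwardFlow (radialField g r) t) p v ^ 2 ≤ Real.exp (2 * t + 18) *
      normGradSq g G (forwardFlow (radialField g r) t p) * g.inner p v v := by
  set Φ := forwardFlow (radialField g r) t with hΦ
  have hd : differential (G ∘ Φ) p v = differential G (Φ p) (mfderiv (𝓡 n) (𝓡 n) Φ p v) :=
    congrArg (fun L => L v) (mfderiv_comp p (hG.mdifferentiable (by simp) (Φ p))
      ((contMDiff_forwardFlow h ht).mdifferentiable (by simp) p))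
  have hN : 0 ≤ normGradSq g G (Φ p) := inner_self_nonneg g _ _
  have h1 := (rescaledPullback_bounds h ht p v).1
  rw [rescaledPullback_exp t p v v, ← hΦ] at h1
  have h2 : Real.exp (36 * Λ / r p ^ 2) ≤ Real.exp 18 := Real.exp_le_exp.2 (h.exponent_le p)
  have h3 := inner_self_nonneg g p v
  have h4 := h1.trans (mul_le_mul_of_nonneg_right h2 h3)
  rw [hd]
  refine (differential_sq_le g G _ _).trans ?_
  rw [mul_comm (Real.exp _), mul_assoc]
  refine mul_le_mul_of_nonneg_left ?_ hN
  rw [Real.exp_add, mul_assoc]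
  refine le_trans (le_of_eq ?_) (mul_le_mul_of_nonneg_left h4 (Real.exp_pos (2 * t)).le)
  rw [← mul_assoc, ← Real.exp_add]
  simp

variable [MeasurableSpace M] [BorelSpace M] [SecondCountableTopology M]

/-- On a compact subset of the target of a chart, Lebesgue measure is at most a multiple of the
Riemannian measure. -/
theorem exists_map_volume_le [Nonempty M] (gC : C0Metric n M)
    (hφ : φ ∈ IsManifold.maximalAtlas (𝓡 n) ∞ M) {K : Set (EuclideanSpace ℝ (Fin n))}
    (hKφ : K ⊆ φ.target) (hK : IsCompact K) :
    ∃ c : ℝ≥0∞, c ≠ ⊤ ∧ (volume.restrict K).map φ.symm ≤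
      c • (riemannianVolume (formC0 gC)).restrict (φ.symm '' K) := by
  have hβ := isInnerField_formC0 gC
  have hc := (continuousOn_chartDensity fun i j => continuousOn_coordMatrix gC hφ i j).mono hKφ
  have hpos : ∀ x ∈ K, 0 < chartDensity (formC0 gC) φ x := fun x hx =>
    hβ.chartDensity_pos hφ (hKφ hx)
  obtain ⟨c, hcb⟩ := hK.exists_bound_of_continuousOn (hc.inv₀ fun x hx => (hpos x hx).ne')
  refine ⟨ENNReal.ofReal c, ENNReal.ofReal_ne_top, Measure.le_iff.2 fun A hA => ?_⟩
  have hm : AEMeasurable φ.symm (volume.restrict K) :=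
    (φ.symm.continuousOn.mono hKφ).aemeasurable hK.measurableSet
  have hS : MeasurableSet (φ.symm '' K) :=
    (hK.image_of_continuousOn (φ.symm.continuousOn.mono hKφ)).isClosed.measurableSet
  have hsub : φ.symm '' K ⊆ φ.source := by
    rintro _ ⟨x, hx, rfl⟩
    exact φ.map_target (hKφ hx)
  rw [Measure.smul_apply, Measure.restrict_apply hA, smul_eq_mul,
    riemannianVolume_eq_chartVolume hβ.bilin hφ (hA.inter hS) (inter_subset_right.trans hsub),
    chartVolume_apply _ _ (hA.inter hS), ← lintegral_const_mul' _ _ ENNReal.ofReal_ne_top]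
  have hT := measurableSet_target_inter φ (hA.inter hS)
  have hle : ∀ x ∈ φ.target ∩ φ.symm ⁻¹' (A ∩ φ.symm '' K),
      1 ≤ ENNReal.ofReal c * ENNReal.ofReal (chartDensity (formC0 gC) φ x) := by
    rintro x ⟨hx, -, y, hy, hxy⟩
    obtain rfl : y = x := φ.symm.injOn (hKφ hy) hx hxy
    have h1 := hcb y hy
    have h2 := hpos y hy
    rw [Pi.inv_apply, norm_inv, Real.norm_of_nonneg h2.le] at h1
    rw [← ENNReal.ofReal_mul ((inv_pos.2 h2).le.trans h1), ENNReal.one_le_ofReal]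
    exact (inv_le_iff_one_le_mul₀ h2).1 h1
  calc (volume.restrict K).map φ.symm A = (volume.restrict K) (φ.symm ⁻¹' A) :=
        Measure.map_apply_of_aemeasurable hm hA
    _ = volume (φ.symm ⁻¹' A ∩ K) := Measure.restrict_apply' hK.measurableSet
    _ ≤ volume (φ.target ∩ φ.symm ⁻¹' (A ∩ φ.symm '' K)) :=
        measure_mono fun x hx => ⟨hKφ hx.2, hx.1, mem_image_of_mem _ hx.2⟩
    _ = ∫⁻ x in φ.target ∩ φ.symm ⁻¹' (A ∩ φ.symm '' K), 1 := (setLIntegral_one _).symm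
    _ ≤ _ := setLIntegral_mono' hT hle

theorem exists_eLpNorm_comp_symm_le [Nonempty M] (gC : C0Metric n M)
    (hφ : φ ∈ IsManifold.maximalAtlas (𝓡 n) ∞ M) {K : Set (EuclideanSpace ℝ (Fin n))}
    (hKφ : K ⊆ φ.target) (hK : IsCompact K) :
    ∃ c : ℝ≥0∞, c ≠ ⊤ ∧ ∀ u : M → ℝ,
      MemLp u 2 ((riemannianVolume (formC0 gC)).restrict (φ.symm '' K)) →
      MemLp (u ∘ φ.symm) 2 (volume.restrict K) ∧ eLpNorm (u ∘ φ.symm) 2 (volume.restrict K) ≤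
        c * eLpNorm u 2 ((riemannianVolume (formC0 gC)).restrict (φ.symm '' K)) := by
  obtain ⟨c, hc, hle⟩ := exists_map_volume_le gC hφ hKφ hK
  have hm : AEMeasurable φ.symm (volume.restrict K) :=
    (φ.symm.continuousOn.mono hKφ).aemeasurable hK.measurableSet
  refine ⟨c ^ (1 / (2 : ℝ≥0∞)).toReal, ENNReal.rpow_ne_top_of_nonneg (by positivity) hc,
    fun u hu => ?_⟩
  have hu' := hu.of_measure_le_smul hc hle
  refine ⟨hu'.comp_of_map hm, ?_⟩
  rw [← eLpNorm_map_measure hu'.1 hm]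
  refine (eLpNorm_mono_measure u hle).trans (le_of_eq ?_)
  rw [eLpNorm_smul_measure_of_ne_top (by simp), smul_eq_mul]

/-- The functions `G ∘ Π` have bounded Dirichlet energy in each chart: `r⁻ⁿ dμ_g` is almost
invariant under the flow, and the factor `e^{2t}` by which the flow increases `|∇(G ∘ Π)|²` is
compensated by the decay of the energy of `G`. -/
theorem HasEnergyDecay.lintegral_partialDeriv_le (hE : HasEnergyDecay g r G α RH)
    (h : IsWeaklyConicalEnd g r RS Λ) (hG : ContMDiff (𝓡 n) 𝓘(ℝ, ℝ) 1 G)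
    (hφ : φ ∈ IsManifold.maximalAtlas (𝓡 n) ∞ M) (i : Fin n) (ht : 0 ≤ t)
    (htR : RH ≤ Real.exp t * RS) :
    ∫⁻ x in φ.target, ENNReal.ofReal (r (φ.symm x) ^ (-(n : ℤ)) * chartDensity (formC1 g) φ x /
        coordMatrix (formC1 g) φ x i i *
        partialDeriv i ((G ∘ forwardFlow (radialField g r) t) ∘ φ.symm) x ^ 2) ≤
      ENNReal.ofReal (Real.exp 18 * Real.exp (18 * n * Λ / RS ^ 2) * (α ^ 2 * (RS ^ 2)⁻¹)) := by
  have := h.nonempty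
  have hRS : 0 < RS := one_pos.trans_le h.one_le_RS
  set Φ := forwardFlow (radialField g r) t with hΦ
  set N : M → ℝ≥0∞ := fun p => ENNReal.ofReal (normGradSq g G p) with hN
  have hNm : Measurable N := (continuous_normGradSq g hG).measurable.ennreal_ofReal
  have hΦm : Measurable Φ := (contMDiff_forwardFlow h ht).continuous.measurable
  have hβ := isInnerField_formC1 g
  have hpt : ∀ x ∈ φ.target, ENNReal.ofReal (r (φ.symm x) ^ (-(n : ℤ)) *
        chartDensity (formC1 g) φ x / coordMatrix (formC1 g) φ x i i *
        partialDeriv i ((G ∘ Φ) ∘ φ.symm) x ^ 2) ≤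
      ENNReal.ofReal (Real.exp (2 * t + 18)) * (ENNReal.ofReal (chartDensity (formC1 g) φ x) *
        (decayWeight n r (φ.symm x) * N (Φ (φ.symm x)))) := by
    intro x hx
    have hr := h.r_pos (φ.symm x)
    have hd := hβ.chartDensity_pos hφ hx
    have hii : 0 < coordMatrix (formC1 g) φ x i i := (hβ.posDef hφ hx).diag_pos
    have h1 := differential_comp_forwardFlow_sq_le h ht hG (φ.symm x)
      (coordVector φ x (EuclideanSpace.single i 1))
    rw [differential_coordVector hφ hx
      ((hG.comp (contMDiff_forwardFlow h ht)).mdifferentiable (by simp) _), ← hΦ] at h1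
    have h2 : partialDeriv i ((G ∘ Φ) ∘ φ.symm) x ^ 2 ≤ Real.exp (2 * t + 18) *
      normGradSq g G (Φ (φ.symm x)) * coordMatrix (formC1 g) φ x i i := h1
    rw [decayWeight, hN, ← ENNReal.ofReal_mul (by positivity), ← ENNReal.ofReal_mul hd.le,
      ← ENNReal.ofReal_mul (by positivity)]
    refine ENNReal.ofReal_le_ofReal ?_
    refine (mul_le_mul_of_nonneg_left h2 (by positivity)).trans (le_of_eq ?_)
    field_simp
  calc _ ≤ ∫⁻ x in φ.target, ENNReal.ofReal (Real.exp (2 * t + 18)) *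
          (ENNReal.ofReal (chartDensity (formC1 g) φ x) *
          (decayWeight n r (φ.symm x) * N (Φ (φ.symm x)))) :=
        setLIntegral_mono' φ.open_target.measurableSet hpt
    _ = ENNReal.ofReal (Real.exp (2 * t + 18)) * ∫⁻ p in φ.source, decayWeight n r p * N (Φ p)
          ∂(riemannianVolume (formC1 g)) := by
        rw [lintegral_const_mul' _ _ ENNReal.ofReal_ne_top, lintegral_chart hβ hφ
          (fun i j => (contDiffOn_coordMatrix g hφ i j).continuousOn)
          (f := fun p => decayWeight n r p * N (Φ p))
          ((measurable_decayWeight h).mul (hNm.comp hΦm))]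
    _ ≤ ENNReal.ofReal (Real.exp (2 * t + 18)) * ∫⁻ p in outerRegion r RS,
          decayWeight n r p * N (Φ p) ∂(riemannianVolume (formC1 g)) := by
        refine mul_le_mul_right (lintegral_mono_set ?_) _
        rw [h.outerRegion_eq_univ]
        exact subset_univ _
    _ ≤ ENNReal.ofReal (Real.exp (2 * t + 18)) * (ENNReal.ofReal (Real.exp (18 * n * Λ / RS ^ 2)) *
          ENNReal.ofReal (α ^ 2 * ((Real.exp t * RS) ^ 2)⁻¹)) :=
        mul_le_mul_right ((lintegral_forwardFlow_le h ht hRS hNm).trans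
          (mul_le_mul_right (hE.lintegral_normGradSq_le h htR) _)) _
    _ = _ := by
        rw [← ENNReal.ofReal_mul (by positivity), ← ENNReal.ofReal_mul (by positivity)]
        congr 1
        have h1 : Real.exp (2 * t + 18) = Real.exp 18 * Real.exp t ^ 2 := by
          rw [← Real.exp_nat_mul, ← Real.exp_add]
          push_cast
          ring_nf
        rw [h1, mul_pow]
        have := Real.exp_pos t
        field_simp

/-- A leading term of `G` lies in `H¹_loc`: it is the limit of the functions `G ∘ Π_τ`, whose
Dirichlet energies are bounded by the decay of the energy of `G`. -/
theorem HasEnergyDecay.memH1Loc (hE : HasEnergyDecay g r G α RH)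
    (h : IsWeaklyConicalEnd g r RS Λ) (hG : ContMDiff (𝓡 n) 𝓘(ℝ, ℝ) 1 G) (hRS : RS ≤ RH)
    (hF : IsLeadingTerm g r gC 0 G F) : MemH1Loc n F := by
  have := h.nonempty
  have := isLocallyFiniteMeasure_riemannianVolume_formC0 gC
  rw [isLeadingTerm_zero_iff, tendsto_dilation_iff] at hF
  obtain ⟨-, ⟨hF2, -⟩, hlim⟩ := hF
  intro φ hφ
  have hcomp : ∀ K ⊆ φ.target, IsCompact K → IsCompact (φ.symm '' K) := fun K hKφ hK =>
    hK.image_of_continuousOn (φ.symm.continuousOn.mono hKφ)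
  have hF0 : ∀ K ⊆ φ.target, IsCompact K → MemLp (F ∘ φ.symm) 2 (volume.restrict K) := by
    intro K hKφ hK
    obtain ⟨c, -, hc⟩ := exists_eLpNorm_comp_symm_le gC hφ hKφ hK
    exact (hc F (hF2 _ (hcomp K hKφ hK))).1
  have hRS1 := h.one_le_RS
  have ht : ∀ k : ℕ, 0 ≤ RH + k := fun k =>
    add_nonneg (zero_le_one.trans (hRS1.trans hRS)) k.cast_nonneg
  have hcd : ∀ k : ℕ, ContMDiff (𝓡 n) 𝓘(ℝ, ℝ) 1 (G ∘ forwardFlow (radialField g r) (RH + k)) :=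
    fun k => hG.comp (contMDiff_forwardFlow h (ht k))
  -- the times `RH + k` are large enough because `exp (RH + k) ≥ RH`
  refine ⟨hF0, fun i => exists_weakDeriv_of_bounded φ.open_target
    (f := fun k => (G ∘ forwardFlow (radialField g r) (RH + k)) ∘ φ.symm)
    (σ := fun x => r (φ.symm x) ^ (-(n : ℤ)) * chartDensity (formC1 g) φ x /
        coordMatrix (formC1 g) φ x i i)
    (fun k => contDiffOn_comp_symm hφ (k := 1) (hcd k)) hF0 (fun K hKφ hK => ?_) ?_ (fun x hx => ?_)
    ENNReal.ofReal_ne_top fun k => hE.lintegral_partialDeriv_le h hG hφ i (ht k) ?_⟩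
  · obtain ⟨c, hc, hle⟩ := exists_eLpNorm_comp_symm_le gC hφ hKφ hK
    have h1 : Tendsto (fun k : ℕ => RH + k) atTop atTop :=
      tendsto_atTop_add_const_left _ _ tendsto_natCast_atTop_atTop
    have h2 := ENNReal.Tendsto.const_mul ((hlim _ (hcomp K hKφ hK)).comp h1) (Or.inr hc)
    rw [mul_zero] at h2
    refine tendsto_of_tendsto_of_tendsto_of_le_of_le tendsto_const_nhds h2 (fun _ => zero_le)
      fun k => (hle (fun p => G (forwardFlow (radialField g r) (RH + k) p) - F p) ?_).2
    exact (memL2Loc_of_continuous (hcd k).continuous _ (hcomp K hKφ hK)).sub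
      (hF2 _ (hcomp K hKφ hK))
  · have h1 := continuousOn_chartDensity
      fun i j => (contDiffOn_coordMatrix g hφ i j).continuousOn
    have h2 : ContinuousOn (fun x => r (φ.symm x) ^ (-(n : ℤ))) φ.target :=
      (h.continuous.comp_continuousOn φ.symm.continuousOn).zpow₀ _
        fun x _ => Or.inl (h.r_pos _).ne'
    exact (h2.mul h1).div (contDiffOn_coordMatrix g hφ i i).continuousOn fun x hx =>
      ((isInnerField_formC1 g).posDef hφ hx).diag_pos.ne'
  · have h1 := (isInnerField_formC1 g).chartDensity_pos hφ hx
    have h2 : 0 < coordMatrix (formC1 g) φ x i i :=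
      ((isInnerField_formC1 g).posDef hφ hx).diag_pos
    have h3 := h.r_pos (φ.symm x)
    positivity
  · have h1 := Real.add_one_le_exp (RH + k)
    have h2 : (0 : ℝ) ≤ k := k.cast_nonneg
    nlinarith [mul_le_mul_of_nonneg_left hRS1 (Real.exp_pos (RH + k)).le]

end Sobolev

/-! ### The constant -/

section Constants

variable {n : ℕ} {M : Type*} [TopologicalSpace M] [ChartedSpace (EuclideanSpace ℝ (Fin n)) M]
  [IsManifold (𝓡 n) ∞ M] {g : C1Metric n M} {r : M → ℝ} {RS Λ : ℝ}

/-- Far out the gradient of `r` is so close to a unit vector that `|∇r|⁴ ≥ 1/4`. -/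
theorem IsWeaklyConicalEnd.one_le_mul_normGradSq_sq (h : IsWeaklyConicalEnd g r RS Λ) {R : ℝ}
    (hR1 : 1 ≤ R) (hR : 4 * Λ ≤ R) {p : M} (hp : p ∈ outerRegion r R) :
    1 ≤ 4 * normGradSq g r p ^ 2 := by
  have hp' : R < r p := hp
  have h1 : Λ / r p ^ 4 ≤ 1 / 4 := by
    have h2 : r p ≤ r p ^ 4 := le_self_pow₀ (hR1.trans hp'.le) (by norm_num)
    rw [div_le_iff₀ (pow_pos (h.r_pos p) 4)]
    linarith
  have h3 := (abs_le.1 ((h.grad_bound p).trans h1)).1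
  have h4 : 3 / 4 ≤ √(normGradSq g r p) := by linarith
  have h5 : 9 / 16 ≤ normGradSq g r p := by
    rw [← Real.sq_sqrt (h.normGradSq_pos p).le]
    nlinarith
  nlinarith

theorem exp_le_four {Λ R : ℝ} (hR1 : 1 ≤ R) (hR : 18 * n * Λ ≤ R) :
    Real.exp (18 * n * Λ / R ^ 2) ≤ 4 := by
  have h1 : 18 * n * Λ / R ^ 2 ≤ 1 := by
    rw [div_le_one (by positivity)]
    nlinarith
  have h2 := Real.exp_le_exp.2 h1
  linarith [Real.exp_one_lt_d9]

end Constants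

end

end WeaklyConical

theorem propositionA1 (n : ℕ) (Λ : ℝ) :
    ∃ R₁ : ℝ, ∀ (M : Type*) [TopologicalSpace M] [ChartedSpace (EuclideanSpace ℝ (Fin n)) M]
      [IsManifold (𝓡 n) ∞ M] [T2Space M] [SecondCountableTopology M]
      [MeasurableSpace M] [BorelSpace M]
      (g : WeaklyConical.C1Metric n M) (r : M → ℝ) (RS : ℝ),
      WeaklyConical.IsWeaklyConicalEnd g r RS Λ →
      ∃ gC : WeaklyConical.C0Metric n M, WeaklyConical.IsAsymptoticConeMetric g r gC ∧
        ∀ (G : M → ℝ) (α RH : ℝ), ContMDiff (𝓡 n) 𝓘(ℝ, ℝ) 1 G → RS ≤ RH →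
          (∀ R : ℝ, RH ≤ R →
            ∫⁻ p in WeaklyConical.outerRegion r R,
              ENNReal.ofReal (r p ^ (-(n : ℤ)) * WeaklyConical.normGradSq g G p
                + r p ^ (2 - (n : ℤ)) * WeaklyConical.radialDeriv g r G p ^ 2)
              ∂(WeaklyConical.riemannianVolume (WeaklyConical.formC1 g))
              ≤ ENNReal.ofReal (α ^ 2 * (R ^ 2)⁻¹)) →
          WeaklyConical.IsAsymptoticallyHomogeneous g r gC 0 G ∧
          ∀ F : M → ℝ, WeaklyConical.IsLeadingTerm g r gC 0 G F →
            WeaklyConical.MemH1Loc n F ∧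
            ∀ R : ℝ, RH ≤ R → R₁ ≤ R →
              ∫⁻ p in WeaklyConical.outerRegion r R,
                ENNReal.ofReal (r p ^ (-(n : ℤ)) * (F p - G p) ^ 2)
                ∂(WeaklyConical.riemannianVolume (WeaklyConical.formC1 g))
                ≤ ENNReal.ofReal (16 * α ^ 2 * (R ^ 2)⁻¹) := by
  -- Beyond this radius `|∇r|⁻⁴ ≤ 4` and the distortion of `r⁻ⁿ dμ_g` by the flow is at most `4`.
  refine ⟨max 1 (max (4 * Λ) (18 * n * Λ)), fun M _ _ _ _ _ _ _ g r RS h => ?_⟩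
  obtain ⟨gC, hC⟩ := WeaklyConical.exists_coneMetric h
  refine ⟨gC, WeaklyConical.isAsymptoticConeMetric_of_formC0_eq h hC, fun G α RH hG hRS hE => ?_⟩
  replace hE : WeaklyConical.HasEnergyDecay g r G α RH := hE
  have hlead := hE.isLeadingTerm h hC hG hRS
  refine ⟨⟨_, hlead⟩, fun F hF => ⟨hE.memH1Loc h hG hRS hF, fun R hR hR₁ => ?_⟩⟩
  obtain ⟨hR1, hR2⟩ := max_le_iff.1 hR₁
  obtain ⟨hR4, hR18⟩ := max_le_iff.1 hR2
  have hFae := ae_restrict_of_ae (s := WeaklyConical.outerRegion r R)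
    (WeaklyConical.ae_eq_of_isLeadingTerm h hC hG hF hlead)
  rw [lintegral_congr_ae (g := fun p => ENNReal.ofReal
    (r p ^ (-(n : ℤ)) * (WeaklyConical.asymptoticLimit g r G p - G p) ^ 2))
    (hFae.mono fun p hp => by simp only [hp])]
  refine (hE.lintegral_asymptoticLimit_sub_sq_le h hG hRS hR (κ := 4) (by norm_num)
    fun p hp => h.one_le_mul_normGradSq_sq hR1 hR4 hp).trans (ENNReal.ofReal_le_ofReal ?_)
  have h1 := mul_le_mul_of_nonneg_right (WeaklyConical.exp_le_four hR1 hR18)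
    (by positivity : 0 ≤ 4 * (α ^ 2 * (R ^ 2)⁻¹))
  linarith
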